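/- Let $(M,g)$ be a smooth manifold of dimension $n\ge 2$ with a smooth metric of Lorentzian signature $(n-1,1)$, and let $V\subset M$ be a smoothly immersed lightlike hypersurface, i.e. $\dim V=n-1$ and $g$ is degenerate on each tangent hyperplane $T_xV$. A first-order isotropic frame of $V$ at $x$ is a basis $(e_1,e_a,e_n)$ of $T_xM$, $a=2,\dots,n-1$, with $e_1,e_a\in T_xV$, $(e_1,e_1)=(e_n,e_n)=(e_1,e_a)=(e_a,e_n)=0$ and $(e_1,e_n)=-1$. For a smooth field of such frames on an open subset of $V$, let $\omega^i$ and $\omega_i^j$ be the basis forms and the Levi-Civita connection forms restricted to $V$, $dx=\omega^1e_1+\omega^ae_a$, $\nabla e_i=\omega_i^je_j$. Let $\lambda^a_b$ be the shape operator, $\omega_1^a=\lambda^a_b\omega^b$. Let $I$ be a smooth nonvanishing relative invariant of weight 1 of $V$: its value depends on the frame only through $e_1$, it satisfies $I(te_1)=tI(e_1)$ for $t>0$ and $|I(-e_1)|=|I(e_1)|$, and $I(e_1)$ is smooth for every smooth field $e_1$. Then in each isotropic frame field there are coefficients $K,K_a$ with $$d\ln|I|-\omega_1^1=-K\omega^1-K_a\omega^a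 .$$ Suppose that near each point $x\in V$ there is an isotropic frame field in which $K$ is, at $x$, not a root of the characteristic equation $\det(\lambda^a_b-\lambda\delta^a_b)=0$. Then: (i) $K$ is not a root of the characteristic equation in any isotropic frame field. Let $\widetilde\Lambda$ be the inverse of $\Lambda^a_b=\lambda^a_b-K\delta^a_b$, and let $L_a=\widetilde\Lambda_a^bK_b$. The quantities $L_a$ at $x$ depend only on the frame at $x$, and they form a normalizing object: if $e_1'=te_1$ and $e_a'=A_a^be_b+\beta_ae_1$, then $tL_a'=A_a^bL_b-\beta_a$. (ii) The subspace $S_x\subset T_xV$ spanned by the vectors $e_a+L_ae_1$ is the same for all isotropic frames at $x$, and $S=\bigcup_xS_x$ is a smooth screen distribution on $V$, i.e. $T_xV=S_x\oplus\mathbb{R}e_1$ for all $x\in V$. (iii) Suppose that $I$ is intrinsic and defined in a second-order neighborhood: in all coordinate systems of $V$ and $M$ and for all $(M,g,V)$ considered, $I$ is given by one and the same smooth function $F$ of the $1$-jet of the components of $g$, the $2$-jet of the parametrization of $V$ and the components of $e_1$. Then $S$ is intrinsic and defined in a third-order neighborhood: there is one function $\Phi$, depending only on $F$, which for all such $(M,g,V)$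 and in all coordinate systems gives $S_x$ from the $2$-jet of the components of $g$ and the $3$-jet of the parametrization of $V$ at $x$. -/

import Mathlib

universe u v

set_option maxSynthPendingDepth 3

open scoped Manifold ContDiff Topology

noncomputable section

namespace Lightlike

/-- Model space of the ambient manifold, of dimension `n = m + 2`. -/
abbrev E (m : ℕ) : Type := EuclideanSpace ℝ (Fin (m + 2))

/-- Model space of a hypersurface, of dimension `n - 1 = m + 1`. -/
abbrev H (m : ℕ) : Type := EuclideanSpace ℝ (Fin (m + 1))

/-- Bilinear forms on the model space. -/
abbrev Bil (m : ℕ) : Type := E m →L[ℝ] E m →L[ℝ] ℝ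

/-- Indices of a frame `(e_1, e_a, e_n)`, where `a` takes `m = n - 2` values. -/
abbrev Idx (m : ℕ) : Type := Unit ⊕ (Fin m ⊕ Unit)

/-- The index `1`. -/
abbrev Idx.one {m : ℕ} : Idx m := Sum.inl ()

/-- The screen indices `a = 2, …, n - 1`. -/
abbrev Idx.scr {m : ℕ} (a : Fin m) : Idx m := Sum.inr (Sum.inl a)

/-- The index `n`. -/
abbrev Idx.last {m : ℕ} : Idx m := Sum.inr (Sum.inr ())

/-- A smooth metric of Lorentzian signature `(n - 1, 1)` (one negative direction) on `M`. -/
structure LorentzMetric (m : ℕ) (M : Type*) [TopologicalSpace M] [ChartedSpace (E m) M]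
    [IsManifold 𝓘(ℝ, E m) ∞ M] where
  /-- the scalar product on each tangent space -/
  val : ∀ x : M, TangentSpace 𝓘(ℝ, E m) x →L[ℝ] TangentSpace 𝓘(ℝ, E m) x →L[ℝ] ℝ
  symm : ∀ (x : M) (v w : TangentSpace 𝓘(ℝ, E m) x), val x v w = val x w v
  signature : ∀ x : M, ∃ b : Module.Basis (Fin (m + 2)) ℝ (TangentSpace 𝓘(ℝ, E m) x),
    ∀ i j, val x (b i) (b j) = if i = j then (if i = 0 then -1 else 1) else 0
  smooth : ContMDiff 𝓘(ℝ, E m) (𝓘(ℝ, E m).prod 𝓘(ℝ, Bil m)) ∞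
    (fun x ↦ Bundle.TotalSpace.mk' (Bil m) x (val x))

section Coordinates

variable {m : ℕ}

/-- The Christoffel operation of a field `G` of nondegenerate symmetric bilinear forms: the vector
`Γ(u, v)` with `2 G(Γ(u, v), w) = (D_u G)(v, w) + (D_v G)(u, w) - (D_w G)(u, v)` for all `w`. -/
def christoffel (G : E m → Bil m) (y u v : E m) : E m :=
  (1 / 2 : ℝ) • (G y).inverse
    (fderiv ℝ G y u v + fderiv ℝ G y v u - ((fderiv ℝ G y).flip u).flip v)

end Coordinates

variable {m : ℕ} {M : Type*} [TopologicalSpace M] [ChartedSpace (E m) M]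
  [IsManifold 𝓘(ℝ, E m) ∞ M]
  {N : Type*} [TopologicalSpace N] [ChartedSpace (H m) N] [IsManifold 𝓘(ℝ, H m) ∞ N]

/-- The components of the metric in a chart `κ` of `M`. -/
def metricInChart (g : LorentzMetric m M) (κ : OpenPartialHomeomorph M (E m)) (y : E m) : Bil m :=
  let B : Bil m := g.val (κ.symm y)
  let D : E m →L[ℝ] E m := mfderiv 𝓘(ℝ, E m) 𝓘(ℝ, E m) κ.symm y
  B.bilinearComp D D

/-- The tangent hyperplane `T_x(V)` at the point of `V = f(N)` with parameter `p`. -/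
def tangentHyperplane (f : N → M) (p : N) : Submodule ℝ (TangentSpace 𝓘(ℝ, E m) (f p)) :=
  LinearMap.range (mfderiv 𝓘(ℝ, H m) 𝓘(ℝ, E m) f p).toLinearMap

/-- The tangent vectors of `V` that are orthogonal to all of `T_x(V)`. -/
def radical (g : LorentzMetric m M) (f : N → M) (p : N) :
    Submodule ℝ (TangentSpace 𝓘(ℝ, E m) (f p)) where
  carrier := {v | v ∈ tangentHyperplane f p ∧ ∀ w ∈ tangentHyperplane f p, g.val (f p) v w = 0}
  add_mem' := by
    rintro a b ⟨ha, ha'⟩ ⟨hb, hb'⟩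
    exact ⟨add_mem ha hb, fun w hw ↦ by simp [ha' w hw, hb' w hw]⟩
  zero_mem' := ⟨zero_mem _, fun w _ ↦ by simp⟩
  smul_mem' := by
    rintro c a ⟨ha, ha'⟩
    exact ⟨Submodule.smul_mem _ c ha, fun w hw ↦ by simp [ha' w hw]⟩

/-- `f : N → M` is a smoothly immersed lightlike hypersurface: the metric induced on each tangent
hyperplane is degenerate. -/
structure IsLightlikeHypersurface (g : LorentzMetric m M) (f : N → M) : Prop where
  smooth : ContMDiff 𝓘(ℝ, H m) 𝓘(ℝ, E m) ∞ f
  immersion : ∀ p, Function.Injective (mfderiv 𝓘(ℝ, H m) 𝓘(ℝ, E m) f p)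
  degenerate : ∀ p, radical g f p ≠ ⊥

/-- A field of ambient tangent vectors along `f` is smooth on `U`. -/
def SmoothAlongOn (f : N → M) (ξ : ∀ q : N, TangentSpace 𝓘(ℝ, E m) (f q)) (U : Set N) : Prop :=
  ContMDiffOn 𝓘(ℝ, H m) 𝓘(ℝ, E m).tangent ∞
    (fun q ↦ (⟨f q, ξ q⟩ : TangentBundle 𝓘(ℝ, E m) M)) U

/-- The Levi-Civita covariant derivative `∇_X ξ` at `p` of a vector field `ξ` along `f`, computed
in the preferred chart at `f p`: it has components `X(ξ^k) + Γ^k_{ij} (df X)^i ξ^j`. -/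
def covDeriv (g : LorentzMetric m M) (f : N → M) (ξ : ∀ q : N, TangentSpace 𝓘(ℝ, E m) (f q))
    (p : N) (X : TangentSpace 𝓘(ℝ, H m) p) : TangentSpace 𝓘(ℝ, E m) (f p) :=
  let κ := chartAt (E m) (f p)
  let dκ (q : N) : TangentSpace 𝓘(ℝ, E m) (f q) →L[ℝ] E m :=
    mfderiv 𝓘(ℝ, E m) 𝓘(ℝ, E m) κ (f q)
  let ξκ (q : N) : E m := dκ q (ξ q)
  let Dξ : TangentSpace 𝓘(ℝ, H m) p →L[ℝ] E m := mfderiv 𝓘(ℝ, H m) 𝓘(ℝ, E m) ξκ p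
  (dκ p).inverse (Dξ X + christoffel (metricInChart g κ) (κ (f p))
      (dκ p (mfderiv 𝓘(ℝ, H m) 𝓘(ℝ, E m) f p X)) (ξκ p))

/-- A first-order isotropic frame of `V` at `p`: a basis `(e_1, e_a, e_n)` of the ambient tangent
space such that `e_1, e_a` are tangent to `V`, `e_1` and `e_n` are isotropic, both are orthogonal
to the `e_a`, and `(e_1, e_n) = -1`. -/
structure IsIsotropicFrame (g : LorentzMetric m M) (f : N → M) (p : N)
    (b : Module.Basis (Idx m) ℝ (TangentSpace 𝓘(ℝ, E m) (f p))) : Prop where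
  tangent_one : b Idx.one ∈ tangentHyperplane f p
  tangent_scr : ∀ a, b (Idx.scr a) ∈ tangentHyperplane f p
  one_one : g.val (f p) (b Idx.one) (b Idx.one) = 0
  one_scr : ∀ a, g.val (f p) (b Idx.one) (b (Idx.scr a)) = 0
  one_last : g.val (f p) (b Idx.one) (b Idx.last) = -1
  scr_last : ∀ a, g.val (f p) (b (Idx.scr a)) (b Idx.last) = 0
  last_last : g.val (f p) (b Idx.last) (b Idx.last) = 0

/-- A smooth field of first-order isotropic frames over an open set `U` of `V`. -/
structure IsFrameField (g : LorentzMetric m M) (f : N → M) (U : Set N)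
    (e : ∀ q : N, Module.Basis (Idx m) ℝ (TangentSpace 𝓘(ℝ, E m) (f q))) : Prop where
  isOpen : IsOpen U
  smooth : ∀ i, SmoothAlongOn f (fun q ↦ e q i) U
  isotropic : ∀ q ∈ U, IsIsotropicFrame g f q (e q)

/-- The basis form `ω^i` on `V`: `df(X) = ω^i(X) e_i`. -/
def basisForm (f : N → M) (e : ∀ q : N, Module.Basis (Idx m) ℝ (TangentSpace 𝓘(ℝ, E m) (f q)))
    (p : N) (i : Idx m) (X : TangentSpace 𝓘(ℝ, H m) p) : ℝ :=
  (e p).repr (mfderiv 𝓘(ℝ, H m) 𝓘(ℝ, E m) f p X) i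

/-- The connection form `ω_i^j` on `V`: `∇_X e_i = ω_i^j(X) e_j`. -/
def connForm (g : LorentzMetric m M) (f : N → M)
    (e : ∀ q : N, Module.Basis (Idx m) ℝ (TangentSpace 𝓘(ℝ, E m) (f q)))
    (p : N) (i j : Idx m) (X : TangentSpace 𝓘(ℝ, H m) p) : ℝ :=
  (e p).repr (covDeriv g f (fun q ↦ e q i) p X) j

/-- A smooth relative invariant of weight `w` of `V`. Its value `I p v` in a frame at `p` depends
on the frame only through the isotropic vector `v = e_1`, and is multiplied by `t ^ w` when `e_1`
is multiplied by `t > 0`; the sign may or may not change when `e_1` is replaced by `-e_1`. -/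
structure IsRelativeInvariant (g : LorentzMetric m M) (f : N → M) (w : ℤ)
    (I : ∀ p : N, TangentSpace 𝓘(ℝ, E m) (f p) → ℝ) : Prop where
  smooth : ∀ (U : Set N) (ξ : ∀ q : N, TangentSpace 𝓘(ℝ, E m) (f q)), IsOpen U →
    SmoothAlongOn f ξ U → (∀ q ∈ U, ξ q ∈ radical g f q ∧ ξ q ≠ 0) →
    ContMDiffOn 𝓘(ℝ, H m) 𝓘(ℝ, ℝ) ∞ (fun q ↦ I q (ξ q)) U
  smul : ∀ p, ∀ v ∈ radical g f p, v ≠ 0 → ∀ t : ℝ, 0 < t → I p (t • v) = t ^ w * I p v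
  neg : ∀ p, ∀ v ∈ radical g f p, v ≠ 0 → |I p (-v)| = |I p v|

/-- The invariant `I` vanishes in no isotropic frame. -/
def Nonvanishing (g : LorentzMetric m M) (f : N → M)
    (I : ∀ p : N, TangentSpace 𝓘(ℝ, E m) (f p) → ℝ) : Prop :=
  ∀ p, ∀ v ∈ radical g f p, v ≠ 0 → I p v ≠ 0

/-- `lam a b = λ^a_b` is the shape operator at `p` in the given frame field, and `K`, `K_a` are the
coefficients of the form `d ln |I| - ω_1^1` at `p`. -/
structure HasCoefficients (g : LorentzMetric m M) (f : N → M)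
    (I : ∀ p : N, TangentSpace 𝓘(ℝ, E m) (f p) → ℝ)
    (e : ∀ q : N, Module.Basis (Idx m) ℝ (TangentSpace 𝓘(ℝ, E m) (f q))) (p : N)
    (lam : Matrix (Fin m) (Fin m) ℝ) (K : ℝ) (Ka : Fin m → ℝ) : Prop where
  shape : ∀ (a : Fin m) (X : TangentSpace 𝓘(ℝ, H m) p),
    connForm g f e p Idx.one (Idx.scr a) X = ∑ b, lam a b * basisForm f e p (Idx.scr b) X
  dlog : ∀ X : TangentSpace 𝓘(ℝ, H m) p,
    mvfderiv 𝓘(ℝ, H m) (fun q ↦ Real.log |I q (e q Idx.one)|) p X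
        - connForm g f e p Idx.one Idx.one X
      = -(K * basisForm f e p Idx.one X) - ∑ a, Ka a * basisForm f e p (Idx.scr a) X

/-- `L_a = K_b Λ̃^b_a`, where `Λ̃` is the inverse of `Λ^a_b = λ^a_b - K δ^a_b`. -/
def normObj (lam : Matrix (Fin m) (Fin m) ℝ) (K : ℝ) (Ka : Fin m → ℝ) : Fin m → ℝ :=
  Matrix.vecMul Ka (lam - K • (1 : Matrix (Fin m) (Fin m) ℝ))⁻¹

/-- The subspace spanned by the vectors `e_a + z_a e_1`. -/
def screenSpan {x : M} (b : Module.Basis (Idx m) ℝ (TangentSpace 𝓘(ℝ, E m) x)) (z : Fin m → ℝ) :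
    Submodule ℝ (TangentSpace 𝓘(ℝ, E m) x) :=
  Submodule.span ℝ (Set.range fun a ↦ b (Idx.scr a) + z a • b Idx.one)

/-- A normalizing object: a quantity `z_a` attached to the isotropic frames of `V` with the law
`t z'_a = A_a^b z_b - β_a` under `e'_1 = t e_1`, `e'_a = A_a^b e_b + β_a e_1`; this is the
integrated form of `∇_δ z_a + z_a π_1^1 + π_a^1 = 0`. -/
def IsNormalizingObject (g : LorentzMetric m M) (f : N → M)
    (z : ∀ p : N, Module.Basis (Idx m) ℝ (TangentSpace 𝓘(ℝ, E m) (f p)) → Fin m → ℝ) : Prop :=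
  ∀ (p : N) (b b' : Module.Basis (Idx m) ℝ (TangentSpace 𝓘(ℝ, E m) (f p))),
    IsIsotropicFrame g f p b → IsIsotropicFrame g f p b' →
    ∀ (t : ℝ) (A : Matrix (Fin m) (Fin m) ℝ) (β : Fin m → ℝ),
      b' Idx.one = t • b Idx.one →
      (∀ a, b' (Idx.scr a) = (∑ c, A a c • b (Idx.scr c)) + β a • b Idx.one) →
      ∀ a, t * z p b' a = (∑ c, A a c * z p b c) - β a

/-- A smooth screen distribution on `V`: a smooth field of subspaces of the tangent hyperplanes,
complementary in them to the isotropic directions. -/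
structure IsScreenDistribution (g : LorentzMetric m M) (f : N → M)
    (S : ∀ p : N, Submodule ℝ (TangentSpace 𝓘(ℝ, E m) (f p))) : Prop where
  inf_eq : ∀ p, S p ⊓ radical g f p = ⊥
  sup_eq : ∀ p, S p ⊔ radical g f p = tangentHyperplane f p
  smooth : ∀ p, ∃ U : Set N, IsOpen U ∧ p ∈ U ∧
    ∃ s : Fin m → ∀ q : N, TangentSpace 𝓘(ℝ, E m) (f q),
      (∀ a, SmoothAlongOn f (s a) U) ∧
      ∀ q ∈ U, S q = Submodule.span ℝ (Set.range fun a ↦ s a q)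

/-- Near every point there is an isotropic frame field in which the coefficient `K` at the point
is not a root of the characteristic equation of the shape operator. -/
def NotCharacteristicRoot (g : LorentzMetric m M) (f : N → M)
    (I : ∀ p : N, TangentSpace 𝓘(ℝ, E m) (f p) → ℝ) : Prop :=
  ∀ p, ∃ (U : Set N) (e : ∀ q : N, Module.Basis (Idx m) ℝ (TangentSpace 𝓘(ℝ, E m) (f q))),
    p ∈ U ∧ IsFrameField g f U e ∧
    ∃ (lam : Matrix (Fin m) (Fin m) ℝ) (K : ℝ) (Ka : Fin m → ℝ),
      HasCoefficients g f I e p lam K Ka ∧ ¬ lam.charpoly.IsRoot K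

/-- The quantity `z` is `L_a = K_b Λ̃^b_a` in every isotropic frame field, and the field of
subspaces `S` is the one spanned by `e_a + z_a e_1` in every isotropic frame. -/
structure IsInducedNormalization (g : LorentzMetric m M) (f : N → M)
    (I : ∀ p : N, TangentSpace 𝓘(ℝ, E m) (f p) → ℝ)
    (z : ∀ p : N, Module.Basis (Idx m) ℝ (TangentSpace 𝓘(ℝ, E m) (f p)) → Fin m → ℝ)
    (S : ∀ p : N, Submodule ℝ (TangentSpace 𝓘(ℝ, E m) (f p))) : Prop where
  obj_eq : ∀ (U : Set N)
    (e : ∀ q : N, Module.Basis (Idx m) ℝ (TangentSpace 𝓘(ℝ, E m) (f q))), IsFrameField g f U e →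
    ∀ p ∈ U, ∀ (lam : Matrix (Fin m) (Fin m) ℝ) (K : ℝ) (Ka : Fin m → ℝ),
      HasCoefficients g f I e p lam K Ka → z p (e p) = normObj lam K Ka
  screen_eq : ∀ (p : N) (b : Module.Basis (Idx m) ℝ (TangentSpace 𝓘(ℝ, E m) (f p))),
    IsIsotropicFrame g f p b → S p = screenSpan b (z p b)

/-- Second-order data of a hypersurface in coordinates: the 1-jet of the metric and the 2-jet of
the parametrization. -/
abbrev Jet2 (m : ℕ) : Type :=
  (Bil m × (E m →L[ℝ] Bil m)) × ((H m →L[ℝ] E m) × (H m →L[ℝ] H m →L[ℝ] E m))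

/-- Third-order data of a hypersurface in coordinates: the 2-jet of the metric and the 3-jet of
the parametrization. -/
abbrev Jet3 (m : ℕ) : Type :=
  (Bil m × (E m →L[ℝ] Bil m) × (E m →L[ℝ] E m →L[ℝ] Bil m)) ×
    ((H m →L[ℝ] E m) × (H m →L[ℝ] H m →L[ℝ] E m) × (H m →L[ℝ] H m →L[ℝ] H m →L[ℝ] E m))

/-- The second-order data at `p`, in a chart `χ` of `N` and a chart `κ` of `M`. -/
def jet2 (g : LorentzMetric m M) (f : N → M) (χ : OpenPartialHomeomorph N (H m))
    (κ : OpenPartialHomeomorph M (E m)) (p : N) : Jet2 m :=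
  let G : E m → Bil m := metricInChart g κ
  let φ : H m → E m := κ ∘ f ∘ χ.symm
  ((G (κ (f p)), fderiv ℝ G (κ (f p))), (fderiv ℝ φ (χ p), fderiv ℝ (fderiv ℝ φ) (χ p)))

/-- The third-order data at `p`, in a chart `χ` of `N` and a chart `κ` of `M`. -/
def jet3 (g : LorentzMetric m M) (f : N → M) (χ : OpenPartialHomeomorph N (H m))
    (κ : OpenPartialHomeomorph M (E m)) (p : N) : Jet3 m :=
  let G : E m → Bil m := metricInChart g κ
  let φ : H m → E m := κ ∘ f ∘ χ.symm
  ((G (κ (f p)), fderiv ℝ G (κ (f p)), fderiv ℝ (fderiv ℝ G) (κ (f p))),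
    (fderiv ℝ φ (χ p), fderiv ℝ (fderiv ℝ φ) (χ p), fderiv ℝ (fderiv ℝ (fderiv ℝ φ)) (χ p)))

/-- The invariant `I` is intrinsic and of second order: in all coordinate systems of `N` and `M` it
is given by one and the same function `F`, with domain `D`, of the second-order data of the
hypersurface and of the components of `e_1`. -/
def GivenBySecondOrder (F : Jet2 m × E m → ℝ) (D : Set (Jet2 m × E m))
    (g : LorentzMetric m M) (f : N → M)
    (I : ∀ p : N, TangentSpace 𝓘(ℝ, E m) (f p) → ℝ) : Prop :=
  ∀ (p : N), ∀ χ ∈ IsManifold.maximalAtlas 𝓘(ℝ, H m) ∞ N,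
    ∀ κ ∈ IsManifold.maximalAtlas 𝓘(ℝ, E m) ∞ M, p ∈ χ.source → f p ∈ κ.source →
    ∀ v ∈ radical g f p, v ≠ 0 →
      (jet2 g f χ κ p, mfderiv 𝓘(ℝ, E m) 𝓘(ℝ, E m) κ (f p) v) ∈ D ∧
      I p v = F (jet2 g f χ κ p, mfderiv 𝓘(ℝ, E m) 𝓘(ℝ, E m) κ (f p) v)

/-- The field of subspaces `S` is intrinsic and of third order: in all coordinate systems of `N` and
`M` it is given by one and the same function `Φ` of the third-order data of the hypersurface. -/
def GivenByThirdOrder (Φ : Jet3 m → Submodule ℝ (E m)) (g : LorentzMetric m M) (f : N → M)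
    (S : ∀ p : N, Submodule ℝ (TangentSpace 𝓘(ℝ, E m) (f p))) : Prop :=
  ∀ (p : N), ∀ χ ∈ IsManifold.maximalAtlas 𝓘(ℝ, H m) ∞ N,
    ∀ κ ∈ IsManifold.maximalAtlas 𝓘(ℝ, E m) ∞ M, p ∈ χ.source → f p ∈ κ.source →
    (S p).map (mfderiv 𝓘(ℝ, E m) 𝓘(ℝ, E m) κ (f p)).toLinearMap = Φ (jet3 g f χ κ p)

end Lightlike

end

/-!
A lightlike hypersurface carries an isotropic direction but no preferred vector in it. A
nonvanishing relative invariant `I` of weight one selects such a vector up to sign: the vector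
`ν = e_1 / |I(e_1)|` with `|I(ν)| = 1` does not depend on the frame (`IsUnitField`). The null
generators of the hypersurface are geodesics, hence `∇_ν ν = k ν` for a function `k`
(`IsAcceleration`), and the linear map `X ↦ ∇_X ν - k df(X)` (`screenMap`) vanishes on the isotropic
direction. In a frame with `e_1 = |I(e_1)| ν` the equations for `d ln |I| - ω_1^1` and `ω_1^a` show
that, up to the factor `|I(e_1)|`, it sends `e_b` to `K_b e_1 + (λ^a_b - K δ^a_b) e_a`, and
`K = k |I(e_1)|` (`HasCoefficients.smul_screenMap`).

Hence `K` is not a characteristic root exactly when the range of the screen map together with the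
isotropic direction spans the tangent hyperplane (`HasCoefficients.not_isRoot_iff`), a condition
without frames, and then this range is the span of the vectors `e_a + L_a e_1`
(`HasCoefficients.range_screenMap`). A change of the sign of `ν` does not change the range
(`IsUnitField.range_screenMap_eq`). So the screen is independent of the frame, it determines the
`L_a` at the point in every frame there, and their transformation law is that of the coordinates of
a fixed complement of the isotropic direction (`mul_eq_of_screenSpan_eq`). The screen is smooth
since it is the range of a smooth family of linear maps of constant rank (`exists_smooth_spanning`).

For the third-order dependence, `ν` and its first derivatives are found from the third-order data by
algebraic equations (`IsUnitJet`): `ν` is tangent, orthogonal to the hypersurface and satisfies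
`|F| = 1`, and its derivatives satisfy the derivatives of the last two conditions. Orthogonality
determines the derivative of `ν` up to multiples of `ν`. These are excluded by the normalization,
since `F` is homogeneous of degree one in `e_1`, so that its derivative in the direction of `ν` is
`F ≠ 0` by Euler's relation (`IsUnitJet.eq_of_eq`). The second derivatives of the metric and the
third derivatives of the parametrization enter only through the derivative of `F`. The remaining
ingredients of the screen, the Christoffel symbols and `k`, are of lower order.
-/

noncomputable section

/-! ### Covariant differentiation in coordinates -/

namespace Lightlike

section Coordinates

variable {m : ℕ}

theorem christoffel_spec {G : E m → Bil m} {y : E m} (hG : (G y).IsInvertible) (u v w : E m) :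
    2 * G y (christoffel G y u v) w
      = fderiv ℝ G y u v w + fderiv ℝ G y v u w - fderiv ℝ G y w u v := by
  unfold christoffel
  rw [map_smul, hG.self_apply_inverse]
  simp

theorem fderiv_apply_symm {G : E m → Bil m} {y : E m} (hd : DifferentiableAt ℝ G y)
    (hs : ∀ z v w, G z v w = G z w v) (u v w : E m) :
    fderiv ℝ G y u v w = fderiv ℝ G y u w v := by
  have h (v w : E m) := (hd.hasFDerivAt.clm_apply (hasFDerivAt_const v y)).clm_apply
    (hasFDerivAt_const w y)
  have h1 := h v w
  rw [funext fun z ↦ hs z v w] at h1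
  simpa using DFunLike.congr_fun (h1.unique (h w v)) u

theorem christoffel_symm {G : E m → Bil m} {y : E m} (hd : DifferentiableAt ℝ G y)
    (hs : ∀ z v w, G z v w = G z w v) (u v : E m) :
    christoffel G y u v = christoffel G y v u := by
  unfold christoffel
  congr 2
  ext w
  simp [fderiv_apply_symm hd hs w u v, add_comm]

/-- The components of the covariant derivative of the field with components `η` along the
parametrization `φ`, in the direction of the vector `Y` of the parameter space. -/
def coordCov (G : E m → Bil m) (φ η : H m → E m) (x Y : H m) : E m :=
  fderiv ℝ η x Y + christoffel G (φ x) (fderiv ℝ φ x Y) (η x)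

theorem christoffel_add (G : E m → Bil m) (y u u' v : E m) :
    christoffel G y (u + u') v = christoffel G y u v + christoffel G y u' v := by
  simp only [christoffel, map_add, ContinuousLinearMap.flip_add, add_apply, map_sub, smul_add,
    smul_sub]
  abel

theorem christoffel_smul (G : E m → Bil m) (y u v : E m) (c : ℝ) :
    christoffel G y (c • u) v = c • christoffel G y u v := by
  simp only [christoffel, map_smul, smul_apply, map_sub, map_add,
    ContinuousLinearMap.flip_smul, smul_add, smul_sub, smul_comm c (1 / 2 : ℝ)]

theorem christoffel_smul_right (G : E m → Bil m) (y u v : E m) (c : ℝ) :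
    christoffel G y u (c • v) = c • christoffel G y u v := by
  simp only [christoffel, map_smul, smul_apply, map_sub, map_add,
    smul_add, smul_sub, smul_comm c (1 / 2 : ℝ)]

theorem apply_add_christoffel_add (L : E m →L[ℝ] E m) (D A : H m →L[ℝ] E m) (G : E m → Bil m)
    (y v : E m) (Y Z : H m) :
    L (D (Y + Z) + christoffel G y (A (Y + Z)) v)
      = L (D Y + christoffel G y (A Y) v) + L (D Z + christoffel G y (A Z) v) := by
  simp only [map_add, christoffel_add]
  abel

theorem apply_smul_add_christoffel_smul (L : E m →L[ℝ] E m) (D A : H m →L[ℝ] E m)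
    (G : E m → Bil m) (y v : E m) (c : ℝ) (Y : H m) :
    L (D (c • Y) + christoffel G y (A (c • Y)) v)
      = c • L (D Y + christoffel G y (A Y) v) := by
  simp only [map_smul, map_add, christoffel_smul, smul_add]

/-- The Leibniz rule. -/
theorem coordCov_fun_smul (G : E m → Bil m) {φ η : H m → E m} {c : H m → ℝ} {x : H m}
    (hc : DifferentiableAt ℝ c x) (hη : DifferentiableAt ℝ η x) (Y : H m) :
    coordCov G φ (fun z ↦ c z • η z) x Y
      = fderiv ℝ c x Y • η x + c x • coordCov G φ η x Y := by
  have h := (hc.hasFDerivAt.fun_smul hη.hasFDerivAt).fderiv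
  simp only [coordCov, h, christoffel_smul_right]
  simp
  abel

/-- The Levi-Civita connection is compatible with the metric. -/
theorem fderiv_inner_coordCov {G : E m → Bil m} {φ η ζ : H m → E m} {x : H m}
    (hG : (G (φ x)).IsInvertible) (hd : DifferentiableAt ℝ G (φ x))
    (hs : ∀ z v w, G z v w = G z w v) (hφ : DifferentiableAt ℝ φ x)
    (hη : DifferentiableAt ℝ η x) (hζ : DifferentiableAt ℝ ζ x) (Y : H m) :
    fderiv ℝ (fun z ↦ G (φ z) (η z) (ζ z)) x Y
      = G (φ x) (coordCov G φ η x Y) (ζ x) + G (φ x) (η x) (coordCov G φ ζ x Y) := by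
  have h1 : HasFDerivAt (fun z ↦ G (φ z)) ((fderiv ℝ G (φ x)).comp (fderiv ℝ φ x)) x :=
    hd.hasFDerivAt.comp x hφ.hasFDerivAt
  have h2 := (h1.clm_apply hη.hasFDerivAt).clm_apply hζ.hasFDerivAt
  rw [h2.fderiv]
  simp only [coordCov, map_add, add_apply, ContinuousLinearMap.comp_apply,
    ContinuousLinearMap.flip_apply]
  have e1 := christoffel_spec hG (fderiv ℝ φ x Y) (η x) (ζ x)
  have e2 := christoffel_spec hG (fderiv ℝ φ x Y) (ζ x) (η x)
  rw [hs _ (η x) (christoffel G (φ x) (fderiv ℝ φ x Y) (ζ x))]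
  have e3 := fderiv_apply_symm hd hs (fderiv ℝ φ x Y) (η x) (ζ x)
  have e4 := fderiv_apply_symm hd hs (η x) (fderiv ℝ φ x Y) (ζ x)
  have e5 := fderiv_apply_symm hd hs (ζ x) (fderiv ℝ φ x Y) (η x)
  linarith

/-- The Levi-Civita connection is torsion-free: the covariant derivatives of the coordinate fields
of the hypersurface commute. -/
theorem coordCov_coordField_symm {G : E m → Bil m} {φ : H m → E m} {x : H m}
    (hd : DifferentiableAt ℝ G (φ x)) (hs : ∀ z v w, G z v w = G z w v)
    (hφ : ContDiffAt ℝ 2 φ x) (Y Z : H m) :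
    coordCov G φ (fun z ↦ fderiv ℝ φ z Z) x Y = coordCov G φ (fun z ↦ fderiv ℝ φ z Y) x Z := by
  have hφ' : DifferentiableAt ℝ (fderiv ℝ φ) x :=
    (hφ.fderiv_right (m := 1) (by norm_num)).differentiableAt (by norm_num)
  have h (Z : H m) : fderiv ℝ (fun z ↦ fderiv ℝ φ z Z) x = (fderiv ℝ (fderiv ℝ φ) x).flip Z := by
    have := hφ'.hasFDerivAt.clm_apply (hasFDerivAt_const Z x)
    rw [this.fderiv]; ext; simp
  simp only [coordCov, h, ContinuousLinearMap.flip_apply]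
  rw [(hφ.isSymmSndFDerivAt (by simp)).eq Y Z, christoffel_symm hd hs]

/-- For a field orthogonal to the hypersurface near the point, pairing its covariant derivative with
a coordinate field is, up to sign, pairing the field with the covariant derivative of the coordinate
field. The latter is symmetric, which makes the shape operator symmetric. -/
theorem inner_coordCov_of_orthogonal {G : E m → Bil m} {φ η : H m → E m} {x : H m}
    (hG : (G (φ x)).IsInvertible) (hd : DifferentiableAt ℝ G (φ x))
    (hs : ∀ z v w, G z v w = G z w v) (hφ : ContDiffAt ℝ 2 φ x)
    (hη : DifferentiableAt ℝ η x)
    (horth : ∀ᶠ z in 𝓝 x, ∀ Y, G (φ z) (η z) (fderiv ℝ φ z Y) = 0) (Y Z : H m) :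
    G (φ x) (coordCov G φ η x Y) (fderiv ℝ φ x Z)
      = - G (φ x) (η x) (coordCov G φ (fun z ↦ fderiv ℝ φ z Z) x Y) := by
  have hφ' : DifferentiableAt ℝ (fderiv ℝ φ) x :=
    (hφ.fderiv_right (m := 1) (by norm_num)).differentiableAt (by norm_num)
  have hζ : DifferentiableAt ℝ (fun z ↦ fderiv ℝ φ z Z) x :=
    hφ'.clm_apply (differentiableAt_const Z)
  have h := fderiv_inner_coordCov hG hd hs (hφ.differentiableAt (by norm_num)) hη hζ Y
  have h0 : (fun z ↦ G (φ z) (η z) (fderiv ℝ φ z Z)) =ᶠ[𝓝 x] fun _ ↦ 0 :=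
    horth.mono fun z hz ↦ hz Z
  rw [h0.fderiv_eq] at h
  simp at h
  linarith

theorem inner_coordCov_symm {G : E m → Bil m} {φ η : H m → E m} {x : H m}
    (hG : (G (φ x)).IsInvertible) (hd : DifferentiableAt ℝ G (φ x))
    (hs : ∀ z v w, G z v w = G z w v) (hφ : ContDiffAt ℝ 2 φ x)
    (hη : DifferentiableAt ℝ η x)
    (horth : ∀ᶠ z in 𝓝 x, ∀ Y, G (φ z) (η z) (fderiv ℝ φ z Y) = 0) (Y Z : H m) :
    G (φ x) (coordCov G φ η x Y) (fderiv ℝ φ x Z)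
      = G (φ x) (coordCov G φ η x Z) (fderiv ℝ φ x Y) := by
  rw [inner_coordCov_of_orthogonal hG hd hs hφ hη horth,
    inner_coordCov_of_orthogonal hG hd hs hφ hη horth, coordCov_coordField_symm hd hs hφ]

theorem inner_coordCov_self {G : E m → Bil m} {φ η : H m → E m} {x : H m}
    (hG : (G (φ x)).IsInvertible) (hd : DifferentiableAt ℝ G (φ x))
    (hs : ∀ z v w, G z v w = G z w v) (hφ : DifferentiableAt ℝ φ x)
    (hη : DifferentiableAt ℝ η x)
    (hiso : ∀ᶠ z in 𝓝 x, G (φ z) (η z) (η z) = 0) (Y : H m) :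
    G (φ x) (coordCov G φ η x Y) (η x) = 0 := by
  have h := fderiv_inner_coordCov hG hd hs hφ hη hη Y
  have h0 : (fun z ↦ G (φ z) (η z) (η z)) =ᶠ[𝓝 x] fun _ ↦ 0 := hiso
  rw [h0.fderiv_eq, hs _ (η x)] at h
  simp at h
  linarith

/-- The transformation law of the Christoffel operation under a change of coordinates `ψ`. -/
theorem fderiv_christoffel {G G' : E m → Bil m} {ψ : E m → E m} {y : E m}
    (hψ : ContDiffAt ℝ 2 ψ y) (hψi : (fderiv ℝ ψ y).IsInvertible)
    (hG : (G y).IsInvertible) (hG' : (G' (ψ y)).IsInvertible)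
    (hd : DifferentiableAt ℝ G' (ψ y)) (hs : ∀ z v w, G' z v w = G' z w v)
    (heq : ∀ᶠ z in 𝓝 y, ∀ v w, G z v w = G' (ψ z) (fderiv ℝ ψ z v) (fderiv ℝ ψ z w))
    (hdG : DifferentiableAt ℝ G y) (u v : E m) :
    fderiv ℝ ψ y (christoffel G y u v)
      = christoffel G' (ψ y) (fderiv ℝ ψ y u) (fderiv ℝ ψ y v)
        + fderiv ℝ (fderiv ℝ ψ) y u v := by
  have hψ' : DifferentiableAt ℝ (fderiv ℝ ψ) y :=
    (hψ.fderiv_right (m := 1) (by norm_num)).differentiableAt (by norm_num)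
  have hψ0 : DifferentiableAt ℝ ψ y := hψ.differentiableAt (by norm_num)
  have hsym := hψ.isSymmSndFDerivAt (by simp)
  -- the derivative of the metric components, by the product rule
  have key (u v w : E m) : fderiv ℝ G y u v w
      = fderiv ℝ G' (ψ y) (fderiv ℝ ψ y u) (fderiv ℝ ψ y v) (fderiv ℝ ψ y w)
        + G' (ψ y) (fderiv ℝ (fderiv ℝ ψ) y u v) (fderiv ℝ ψ y w)
        + G' (ψ y) (fderiv ℝ ψ y v) (fderiv ℝ (fderiv ℝ ψ) y u w) := by
    have h1 := (hdG.hasFDerivAt.clm_apply (hasFDerivAt_const v y)).clm_apply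
      (hasFDerivAt_const w y)
    have h2 := ((hd.hasFDerivAt.comp y hψ0.hasFDerivAt).clm_apply
      (hψ'.hasFDerivAt.clm_apply (hasFDerivAt_const v y))).clm_apply
      (hψ'.hasFDerivAt.clm_apply (hasFDerivAt_const w y))
    have h3 := h1.congr_of_eventuallyEq (heq.mono fun z hz ↦ (hz v w).symm)
    have h4 := DFunLike.congr_fun (h3.unique h2) u
    simp at h4
    linarith
  have hinj : Function.Injective (G' (ψ y)) := hG'.injective
  apply hinj
  ext w'
  obtain ⟨w, rfl⟩ := hψi.surjective w'
  have e1 := christoffel_spec hG u v w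
  have e2 := christoffel_spec hG' (fderiv ℝ ψ y u) (fderiv ℝ ψ y v) (fderiv ℝ ψ y w)
  rw [heq.self_of_nhds, key, key, key, hsym.eq v u, hsym.eq w u, hsym.eq w v] at e1
  rw [hs _ (fderiv ℝ ψ y u) (fderiv ℝ (fderiv ℝ ψ) y v w)] at e1
  rw [map_add, add_apply]
  rw [hs _ (fderiv ℝ ψ y v) (fderiv ℝ (fderiv ℝ ψ) y u w)] at e1
  linarith

/-- The covariant derivative of a field along the hypersurface is independent of the coordinates
of the ambient manifold. -/
theorem fderiv_coordCov {G G' : E m → Bil m} {ψ : E m → E m} {φ φ' η η' : H m → E m} {x : H m}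
    (hψ : ContDiffAt ℝ 2 ψ (φ x)) (hψi : (fderiv ℝ ψ (φ x)).IsInvertible)
    (hG : (G (φ x)).IsInvertible) (hG' : (G' (ψ (φ x))).IsInvertible)
    (hd : DifferentiableAt ℝ G' (ψ (φ x))) (hs : ∀ z v w, G' z v w = G' z w v)
    (heq : ∀ᶠ z in 𝓝 (φ x), ∀ v w, G z v w = G' (ψ z) (fderiv ℝ ψ z v) (fderiv ℝ ψ z w))
    (hdG : DifferentiableAt ℝ G (φ x)) (hφ : DifferentiableAt ℝ φ x)
    (hη : DifferentiableAt ℝ η x)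
    (hφ' : φ' =ᶠ[𝓝 x] ψ ∘ φ) (hη' : η' =ᶠ[𝓝 x] fun z ↦ fderiv ℝ ψ (φ z) (η z)) (Y : H m) :
    fderiv ℝ ψ (φ x) (coordCov G φ η x Y) = coordCov G' φ' η' x Y := by
  have hψ' : DifferentiableAt ℝ (fderiv ℝ ψ) (φ x) :=
    (hψ.fderiv_right (m := 1) (by norm_num)).differentiableAt (by norm_num)
  have hψ0 : DifferentiableAt ℝ ψ (φ x) := hψ.differentiableAt (by norm_num)
  have h1 := (hψ0.hasFDerivAt.comp x hφ.hasFDerivAt).congr_of_eventuallyEq hφ'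
  have h2 := ((hψ'.hasFDerivAt.comp x hφ.hasFDerivAt).clm_apply
    hη.hasFDerivAt).congr_of_eventuallyEq hη'
  simp only [coordCov, h1.fderiv, h2.fderiv, hφ'.self_of_nhds, hη'.self_of_nhds, map_add,
    fderiv_christoffel hψ hψi hG hG' hd hs heq hdG]
  simp
  abel

theorem contDiffAt_christoffel {G : E m → Bil m} {φ a b : H m → E m} {x : H m}
    (hG : (G (φ x)).IsInvertible) (hd : ContDiffAt ℝ ∞ G (φ x)) (hφ : ContDiffAt ℝ ∞ φ x)
    (ha : ContDiffAt ℝ ∞ a x) (hb : ContDiffAt ℝ ∞ b x) :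
    ContDiffAt ℝ ∞ (fun z ↦ christoffel G (φ z) (a z) (b z)) x := by
  have hG1 : ContDiffAt ℝ ∞ (fun z ↦ G (φ z)) x := hd.comp x hφ
  have hG2 : ContDiffAt ℝ ∞ (fun z ↦ fderiv ℝ G (φ z)) x :=
    (hd.fderiv_right (m := ∞) (by simp)).comp x hφ
  have hinv : ContDiffAt ℝ ∞ (fun z ↦ (G (φ z)).inverse) x :=
    ContDiffAt.comp (g := ContinuousLinearMap.inverse) x hG.contDiffAt_map_inverse hG1
  have hflip : ContDiffAt ℝ ∞ (fun z ↦ ((fderiv ℝ G (φ z)).flip (a z)).flip (b z)) x := by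
    have h1 : ContDiffAt ℝ ∞ (fun z ↦ (fderiv ℝ G (φ z)).flip) x :=
      ((ContinuousLinearMap.flipₗᵢ ℝ (E m) (E m) (E m →L[ℝ] ℝ)).contDiff.contDiffAt).comp x hG2
    have h2 : ContDiffAt ℝ ∞ (fun z ↦ ((fderiv ℝ G (φ z)).flip (a z)).flip) x :=
      ((ContinuousLinearMap.flipₗᵢ ℝ (E m) (E m) ℝ).contDiff.contDiffAt).comp x (h1.clm_apply ha)
    exact h2.clm_apply hb
  unfold christoffel
  exact contDiffAt_const.fun_smul (hinv.clm_apply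
    ((((hG2.clm_apply ha).clm_apply hb).add ((hG2.clm_apply hb).clm_apply ha)).sub hflip))

theorem contDiffAt_coordCov {G : E m → Bil m} {φ η : H m → E m} {Y : H m → H m} {x : H m}
    (hG : (G (φ x)).IsInvertible) (hd : ContDiffAt ℝ ∞ G (φ x)) (hφ : ContDiffAt ℝ ∞ φ x)
    (hη : ContDiffAt ℝ ∞ η x) (hY : ContDiffAt ℝ ∞ Y x) :
    ContDiffAt ℝ ∞ (fun z ↦ coordCov G φ η z (Y z)) x :=
  ((hη.fderiv_right (m := ∞) (by simp)).clm_apply hY).add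
    (contDiffAt_christoffel hG hd hφ ((hφ.fderiv_right (m := ∞) (by simp)).clm_apply hY) hη)

end Coordinates

end Lightlike

/-! ### Charts and the components of the metric -/

namespace Lightlike

section Charts

variable {F : Type*} [NormedAddCommGroup F] [NormedSpace ℝ F]
  {X : Type*} [TopologicalSpace X] [ChartedSpace F X]

theorem chart_mdifferentiable {κ : OpenPartialHomeomorph X F}
    (hκ : κ ∈ IsManifold.maximalAtlas 𝓘(ℝ, F) ∞ X) : κ.MDifferentiable 𝓘(ℝ, F) 𝓘(ℝ, F) :=
  ⟨(contMDiffOn_of_mem_maximalAtlas hκ).mdifferentiableOn (by simp),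
    (contMDiffOn_symm_of_mem_maximalAtlas hκ).mdifferentiableOn (by simp)⟩

theorem isInvertible_mfderiv_chart {κ : OpenPartialHomeomorph X F}
    (hκ : κ ∈ IsManifold.maximalAtlas 𝓘(ℝ, F) ∞ X) {x : X} (hx : x ∈ κ.source) :
    (mfderiv 𝓘(ℝ, F) 𝓘(ℝ, F) κ x).IsInvertible :=
  ⟨(chart_mdifferentiable hκ).mfderiv hx, rfl⟩

theorem mfderiv_chart_symm_apply {κ : OpenPartialHomeomorph X F}
    (hκ : κ ∈ IsManifold.maximalAtlas 𝓘(ℝ, F) ∞ X) {x : X} (hx : x ∈ κ.source) (v : F) :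
    (mfderiv 𝓘(ℝ, F) 𝓘(ℝ, F) κ.symm (κ x) v : F)
      = (mfderiv 𝓘(ℝ, F) 𝓘(ℝ, F) κ x).inverse v := by
  obtain ⟨w, rfl⟩ := (isInvertible_mfderiv_chart hκ hx).surjective v
  exact (DFunLike.congr_fun ((chart_mdifferentiable hκ).symm_comp_deriv hx) w).trans
    ((isInvertible_mfderiv_chart hκ hx).inverse_apply_self w).symm

theorem contDiffAt_transition {κ κ' : OpenPartialHomeomorph X F}
    (hκ : κ ∈ IsManifold.maximalAtlas 𝓘(ℝ, F) ∞ X) (hκ' : κ' ∈ IsManifold.maximalAtlas 𝓘(ℝ, F) ∞ X)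
    {x : X} (hx : x ∈ κ.source) (hx' : x ∈ κ'.source) :
    ContDiffAt ℝ ∞ (κ' ∘ κ.symm) (κ x) := by
  rw [← contMDiffAt_iff_contDiffAt]
  refine ContMDiffAt.comp (I' := 𝓘(ℝ, F)) (κ x) ?_
    (contMDiffAt_symm_of_mem_maximalAtlas hκ (κ.map_source hx))
  rw [κ.left_inv hx]
  exact contMDiffAt_of_mem_maximalAtlas hκ' hx'

theorem mfderiv_chart_eq_transition {κ κ' : OpenPartialHomeomorph X F}
    (hκ : κ ∈ IsManifold.maximalAtlas 𝓘(ℝ, F) ∞ X) (hκ' : κ' ∈ IsManifold.maximalAtlas 𝓘(ℝ, F) ∞ X)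
    {x : X} (hx : x ∈ κ.source) (hx' : x ∈ κ'.source) (v : TangentSpace 𝓘(ℝ, F) x) :
    (mfderiv 𝓘(ℝ, F) 𝓘(ℝ, F) κ' x v : F)
      = fderiv ℝ (κ' ∘ κ.symm) (κ x) (mfderiv 𝓘(ℝ, F) 𝓘(ℝ, F) κ x v) := by
  have h1 : HasMFDerivAt 𝓘(ℝ, F) 𝓘(ℝ, F) (κ' ∘ κ.symm) (κ x)
      (fderiv ℝ (κ' ∘ κ.symm) (κ x)) :=
    ((contDiffAt_transition hκ hκ' hx hx').differentiableAt (by simp)).hasFDerivAt.hasMFDerivAt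
  have h2 := h1.comp x ((chart_mdifferentiable hκ).mdifferentiableAt hx).hasMFDerivAt
  have h3 : (κ' ∘ κ.symm) ∘ κ =ᶠ[𝓝 x] κ' := by
    filter_upwards [κ.open_source.mem_nhds hx] with z hz
    simp [κ.left_inv hz]
  have h4 := (h2.congr_of_eventuallyEq h3.symm).mfderiv
  rw [h4]
  rfl

end Charts

variable {m : ℕ} {M : Type*} [TopologicalSpace M] [ChartedSpace (E m) M]
  [IsManifold 𝓘(ℝ, E m) ∞ M]
  {N : Type*} [TopologicalSpace N] [ChartedSpace (H m) N]

theorem metricInChart_symm (g : LorentzMetric m M) (κ : OpenPartialHomeomorph M (E m))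
    (y v w : E m) : metricInChart g κ y v w = metricInChart g κ y w v :=
  g.symm _ _ _

theorem metricInChart_mfderiv (g : LorentzMetric m M) {κ : OpenPartialHomeomorph M (E m)}
    (hκ : κ ∈ IsManifold.maximalAtlas 𝓘(ℝ, E m) ∞ M) {q : M} (hq : q ∈ κ.source)
    (v w : TangentSpace 𝓘(ℝ, E m) q) :
    metricInChart g κ (κ q) (mfderiv 𝓘(ℝ, E m) 𝓘(ℝ, E m) κ q v)
      (mfderiv 𝓘(ℝ, E m) 𝓘(ℝ, E m) κ q w) = g.val q v w := by
  have h (v : TangentSpace 𝓘(ℝ, E m) q) : mfderiv 𝓘(ℝ, E m) 𝓘(ℝ, E m) κ.symm (κ q)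
      (mfderiv 𝓘(ℝ, E m) 𝓘(ℝ, E m) κ q v) = v :=
    DFunLike.congr_fun ((chart_mdifferentiable hκ).symm_comp_deriv hq) v
  have key (q' : M) (hq' : q' = q) (v' w' : E m) : g.val q' v' w' = g.val q v' w' := by
    rw [hq']
  refine (key _ (κ.left_inv hq) _ _).trans ?_
  erw [h v, h w]

theorem LorentzMetric.eq_zero_of_forall (g : LorentzMetric m M) {x : M}
    {v : TangentSpace 𝓘(ℝ, E m) x} (hv : ∀ w, g.val x v w = 0) : v = 0 := by
  obtain ⟨b, hb⟩ := g.signature x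
  rw [← b.sum_repr v]
  refine Finset.sum_eq_zero fun j _ ↦ ?_
  have h := hv (b j)
  rw [← b.sum_repr v] at h
  simp only [map_sum, map_smul, sum_apply, smul_apply, hb, smul_eq_mul] at h
  simp only [mul_ite, mul_zero, Finset.sum_ite_eq', Finset.mem_univ,
    if_true] at h
  have : b.repr v j = 0 := by
    by_contra hne
    rcases eq_or_ne j 0 with rfl | hj
    · simp_all
    · simp_all
  simp [this]

theorem isInvertible_of_nondegenerate {B : Bil m} (h : ∀ v, (∀ w, B v w = 0) → v = 0) :
    B.IsInvertible := by
  have hinj : Function.Injective B.toLinearMap := by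
    rw [← LinearMap.ker_eq_bot, LinearMap.ker_eq_bot']
    intro v hv
    exact h v fun w ↦ by simpa using DFunLike.congr_fun hv w
  have hdim : Module.finrank ℝ (E m) = Module.finrank ℝ (E m →L[ℝ] ℝ) := by
    rw [← LinearEquiv.finrank_eq (LinearMap.toContinuousLinearMap (𝕜 := ℝ) (E := E m) (F' := ℝ))]
    exact (Subspace.dual_finrank_eq).symm
  refine ⟨(LinearEquiv.ofInjectiveOfFinrankEq B.toLinearMap hinj hdim).toContinuousLinearEquiv, ?_⟩
  ext v w
  rfl

theorem isInvertible_metricInChart (g : LorentzMetric m M) {κ : OpenPartialHomeomorph M (E m)}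
    (hκ : κ ∈ IsManifold.maximalAtlas 𝓘(ℝ, E m) ∞ M) {q : M} (hq : q ∈ κ.source) :
    (metricInChart g κ (κ q)).IsInvertible := by
  refine isInvertible_of_nondegenerate fun v hv ↦ ?_
  obtain ⟨v, rfl⟩ := (isInvertible_mfderiv_chart hκ hq).surjective v
  have : v = 0 := g.eq_zero_of_forall fun w ↦ by
    rw [← metricInChart_mfderiv g hκ hq]
    exact hv _
  rw [this, map_zero]
  rfl

/-- A smooth map into the model space of a chart defines a smooth family of tangent vectors. -/
theorem contMDiffOn_totalSpace_of_components {κ : OpenPartialHomeomorph M (E m)}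
    (hκ : κ ∈ IsManifold.maximalAtlas 𝓘(ℝ, E m) ∞ M)
    {F : Type*} [NormedAddCommGroup F] [NormedSpace ℝ F]
    {X : Type*} [TopologicalSpace X] [ChartedSpace F X] {a σ : X → E m} {U : Set X}
    (ha : ContMDiffOn 𝓘(ℝ, F) 𝓘(ℝ, E m) ∞ a U) (hσ : ContMDiffOn 𝓘(ℝ, F) 𝓘(ℝ, E m) ∞ σ U)
    (hU : Set.MapsTo a U κ.target) :
    ContMDiffOn 𝓘(ℝ, F) 𝓘(ℝ, E m).tangent ∞
      (fun x ↦ (⟨κ.symm (a x), mfderiv 𝓘(ℝ, E m) 𝓘(ℝ, E m) κ.symm (a x) (σ x)⟩ :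
        TangentBundle 𝓘(ℝ, E m) M)) U := by
  have h1 := (contMDiffOn_symm_of_mem_maximalAtlas hκ).contMDiffOn_tangentMapWithin (m := ∞)
    (by simp) κ.open_target.uniqueMDiffOn
  have h2 : ContMDiffOn 𝓘(ℝ, F) 𝓘(ℝ, E m).tangent ∞
      (fun x ↦ (⟨a x, σ x⟩ : TangentBundle 𝓘(ℝ, E m) (E m))) U := by
    intro x hx
    rw [Bundle.contMDiffWithinAt_totalSpace]
    refine ⟨ha x hx, ?_⟩
    simpa using! hσ x hx
  refine (h1.comp h2 fun x hx ↦ hU hx).congr fun x hx ↦ ?_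
  simp only [Function.comp_apply, tangentMapWithin]
  rw [mfderivWithin_of_isOpen κ.open_target (hU hx)]

theorem contDiffAt_metricInChart (g : LorentzMetric m M) {κ : OpenPartialHomeomorph M (E m)}
    (hκ : κ ∈ IsManifold.maximalAtlas 𝓘(ℝ, E m) ∞ M) {q : M} (hq : q ∈ κ.source) :
    ContDiffAt ℝ ∞ (metricInChart g κ) (κ q) := by
  have hsec (v : E m) : ContMDiffOn 𝓘(ℝ, E m) 𝓘(ℝ, E m).tangent ∞
      (fun y : E m ↦ (⟨κ.symm y, mfderiv 𝓘(ℝ, E m) 𝓘(ℝ, E m) κ.symm y v⟩ :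
        TangentBundle 𝓘(ℝ, E m) M)) κ.target :=
    contMDiffOn_totalSpace_of_components hκ contMDiffOn_id contMDiffOn_const fun _ h ↦ h
  have hval (v w : E m) : ContDiffOn ℝ ∞ (fun y ↦ metricInChart g κ y v w) κ.target := by
    rw [← contMDiffOn_iff_contDiffOn]
    have : ContMDiffOn 𝓘(ℝ, E m) (𝓘(ℝ, E m).prod 𝓘(ℝ)) ∞
        (fun y ↦ Bundle.TotalSpace.mk' ℝ (E := Bundle.Trivial M ℝ) (κ.symm y)
          (g.val (κ.symm y) (mfderiv 𝓘(ℝ, E m) 𝓘(ℝ, E m) κ.symm y v)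
            (mfderiv 𝓘(ℝ, E m) 𝓘(ℝ, E m) κ.symm y w))) κ.target := by
      apply ContMDiffOn.clm_bundle_apply₂ (F₁ := E m) (F₂ := E m)
      · exact g.smooth.comp_contMDiffOn (contMDiffOn_symm_of_mem_maximalAtlas hκ)
      · exact hsec v
      · exact hsec w
    intro y hy
    have := this y hy
    rw [Bundle.contMDiffWithinAt_totalSpace] at this
    exact this.2
  have h2 : ContDiffOn ℝ ∞ (metricInChart g κ) κ.target :=
    contDiffOn_clm_apply.2 fun v ↦ contDiffOn_clm_apply.2 fun w ↦ hval v w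
  exact h2.contDiffAt (κ.open_target.mem_nhds (κ.map_source hq))

theorem SmoothAlongOn.contMDiffAt_components {f : N → M}
    {ξ : ∀ q : N, TangentSpace 𝓘(ℝ, E m) (f q)} {U : Set N} (hξ : SmoothAlongOn f ξ U)
    (hU : IsOpen U) {κ : OpenPartialHomeomorph M (E m)}
    (hκ : κ ∈ IsManifold.maximalAtlas 𝓘(ℝ, E m) ∞ M) {q : N} (hq : q ∈ U)
    (hfq : f q ∈ κ.source) :
    ContMDiffAt 𝓘(ℝ, H m) 𝓘(ℝ, E m) ∞
      (fun q ↦ (mfderiv 𝓘(ℝ, E m) 𝓘(ℝ, E m) κ (f q) (ξ q) : E m)) q := by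
  have h1 := (contMDiffOn_of_mem_maximalAtlas hκ).contMDiffOn_tangentMapWithin (m := ∞)
    (by simp) κ.open_source.uniqueMDiffOn
  have hξq := hξ.contMDiffAt (hU.mem_nhds hq)
  have h2 := (h1.contMDiffAt (x := (⟨f q, ξ q⟩ : TangentBundle 𝓘(ℝ, E m) M))
    ((κ.open_source.preimage (FiberBundle.continuous_proj (E m) (TangentSpace 𝓘(ℝ, E m)))).mem_nhds
      hfq)).comp q hξq
  have h3 := ((contMDiff_snd_tangentBundle_modelSpace (n := ∞) (E m) 𝓘(ℝ, E m)).contMDiffAt).comp q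
    h2
  refine h3.congr_of_eventuallyEq ?_
  have hc : ContinuousAt f q :=
    ((FiberBundle.continuous_proj (E m) (TangentSpace 𝓘(ℝ, E m))).continuousAt).comp
      hξq.continuousAt
  filter_upwards [hc.preimage_mem_nhds (κ.open_source.mem_nhds hfq)] with z hz
  exact (DFunLike.congr_fun (mfderivWithin_of_isOpen (I := 𝓘(ℝ, E m)) (I' := 𝓘(ℝ, E m)) (f := κ)
    κ.open_source hz) (ξ z)).symm

theorem smoothAlongOn_of_components {f : N → M} {U : Set N}
    (hf : ContMDiff 𝓘(ℝ, H m) 𝓘(ℝ, E m) ∞ f) {κ : OpenPartialHomeomorph M (E m)}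
    (hκ : κ ∈ IsManifold.maximalAtlas 𝓘(ℝ, E m) ∞ M) (hfU : Set.MapsTo f U κ.source)
    {σ : N → E m} (hσ : ContMDiffOn 𝓘(ℝ, H m) 𝓘(ℝ, E m) ∞ σ U) :
    SmoothAlongOn f (fun q ↦ (mfderiv 𝓘(ℝ, E m) 𝓘(ℝ, E m) κ (f q)).inverse (σ q)) U := by
  have ha : ContMDiffOn 𝓘(ℝ, H m) 𝓘(ℝ, E m) ∞ (κ ∘ f) U :=
    (contMDiffOn_of_mem_maximalAtlas hκ).comp hf.contMDiffOn hfU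
  refine (contMDiffOn_totalSpace_of_components hκ ha hσ fun q hq ↦ κ.map_source (hfU hq)).congr
    fun q hq ↦ ?_
  have key (q' q'' : M) (h : q' = q'') (v : E m) :
      (⟨q', v⟩ : TangentBundle 𝓘(ℝ, E m) M) = ⟨q'', v⟩ := by subst h; rfl
  refine Eq.trans ?_ (key _ _ (κ.left_inv (hfU hq)).symm _)
  exact congrArg _ (mfderiv_chart_symm_apply hκ (hfU hq) (σ q)).symm

end Lightlike

/-! ### Fields along the hypersurface in charts -/

namespace Lightlike

section

variable {m : ℕ} {M N : Type*} [TopologicalSpace M] [TopologicalSpace N]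
  {χ : OpenPartialHomeomorph N (H m)} {κ : OpenPartialHomeomorph M (E m)} {f : N → M}

theorem eventually_mem_chart_source {p : N} (hp : p ∈ χ.source) {U : Set N} (hU : U ∈ 𝓝 p) :
    ∀ᶠ x in 𝓝 (χ p), x ∈ χ.target ∧ χ.symm x ∈ χ.source ∧ χ.symm x ∈ U := by
  filter_upwards [χ.open_target.mem_nhds (χ.map_source hp),
    (χ.tendsto_symm hp).eventually hU] with x hx hxU
  exact ⟨hx, χ.map_target hx, hxU⟩

/-- The parametrization of the hypersurface in a chart `χ` of `N` and a chart `κ` of `M`. -/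
def paramInChart (f : N → M) (χ : OpenPartialHomeomorph N (H m))
    (κ : OpenPartialHomeomorph M (E m)) : H m → E m :=
  κ ∘ f ∘ χ.symm

theorem paramInChart_apply {p : N} (hp : p ∈ χ.source) :
    paramInChart f χ κ (χ p) = κ (f p) := by
  simp [paramInChart, χ.left_inv hp]

variable [ChartedSpace (E m) M]

/-- The components, in a chart `χ` of `N` and a chart `κ` of `M`, of a field of ambient tangent
vectors along `f`. -/
def fieldInChart (f : N → M) (χ : OpenPartialHomeomorph N (H m))
    (κ : OpenPartialHomeomorph M (E m)) (ξ : ∀ q : N, TangentSpace 𝓘(ℝ, E m) (f q)) (x : H m) :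
    E m :=
  mfderiv 𝓘(ℝ, E m) 𝓘(ℝ, E m) κ (f (χ.symm x)) (ξ (χ.symm x))

theorem fieldInChart_apply (ξ : ∀ q : N, TangentSpace 𝓘(ℝ, E m) (f q)) {p : N}
    (hp : p ∈ χ.source) :
    fieldInChart f χ κ ξ (χ p) = mfderiv 𝓘(ℝ, E m) 𝓘(ℝ, E m) κ (f p) (ξ p) := by
  have key (q : N) (h : q = p) : (mfderiv 𝓘(ℝ, E m) 𝓘(ℝ, E m) κ (f q) (ξ q) : E m)
      = mfderiv 𝓘(ℝ, E m) 𝓘(ℝ, E m) κ (f p) (ξ p) := by subst h; rfl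
  exact key _ (χ.left_inv hp)

variable [ChartedSpace (H m) N]

theorem contMDiffAt_chart_comp (hκ : κ ∈ IsManifold.maximalAtlas 𝓘(ℝ, E m) ∞ M)
    (hf : ContMDiff 𝓘(ℝ, H m) 𝓘(ℝ, E m) ∞ f) {p : N} (hfp : f p ∈ κ.source) :
    ContMDiffAt 𝓘(ℝ, H m) 𝓘(ℝ, E m) ∞ (κ ∘ f) p :=
  (contMDiffAt_of_mem_maximalAtlas hκ hfp).comp p hf.contMDiffAt

end

variable {m : ℕ} {M : Type*} [TopologicalSpace M] [ChartedSpace (E m) M]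
  {N : Type*} [TopologicalSpace N] [ChartedSpace (H m) N]

section

variable {F : Type*} [NormedAddCommGroup F] [NormedSpace ℝ F]
  {χ : OpenPartialHomeomorph N (H m)} {κ : OpenPartialHomeomorph M (E m)}

theorem contDiffAt_comp_chart_symm (hχ : χ ∈ IsManifold.maximalAtlas 𝓘(ℝ, H m) ∞ N) {p : N}
    (hp : p ∈ χ.source) {h : N → F} (hh : ContMDiffAt 𝓘(ℝ, H m) 𝓘(ℝ, F) ∞ h p) :
    ContDiffAt ℝ ∞ (h ∘ χ.symm) (χ p) := by
  rw [← contMDiffAt_iff_contDiffAt]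
  refine ContMDiffAt.comp (I' := 𝓘(ℝ, H m)) (χ p) ?_
    (contMDiffAt_symm_of_mem_maximalAtlas hχ (χ.map_source hp))
  rwa [χ.left_inv hp]

theorem mfderiv_eq_fderiv_chart (hχ : χ ∈ IsManifold.maximalAtlas 𝓘(ℝ, H m) ∞ N) {p : N}
    (hp : p ∈ χ.source) {h : N → F} (hh : ContMDiffAt 𝓘(ℝ, H m) 𝓘(ℝ, F) ∞ h p)
    (X : TangentSpace 𝓘(ℝ, H m) p) :
    (mfderiv 𝓘(ℝ, H m) 𝓘(ℝ, F) h p X : F)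
      = fderiv ℝ (h ∘ χ.symm) (χ p) (mfderiv 𝓘(ℝ, H m) 𝓘(ℝ, H m) χ p X) := by
  have h1 : HasMFDerivAt 𝓘(ℝ, H m) 𝓘(ℝ, F) (h ∘ χ.symm) (χ p)
      (fderiv ℝ (h ∘ χ.symm) (χ p)) :=
    ((contDiffAt_comp_chart_symm hχ hp hh).differentiableAt (by simp)).hasFDerivAt.hasMFDerivAt
  have h2 := h1.comp p ((chart_mdifferentiable hχ).mdifferentiableAt hp).hasMFDerivAt
  have h3 : (h ∘ χ.symm) ∘ χ =ᶠ[𝓝 p] h := by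
    filter_upwards [χ.open_source.mem_nhds hp] with z hz
    simp [χ.left_inv hz]
  have h4 := (h2.congr_of_eventuallyEq h3.symm).mfderiv
  rw [h4]
  rfl

variable {f : N → M}

theorem contDiffAt_paramInChart (hχ : χ ∈ IsManifold.maximalAtlas 𝓘(ℝ, H m) ∞ N)
    (hκ : κ ∈ IsManifold.maximalAtlas 𝓘(ℝ, E m) ∞ M)
    (hf : ContMDiff 𝓘(ℝ, H m) 𝓘(ℝ, E m) ∞ f) {p : N} (hp : p ∈ χ.source)
    (hfp : f p ∈ κ.source) :
    ContDiffAt ℝ ∞ (paramInChart f χ κ) (χ p) :=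
  contDiffAt_comp_chart_symm hχ hp (contMDiffAt_chart_comp hκ hf hfp)

theorem fderiv_paramInChart (hχ : χ ∈ IsManifold.maximalAtlas 𝓘(ℝ, H m) ∞ N)
    (hκ : κ ∈ IsManifold.maximalAtlas 𝓘(ℝ, E m) ∞ M)
    (hf : ContMDiff 𝓘(ℝ, H m) 𝓘(ℝ, E m) ∞ f) {p : N} (hp : p ∈ χ.source)
    (hfp : f p ∈ κ.source) (X : TangentSpace 𝓘(ℝ, H m) p) :
    fderiv ℝ (paramInChart f χ κ) (χ p) (mfderiv 𝓘(ℝ, H m) 𝓘(ℝ, H m) χ p X)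
      = mfderiv 𝓘(ℝ, E m) 𝓘(ℝ, E m) κ (f p) (mfderiv 𝓘(ℝ, H m) 𝓘(ℝ, E m) f p X) := by
  refine (mfderiv_eq_fderiv_chart hχ hp (contMDiffAt_chart_comp hκ hf hfp) X).symm.trans ?_
  have h := mfderiv_comp p ((chart_mdifferentiable hκ).mdifferentiableAt hfp)
    ((hf p).mdifferentiableAt (by simp))
  exact DFunLike.congr_fun h X

variable [IsManifold 𝓘(ℝ, E m) ∞ M]

theorem contDiffAt_fieldInChart (hχ : χ ∈ IsManifold.maximalAtlas 𝓘(ℝ, H m) ∞ N)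
    (hκ : κ ∈ IsManifold.maximalAtlas 𝓘(ℝ, E m) ∞ M)
    {ξ : ∀ q : N, TangentSpace 𝓘(ℝ, E m) (f q)} {U : Set N} (hξ : SmoothAlongOn f ξ U)
    (hU : IsOpen U) {p : N} (hpU : p ∈ U) (hp : p ∈ χ.source) (hfp : f p ∈ κ.source) :
    ContDiffAt ℝ ∞ (fieldInChart f χ κ ξ) (χ p) :=
  contDiffAt_comp_chart_symm hχ hp (hξ.contMDiffAt_components hU hκ hpU hfp)

/-- The covariant derivative along the hypersurface, computed in arbitrary coordinates. -/
theorem mfderiv_covDeriv (g : LorentzMetric m M)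
    (hχ : χ ∈ IsManifold.maximalAtlas 𝓘(ℝ, H m) ∞ N)
    (hκ : κ ∈ IsManifold.maximalAtlas 𝓘(ℝ, E m) ∞ M)
    (hf : ContMDiff 𝓘(ℝ, H m) 𝓘(ℝ, E m) ∞ f)
    {ξ : ∀ q : N, TangentSpace 𝓘(ℝ, E m) (f q)} {U : Set N} (hξ : SmoothAlongOn f ξ U)
    (hU : IsOpen U) {p : N} (hpU : p ∈ U) (hp : p ∈ χ.source) (hfp : f p ∈ κ.source)
    (X : TangentSpace 𝓘(ℝ, H m) p) :
    mfderiv 𝓘(ℝ, E m) 𝓘(ℝ, E m) κ (f p) (covDeriv g f ξ p X)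
      = coordCov (metricInChart g κ) (paramInChart f χ κ) (fieldInChart f χ κ ξ) (χ p)
        (mfderiv 𝓘(ℝ, H m) 𝓘(ℝ, H m) χ p X) := by
  set κ₀ := chartAt (E m) (f p) with hκ₀_def
  have hκ₀ : κ₀ ∈ IsManifold.maximalAtlas 𝓘(ℝ, E m) ∞ M := IsManifold.chart_mem_maximalAtlas _
  have hfp₀ : f p ∈ κ₀.source := mem_chart_source _ _
  -- the definition, read in the preferred chart
  have h0 : mfderiv 𝓘(ℝ, E m) 𝓘(ℝ, E m) κ₀ (f p) (covDeriv g f ξ p X)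
      = coordCov (metricInChart g κ₀) (paramInChart f χ κ₀) (fieldInChart f χ κ₀ ξ) (χ p)
        (mfderiv 𝓘(ℝ, H m) 𝓘(ℝ, H m) χ p X) := by
    refine ((isInvertible_mfderiv_chart hκ₀ hfp₀).self_apply_inverse _).trans ?_
    unfold coordCov
    rw [fderiv_paramInChart hχ hκ₀ hf hp hfp₀, paramInChart_apply hp, fieldInChart_apply ξ hp]
    exact congrArg (· + _)
      (mfderiv_eq_fderiv_chart hχ hp (hξ.contMDiffAt_components hU hκ₀ hpU hfp₀) X)
  have hφ := paramInChart_apply (f := f) (κ := κ₀) hp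
  have hψ := contDiffAt_transition hκ₀ hκ hfp₀ hfp
  have hψφ : (κ ∘ κ₀.symm) (κ₀ (f p)) = κ (f p) := by simp [κ₀.left_inv hfp₀]
  have hnear : ∀ᶠ x in 𝓝 (χ p), f (χ.symm x) ∈ κ₀.source ∧ f (χ.symm x) ∈ κ.source :=
    (χ.tendsto_symm hp).eventually ((hf.continuous.continuousAt.preimage_mem_nhds
      ((κ₀.open_source.inter κ.open_source).mem_nhds ⟨hfp₀, hfp⟩)))
  have hinv : (fderiv ℝ (κ ∘ κ₀.symm) (κ₀ (f p))).IsInvertible := by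
    have h := ((isInvertible_mfderiv_chart hκ hfp).comp
      (isInvertible_mfderiv_chart hκ₀ hfp₀).inverse)
    convert! h using 1
    refine ContinuousLinearMap.ext fun v ↦ ?_
    obtain ⟨w, rfl⟩ := (isInvertible_mfderiv_chart hκ₀ hfp₀).surjective v
    rw [← mfderiv_chart_eq_transition hκ₀ hκ hfp₀ hfp]
    exact congrArg (mfderiv 𝓘(ℝ, E m) 𝓘(ℝ, E m) κ (f p))
      ((isInvertible_mfderiv_chart hκ₀ hfp₀).inverse_apply_self w).symm
  have h1 := fderiv_coordCov (G := metricInChart g κ₀) (G' := metricInChart g κ)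
    (ψ := κ ∘ κ₀.symm) (φ := paramInChart f χ κ₀) (φ' := paramInChart f χ κ)
    (η := fieldInChart f χ κ₀ ξ) (η' := fieldInChart f χ κ ξ) (x := χ p)
    (by rw [hφ]; exact hψ.of_le (by norm_cast)) (by rw [hφ]; exact hinv)
    (by rw [hφ]; exact isInvertible_metricInChart g hκ₀ hfp₀)
    (by rw [hφ, hψφ]; exact isInvertible_metricInChart g hκ hfp)
    (by rw [hφ, hψφ]; exact (contDiffAt_metricInChart g hκ hfp).differentiableAt (by simp))
    (metricInChart_symm g κ)
    (by
      rw [hφ]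
      filter_upwards [κ₀.open_target.mem_nhds (κ₀.map_source hfp₀),
        (κ₀.tendsto_symm hfp₀).eventually (κ.open_source.mem_nhds hfp)] with z hz hz' v w
      obtain ⟨q, hq, rfl⟩ : ∃ q ∈ κ₀.source, κ₀ q = z := ⟨κ₀.symm z, κ₀.map_target hz,
        κ₀.right_inv hz⟩
      rw [κ₀.left_inv hq] at hz'
      obtain ⟨v, rfl⟩ := (isInvertible_mfderiv_chart hκ₀ hq).surjective v
      obtain ⟨w, rfl⟩ := (isInvertible_mfderiv_chart hκ₀ hq).surjective w
      rw [← mfderiv_chart_eq_transition hκ₀ hκ hq hz', ← mfderiv_chart_eq_transition hκ₀ hκ hq hz',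
        metricInChart_mfderiv g hκ₀ hq, ← metricInChart_mfderiv g hκ hz']
      simp [κ₀.left_inv hq])
    (by rw [hφ]; exact (contDiffAt_metricInChart g hκ₀ hfp₀).differentiableAt (by simp))
    ((contDiffAt_paramInChart hχ hκ₀ hf hp hfp₀).differentiableAt (by simp))
    ((contDiffAt_fieldInChart hχ hκ₀ hξ hU hpU hp hfp₀).differentiableAt (by simp))
    (by
      filter_upwards [hnear] with x hx
      simp [paramInChart, κ₀.left_inv hx.1])
    (by
      filter_upwards [hnear] with x hx
      exact mfderiv_chart_eq_transition hκ₀ hκ hx.1 hx.2 _)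
    (mfderiv 𝓘(ℝ, H m) 𝓘(ℝ, H m) χ p X)
  rw [← h1, hφ, ← h0]
  exact mfderiv_chart_eq_transition hκ₀ hκ hfp₀ hfp _

end

end Lightlike

/-! ### The covariant derivative along a lightlike hypersurface -/

namespace Lightlike

variable {m : ℕ} {M : Type*} [TopologicalSpace M] [ChartedSpace (E m) M]
  [IsManifold 𝓘(ℝ, E m) ∞ M]
  {N : Type*} [TopologicalSpace N] [ChartedSpace (H m) N]
  {g : LorentzMetric m M} {f : N → M}

/-- The covariant derivative at a point, as a linear map in the direction of differentiation. -/
def covDerivₗ (g : LorentzMetric m M) (f : N → M) (ξ : ∀ q : N, TangentSpace 𝓘(ℝ, E m) (f q))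
    (p : N) : TangentSpace 𝓘(ℝ, H m) p →ₗ[ℝ] TangentSpace 𝓘(ℝ, E m) (f p) where
  toFun := covDeriv g f ξ p
  map_add' X Y := apply_add_christoffel_add _ _
    ((mfderiv 𝓘(ℝ, E m) 𝓘(ℝ, E m) (chartAt (E m) (f p)) (f p)).comp
      (mfderiv 𝓘(ℝ, H m) 𝓘(ℝ, E m) f p)) _ _ _ X Y
  map_smul' c X := apply_smul_add_christoffel_smul _ _
    ((mfderiv 𝓘(ℝ, E m) 𝓘(ℝ, E m) (chartAt (E m) (f p)) (f p)).comp
      (mfderiv 𝓘(ℝ, H m) 𝓘(ℝ, E m) f p)) _ _ _ c X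

@[simp]
theorem covDeriv_congr {ξ ξ' : ∀ q : N, TangentSpace 𝓘(ℝ, E m) (f q)} {p : N}
    (h : ∀ᶠ q in 𝓝 p, ξ q = ξ' q) (X : TangentSpace 𝓘(ℝ, H m) p) :
    covDeriv g f ξ p X = covDeriv g f ξ' p X := by
  have h' : (fun q ↦ (mfderiv 𝓘(ℝ, E m) 𝓘(ℝ, E m) (chartAt (E m) (f p)) (f q) (ξ q) : E m))
      =ᶠ[𝓝 p] fun q ↦ mfderiv 𝓘(ℝ, E m) 𝓘(ℝ, E m) (chartAt (E m) (f p)) (f q) (ξ' q) :=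
    h.mono fun q hq ↦
      congrArg (mfderiv 𝓘(ℝ, E m) 𝓘(ℝ, E m) (chartAt (E m) (f p)) (f q)) hq
  simp only [covDeriv]
  erw [h'.mfderiv_eq, h.self_of_nhds]
  rfl

theorem eventually_inner_fieldInChart {χ : OpenPartialHomeomorph N (H m)}
    {κ : OpenPartialHomeomorph M (E m)}
    (hχ : χ ∈ IsManifold.maximalAtlas 𝓘(ℝ, H m) ∞ N)
    (hκ : κ ∈ IsManifold.maximalAtlas 𝓘(ℝ, E m) ∞ M) (hf : ContMDiff 𝓘(ℝ, H m) 𝓘(ℝ, E m) ∞ f)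
    {ξ : ∀ q : N, TangentSpace 𝓘(ℝ, E m) (f q)} {U : Set N} (hU : IsOpen U)
    (hrad : ∀ q ∈ U, ξ q ∈ radical g f q) {p : N} (hp : p ∈ U) (hpχ : p ∈ χ.source)
    (hfp : f p ∈ κ.source) :
    ∀ᶠ z in 𝓝 (χ p), ∀ Y, metricInChart g κ (paramInChart f χ κ z) (fieldInChart f χ κ ξ z)
      (fderiv ℝ (paramInChart f χ κ) z Y) = 0 := by
  filter_upwards [eventually_mem_chart_source hpχ ((hU.inter
    (κ.open_source.preimage hf.continuous)).mem_nhds ⟨hp, hfp⟩)] with z hz Y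
  obtain ⟨q, hq, rfl⟩ : ∃ q ∈ χ.source, χ q = z := ⟨χ.symm z, hz.2.1, χ.right_inv hz.1⟩
  rw [χ.left_inv hq] at hz
  obtain ⟨Y, rfl⟩ := (isInvertible_mfderiv_chart hχ hq).surjective Y
  rw [fderiv_paramInChart hχ hκ hf hq hz.2.2.2, paramInChart_apply hq, fieldInChart_apply ξ hq,
    metricInChart_mfderiv g hκ hz.2.2.2]
  exact (hrad q hz.2.2.1).2 _ ⟨Y, rfl⟩

variable [IsManifold 𝓘(ℝ, H m) ∞ N]

theorem covDeriv_fun_smul (hf : ContMDiff 𝓘(ℝ, H m) 𝓘(ℝ, E m) ∞ f)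
    {ξ : ∀ q : N, TangentSpace 𝓘(ℝ, E m) (f q)} {U : Set N} (hU : IsOpen U)
    (hξ : SmoothAlongOn f ξ U) {c : N → ℝ} (hcξ : SmoothAlongOn f (fun q ↦ c q • ξ q) U)
    {p : N} (hp : p ∈ U) (hc : ContMDiffAt 𝓘(ℝ, H m) 𝓘(ℝ, ℝ) ∞ c p)
    (X : TangentSpace 𝓘(ℝ, H m) p) :
    covDeriv g f (fun q ↦ c q • ξ q) p X
      = mvfderiv 𝓘(ℝ, H m) c p X • ξ p + c p • covDeriv g f ξ p X := by
  have hκ : chartAt (E m) (f p) ∈ IsManifold.maximalAtlas 𝓘(ℝ, E m) ∞ M :=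
    IsManifold.chart_mem_maximalAtlas _
  have hχ : chartAt (H m) p ∈ IsManifold.maximalAtlas 𝓘(ℝ, H m) ∞ N :=
    IsManifold.chart_mem_maximalAtlas _
  have hfp := mem_chart_source (E m) (f p)
  have hpχ := mem_chart_source (H m) p
  apply (isInvertible_mfderiv_chart hκ hfp).injective
  rw [mfderiv_covDeriv g hχ hκ hf hcξ hU hp hpχ hfp, map_add, map_smul, map_smul,
    mfderiv_covDeriv g hχ hκ hf hξ hU hp hpχ hfp]
  have h1 : fieldInChart f (chartAt (H m) p) (chartAt (E m) (f p)) (fun q ↦ c q • ξ q)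
      = fun z ↦ (c ∘ (chartAt (H m) p).symm) z
        • fieldInChart f (chartAt (H m) p) (chartAt (E m) (f p)) ξ z := by
    funext z
    exact map_smul _ _ _
  rw [h1]
  refine (coordCov_fun_smul _ ((contDiffAt_comp_chart_symm hχ hpχ hc).differentiableAt (by simp))
    ((contDiffAt_fieldInChart hχ hκ hξ hU hp hpχ hfp).differentiableAt (by simp)) _).trans ?_
  rw [fieldInChart_apply ξ hpχ, ← mfderiv_eq_fderiv_chart hχ hpχ hc, Function.comp_apply,
    (chartAt (H m) p).left_inv hpχ]
  rfl

theorem inner_covDeriv_symm (hf : ContMDiff 𝓘(ℝ, H m) 𝓘(ℝ, E m) ∞ f)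
    {ξ : ∀ q : N, TangentSpace 𝓘(ℝ, E m) (f q)} {U : Set N} (hU : IsOpen U)
    (hξ : SmoothAlongOn f ξ U) (hrad : ∀ q ∈ U, ξ q ∈ radical g f q) {p : N} (hp : p ∈ U)
    (X Y : TangentSpace 𝓘(ℝ, H m) p) :
    g.val (f p) (covDeriv g f ξ p X) (mfderiv 𝓘(ℝ, H m) 𝓘(ℝ, E m) f p Y)
      = g.val (f p) (covDeriv g f ξ p Y) (mfderiv 𝓘(ℝ, H m) 𝓘(ℝ, E m) f p X) := by
  have hκ : chartAt (E m) (f p) ∈ IsManifold.maximalAtlas 𝓘(ℝ, E m) ∞ M :=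
    IsManifold.chart_mem_maximalAtlas _
  have hχ : chartAt (H m) p ∈ IsManifold.maximalAtlas 𝓘(ℝ, H m) ∞ N :=
    IsManifold.chart_mem_maximalAtlas _
  have hfp := mem_chart_source (E m) (f p)
  have hpχ := mem_chart_source (H m) p
  rw [← metricInChart_mfderiv g hκ hfp, ← metricInChart_mfderiv g hκ hfp,
    mfderiv_covDeriv g hχ hκ hf hξ hU hp hpχ hfp, mfderiv_covDeriv g hχ hκ hf hξ hU hp hpχ hfp,
    ← fderiv_paramInChart hχ hκ hf hpχ hfp, ← fderiv_paramInChart hχ hκ hf hpχ hfp,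
    ← paramInChart_apply (κ := chartAt (E m) (f p)) (f := f) hpχ]
  apply inner_coordCov_symm
  · rw [paramInChart_apply hpχ]; exact isInvertible_metricInChart g hκ hfp
  · rw [paramInChart_apply hpχ]
    exact (contDiffAt_metricInChart g hκ hfp).differentiableAt (by simp)
  · exact metricInChart_symm g _
  · exact (contDiffAt_paramInChart hχ hκ hf hpχ hfp).of_le (by norm_cast)
  · exact (contDiffAt_fieldInChart hχ hκ hξ hU hp hpχ hfp).differentiableAt (by simp)
  · exact eventually_inner_fieldInChart hχ hκ hf hU hrad hp hpχ hfp

theorem inner_covDeriv_self (hf : ContMDiff 𝓘(ℝ, H m) 𝓘(ℝ, E m) ∞ f)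
    {ξ : ∀ q : N, TangentSpace 𝓘(ℝ, E m) (f q)} {U : Set N} (hU : IsOpen U)
    (hξ : SmoothAlongOn f ξ U) (hrad : ∀ q ∈ U, ξ q ∈ radical g f q) {p : N} (hp : p ∈ U)
    (X : TangentSpace 𝓘(ℝ, H m) p) : g.val (f p) (covDeriv g f ξ p X) (ξ p) = 0 := by
  have hκ : chartAt (E m) (f p) ∈ IsManifold.maximalAtlas 𝓘(ℝ, E m) ∞ M :=
    IsManifold.chart_mem_maximalAtlas _
  have hχ : chartAt (H m) p ∈ IsManifold.maximalAtlas 𝓘(ℝ, H m) ∞ N :=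
    IsManifold.chart_mem_maximalAtlas _
  have hfp := mem_chart_source (E m) (f p)
  have hpχ := mem_chart_source (H m) p
  rw [← metricInChart_mfderiv g hκ hfp, mfderiv_covDeriv g hχ hκ hf hξ hU hp hpχ hfp,
    ← fieldInChart_apply ξ hpχ, ← paramInChart_apply (κ := chartAt (E m) (f p)) (f := f) hpχ]
  apply inner_coordCov_self
  · rw [paramInChart_apply hpχ]; exact isInvertible_metricInChart g hκ hfp
  · rw [paramInChart_apply hpχ]
    exact (contDiffAt_metricInChart g hκ hfp).differentiableAt (by simp)
  · exact metricInChart_symm g _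
  · exact (contDiffAt_paramInChart hχ hκ hf hpχ hfp).differentiableAt (by simp)
  · exact (contDiffAt_fieldInChart hχ hκ hξ hU hp hpχ hfp).differentiableAt (by simp)
  · filter_upwards [eventually_mem_chart_source hpχ ((hU.inter
      ((chartAt (E m) (f p)).open_source.preimage hf.continuous)).mem_nhds ⟨hp, hfp⟩)] with z hz
    obtain ⟨q, hq, rfl⟩ : ∃ q ∈ (chartAt (H m) p).source, chartAt (H m) p q = z :=
      ⟨(chartAt (H m) p).symm z, hz.2.1, (chartAt (H m) p).right_inv hz.1⟩
    rw [(chartAt (H m) p).left_inv hq] at hz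
    rw [paramInChart_apply hq, fieldInChart_apply ξ hq, metricInChart_mfderiv g hκ hz.2.2.2]
    exact (hrad q hz.2.2.1).2 _ (hrad q hz.2.2.1).1

end Lightlike

/-! ### Isotropic frames and screens in a tangent space -/

namespace Lightlike

variable {m : ℕ} {M : Type*} [TopologicalSpace M] [ChartedSpace (E m) M]
  {N : Type*} [TopologicalSpace N] [ChartedSpace (H m) N] {f : N → M} {p : N}

section Frame

variable {V : Type*} [AddCommGroup V] [Module ℝ V] (b : Module.Basis (Idx m) ℝ V)

theorem Idx.sum_eq {A : Type*} [AddCommMonoid A] (F : Idx m → A) :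
    ∑ i, F i = F Idx.one + ((∑ a, F (Idx.scr a)) + F Idx.last) := by
  simp [Fintype.sum_sum_type]

theorem sum_frame_repr (v : V) :
    v = b.repr v Idx.one • b Idx.one
      + ((∑ a, b.repr v (Idx.scr a) • b (Idx.scr a)) + b.repr v Idx.last • b Idx.last) := by
  conv_lhs => rw [← b.sum_repr v]
  rw [Idx.sum_eq]

end Frame

section Screen

variable {x : M} (b : Module.Basis (Idx m) ℝ (TangentSpace 𝓘(ℝ, E m) x))

/-- The subspace spanned by the `e_a + z_a e_1`, by equations in the frame. -/
theorem mem_screenSpan_iff {z : Fin m → ℝ} {v : TangentSpace 𝓘(ℝ, E m) x} :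
    v ∈ screenSpan b z ↔ b.repr v Idx.last = 0 ∧
      b.repr v Idx.one = ∑ a, z a * b.repr v (Idx.scr a) := by
  constructor
  · intro hv
    induction hv using Submodule.span_induction with
    | mem v hv =>
      obtain ⟨a, rfl⟩ := hv
      simp [Finsupp.single_apply]
    | zero => simp
    | add v w _ _ hv hw =>
      simp [hv.1, hw.1, hv.2, hw.2, mul_add, Finset.sum_add_distrib]
    | smul c v _ hv =>
      simp only [map_smul, Finsupp.smul_apply, smul_eq_mul, hv.1, hv.2, mul_zero, Finset.mul_sum,
        true_and]
      exact Finset.sum_congr rfl fun a _ ↦ by ring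
  · rintro ⟨h1, h2⟩
    have : v = ∑ a, b.repr v (Idx.scr a) • (b (Idx.scr a) + z a • b Idx.one) := by
      conv_lhs => rw [sum_frame_repr b v]
      rw [h1, h2, zero_smul, add_zero, Finset.sum_smul]
      simp only [smul_add, Finset.sum_add_distrib, smul_smul]
      refine (add_comm _ _).trans (congrArg₂ _ rfl ?_)
      exact Finset.sum_congr rfl fun a _ ↦ by rw [mul_comm]
    rw [this]
    exact Submodule.sum_mem _ fun a _ ↦ Submodule.smul_mem _ _
      (Submodule.subset_span ⟨a, rfl⟩)

theorem finrank_screenSpan (z : Fin m → ℝ) : Module.finrank ℝ (screenSpan b z) = m := by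
  have hli : LinearIndependent ℝ fun a : Fin m ↦ b (Idx.scr a) + z a • b Idx.one := by
    rw [Fintype.linearIndependent_iff]
    intro c hc a
    have := congrArg (fun v ↦ b.repr v (Idx.scr a)) hc
    simpa [Finsupp.single_apply] using this
  simpa using! finrank_span_eq_card hli

theorem screenSpan_injective {z z' : Fin m → ℝ} (h : screenSpan b z = screenSpan b z') :
    z = z' := by
  funext a
  have ha : b (Idx.scr a) + z a • b Idx.one ∈ screenSpan b z' := by
    rw [← h]
    exact Submodule.subset_span ⟨a, rfl⟩
  have := ((mem_screenSpan_iff b).1 ha).2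
  simpa [Finsupp.single_apply] using this

end Screen

section Range

variable {x : M} (b : Module.Basis (Idx m) ℝ (TangentSpace 𝓘(ℝ, E m) x))
  {X : Type*} [AddCommGroup X] [Module ℝ X] {Q : X →ₗ[ℝ] TangentSpace 𝓘(ℝ, E m) x}
  {θ : X → Fin m → ℝ} {Λ : Matrix (Fin m) (Fin m) ℝ} {k : Fin m → ℝ}

theorem not_isRoot_charpoly_iff {A : Matrix (Fin m) (Fin m) ℝ} {K : ℝ} :
    ¬ A.charpoly.IsRoot K ↔ IsUnit (A - K • (1 : Matrix (Fin m) (Fin m) ℝ)).det := by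
  rw [Polynomial.IsRoot, Matrix.eval_charpoly, isUnit_iff_ne_zero, not_iff_not,
    ← neg_sub A (Matrix.scalar _ K), Matrix.det_neg]
  simp [Matrix.smul_one_eq_diagonal]

/-- The frame expression of the screen map. -/
theorem repr_sum_screen (θ : Fin m → ℝ) :
    b.repr (∑ c, θ c • (k c • b Idx.one + ∑ a, Λ a c • b (Idx.scr a))) Idx.last = 0 ∧
    b.repr (∑ c, θ c • (k c • b Idx.one + ∑ a, Λ a c • b (Idx.scr a))) Idx.one = k ⬝ᵥ θ ∧
    ∀ a, b.repr (∑ c, θ c • (k c • b Idx.one + ∑ a, Λ a c • b (Idx.scr a))) (Idx.scr a)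
      = Λ.mulVec θ a := by
  refine ⟨?_, ?_, fun a ↦ ?_⟩
  · simp
  · simp [dotProduct, mul_comm]
  · simp [Finsupp.single_apply, Matrix.mulVec, dotProduct, mul_comm]

theorem range_eq_screenSpan (hθ : Function.Surjective θ)
    (hQ : ∀ Y, Q Y = ∑ c, θ Y c • (k c • b Idx.one + ∑ a, Λ a c • b (Idx.scr a)))
    (hΛ : IsUnit Λ.det) : LinearMap.range Q = screenSpan b (Matrix.vecMul k Λ⁻¹) := by
  ext v
  rw [mem_screenSpan_iff]
  constructor
  · rintro ⟨Y, rfl⟩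
    obtain ⟨h1, h2, h3⟩ := repr_sum_screen b (k := k) (Λ := Λ) (θ Y)
    rw [hQ]
    refine ⟨h1, ?_⟩
    rw [h2]
    simp only [h3]
    change _ = Matrix.vecMul k Λ⁻¹ ⬝ᵥ Λ.mulVec (θ Y)
    rw [← Matrix.dotProduct_mulVec, Matrix.mulVec_mulVec, Matrix.nonsing_inv_mul _ hΛ,
      Matrix.one_mulVec]
  · rintro ⟨hl, h1⟩
    obtain ⟨Y, hY⟩ := hθ (Λ⁻¹.mulVec fun a ↦ b.repr v (Idx.scr a))
    refine ⟨Y, b.ext_elem fun i ↦ ?_⟩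
    obtain ⟨e1, e2, e3⟩ := repr_sum_screen b (k := k) (Λ := Λ) (θ Y)
    rw [hQ]
    match i with
    | Sum.inl () =>
      refine e2.trans (Eq.trans ?_ h1.symm)
      rw [hY, Matrix.dotProduct_mulVec]
      rfl
    | Sum.inr (Sum.inl a) =>
      refine (e3 a).trans ?_
      rw [hY, Matrix.mulVec_mulVec, Matrix.mul_nonsing_inv _ hΛ, Matrix.one_mulVec]
    | Sum.inr (Sum.inr ()) => exact e1.trans hl.symm

theorem isUnit_det_of_scr_mem
    (hQ : ∀ Y, Q Y = ∑ c, θ Y c • (k c • b Idx.one + ∑ a, Λ a c • b (Idx.scr a)))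
    (h : ∀ a, b (Idx.scr a) ∈ LinearMap.range Q ⊔ Submodule.span ℝ {b Idx.one}) :
    IsUnit Λ.det := by
  rw [← Matrix.isUnit_iff_isUnit_det, ← Matrix.mulVec_surjective_iff_isUnit]
  have h' (a : Fin m) : ∃ y, Λ.mulVec y = Pi.single a 1 := by
    have ha := h a
    rw [Submodule.mem_sup] at ha
    obtain ⟨_, ⟨Y, rfl⟩, r, hr, hsum⟩ := ha
    obtain ⟨c, rfl⟩ := Submodule.mem_span_singleton.1 hr
    refine ⟨θ Y, funext fun a' ↦ ?_⟩
    rw [← (repr_sum_screen b (k := k) (Λ := Λ) (θ Y)).2.2 a', ← hQ]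
    have := congrArg (fun v ↦ b.repr v (Idx.scr a')) hsum
    simpa [Finsupp.single_apply, Pi.single_apply, eq_comm] using this
  choose y hy using h'
  intro v
  refine ⟨∑ a, v a • y a, ?_⟩
  rw [Matrix.mulVec_sum]
  simp only [Matrix.mulVec_smul, hy]
  funext a
  simp [Pi.single_apply]

end Range

theorem finrank_tangentHyperplane
    (himm : Function.Injective (mfderiv 𝓘(ℝ, H m) 𝓘(ℝ, E m) f p)) :
    Module.finrank ℝ (tangentHyperplane (m := m) f p) = m + 1 := by
  have h := LinearMap.finrank_range_of_inj
    (f := (mfderiv 𝓘(ℝ, H m) 𝓘(ℝ, E m) f p).toLinearMap) himm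
  refine h.trans ?_
  exact finrank_euclideanSpace_fin (𝕜 := ℝ) (n := m + 1)

variable [IsManifold 𝓘(ℝ, E m) ∞ M] {g : LorentzMetric m M}
  {b : Module.Basis (Idx m) ℝ (TangentSpace 𝓘(ℝ, E m) (f p))}

namespace IsIsotropicFrame

theorem mem_tangentHyperplane_iff (hb : IsIsotropicFrame g f p b)
    (himm : Function.Injective (mfderiv 𝓘(ℝ, H m) 𝓘(ℝ, E m) f p))
    {v : TangentSpace 𝓘(ℝ, E m) (f p)} :
    v ∈ tangentHyperplane f p ↔ b.repr v Idx.last = 0 := by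
  have hfd : FiniteDimensional ℝ (TangentSpace 𝓘(ℝ, E m) (f p)) := b.finiteDimensional_of_finite
  have hle : LinearMap.ker (b.coord Idx.last) ≤ tangentHyperplane f p := by
    intro v hv
    have hv' : b.repr v Idx.last = 0 := by simpa using hv
    rw [sum_frame_repr b v, hv', zero_smul, add_zero]
    exact add_mem (Submodule.smul_mem _ _ hb.tangent_one)
      (Submodule.sum_mem _ fun a _ ↦ Submodule.smul_mem _ _ (hb.tangent_scr a))
  have hdim : Module.finrank ℝ (LinearMap.ker (b.coord Idx.last)) = m + 1 := by
    have h1 := LinearMap.finrank_range_add_finrank_ker (b.coord Idx.last)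
    have h2 : LinearMap.range (b.coord Idx.last) = ⊤ := by
      rw [LinearMap.range_eq_top]
      intro c
      exact ⟨c • b Idx.last, by simp⟩
    rw [h2, finrank_top, Module.finrank_self, Module.finrank_eq_card_basis b] at h1
    simp at h1
    omega
  rw [← Submodule.eq_of_le_of_finrank_eq hle
    (hdim.trans (finrank_tangentHyperplane himm).symm)]
  simp

theorem inner_one (hb : IsIsotropicFrame g f p b) (v : TangentSpace 𝓘(ℝ, E m) (f p)) :
    g.val (f p) v (b Idx.one) = - b.repr v Idx.last := by
  conv_lhs => rw [sum_frame_repr b v]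
  simp only [map_add, map_sum, map_smul, add_apply, sum_apply, smul_apply, hb.one_one,
    g.symm _ (b (Idx.scr _)) (b Idx.one), g.symm _ (b Idx.last) (b Idx.one), hb.one_scr,
    hb.one_last]
  simp

theorem mem_radical_iff (hb : IsIsotropicFrame g f p b)
    (himm : Function.Injective (mfderiv 𝓘(ℝ, H m) 𝓘(ℝ, E m) f p))
    {v : TangentSpace 𝓘(ℝ, E m) (f p)} :
    v ∈ radical g f p ↔ ∃ c : ℝ, v = c • b Idx.one := by
  constructor
  · rintro ⟨hv, hvT⟩
    have h0 := (hb.mem_tangentHyperplane_iff himm).1 hv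
    -- the screen part of `v` is orthogonal to the whole frame
    have hw : v - b.repr v Idx.one • b Idx.one = 0 := by
      refine g.eq_zero_of_forall fun w ↦ ?_
      have e := sum_frame_repr b v
      have hw' : v - b.repr v Idx.one • b Idx.one
          = ∑ a, b.repr v (Idx.scr a) • b (Idx.scr a) := by
        rw [h0, zero_smul, add_zero] at e
        exact sub_eq_iff_eq_add.2 (e.trans (add_comm _ _))
      have hlast : g.val (f p) (v - b.repr v Idx.one • b Idx.one) (b Idx.last) = 0 := by
        rw [hw']
        simp [hb.scr_last]
      have hone : g.val (f p) (v - b.repr v Idx.one • b Idx.one) (b Idx.one) = 0 := by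
        simp [hvT _ hb.tangent_one, hb.one_one]
      have hscr (a) : g.val (f p) (v - b.repr v Idx.one • b Idx.one) (b (Idx.scr a)) = 0 := by
        simp [hvT _ (hb.tangent_scr a), hb.one_scr]
      rw [sum_frame_repr b w]
      simp only [map_add, map_sum, map_smul, hlast, hone, hscr]
      simp
    exact ⟨_, sub_eq_zero.1 hw⟩
  · rintro ⟨c, rfl⟩
    refine Submodule.smul_mem _ c ⟨hb.tangent_one, fun w hw ↦ ?_⟩
    rw [g.symm, hb.inner_one, (hb.mem_tangentHyperplane_iff himm).1 hw, neg_zero]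

theorem one_mem_radical (hb : IsIsotropicFrame g f p b)
    (himm : Function.Injective (mfderiv 𝓘(ℝ, H m) 𝓘(ℝ, E m) f p)) :
    b Idx.one ∈ radical g f p :=
  (hb.mem_radical_iff himm).2 ⟨1, (one_smul _ _).symm⟩

theorem screenSpan_le (hb : IsIsotropicFrame g f p b) (z : Fin m → ℝ) :
    screenSpan b z ≤ tangentHyperplane f p := by
  refine Submodule.span_le.2 ?_
  rintro _ ⟨a, rfl⟩
  exact add_mem (hb.tangent_scr a) (Submodule.smul_mem _ _ hb.tangent_one)

theorem screenSpan_inf_radical (hb : IsIsotropicFrame g f p b)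
    (himm : Function.Injective (mfderiv 𝓘(ℝ, H m) 𝓘(ℝ, E m) f p)) (z : Fin m → ℝ) :
    screenSpan b z ⊓ radical g f p = ⊥ := by
  rw [eq_bot_iff]
  rintro v ⟨hv, hr⟩
  obtain ⟨c, rfl⟩ := (hb.mem_radical_iff himm).1 hr
  have h := ((mem_screenSpan_iff b).1 hv).2
  have hc : c = 0 := by simpa using h
  simp [hc]

theorem screenSpan_sup_radical (hb : IsIsotropicFrame g f p b)
    (himm : Function.Injective (mfderiv 𝓘(ℝ, H m) 𝓘(ℝ, E m) f p)) (z : Fin m → ℝ) :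
    screenSpan b z ⊔ radical g f p = tangentHyperplane f p := by
  refine le_antisymm (sup_le (hb.screenSpan_le z) fun v hv ↦ hv.1) fun v hv ↦ ?_
  have h0 := (hb.mem_tangentHyperplane_iff himm).1 hv
  set c := b.repr v Idx.one - ∑ a, z a * b.repr v (Idx.scr a) with hc
  have h1 : v - c • b Idx.one ∈ screenSpan b z := by
    rw [mem_screenSpan_iff]
    simp [h0, hc]
  rw [← sub_add_cancel v (c • b Idx.one)]
  exact add_mem (Submodule.mem_sup_left h1)
    (Submodule.mem_sup_right ((hb.mem_radical_iff himm).2 ⟨c, rfl⟩))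

/-- A screen spanned by the vectors `e_a + z_a e_1` of one isotropic frame is spanned by vectors
of this form in every isotropic frame at the point. -/
theorem exists_screenSpan_eq (hb : IsIsotropicFrame g f p b)
    (himm : Function.Injective (mfderiv 𝓘(ℝ, H m) 𝓘(ℝ, E m) f p)) (z : Fin m → ℝ)
    {b' : Module.Basis (Idx m) ℝ (TangentSpace 𝓘(ℝ, E m) (f p))}
    (hb' : IsIsotropicFrame g f p b') : ∃ z', screenSpan b z = screenSpan b' z' := by
  have hfd : FiniteDimensional ℝ (TangentSpace 𝓘(ℝ, E m) (f p)) := b.finiteDimensional_of_finite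
  have h (a : Fin m) : ∃ c : ℝ, b' (Idx.scr a) + c • b' Idx.one ∈ screenSpan b z := by
    have ha := hb'.tangent_scr a
    rw [← hb.screenSpan_sup_radical himm z, Submodule.mem_sup] at ha
    obtain ⟨s, hs, r, hr, hsr⟩ := ha
    obtain ⟨c, rfl⟩ := (hb'.mem_radical_iff himm).1 hr
    exact ⟨-c, by rw [← hsr]; simpa using hs⟩
  choose z' hz' using h
  refine ⟨z', (Submodule.eq_of_le_of_finrank_eq (Submodule.span_le.2 ?_) ?_).symm⟩
  · rintro _ ⟨a, rfl⟩
    exact hz' a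
  · exact (finrank_screenSpan b' z').trans (finrank_screenSpan b z).symm

end IsIsotropicFrame

end Lightlike

/-! ### Normalization of the isotropic field by the invariant -/

namespace Lightlike

variable {m : ℕ} {M : Type*} [TopologicalSpace M] [ChartedSpace (E m) M]
  [IsManifold 𝓘(ℝ, E m) ∞ M]
  {N : Type*} [TopologicalSpace N] [ChartedSpace (H m) N]
  {g : LorentzMetric m M} {f : N → M} {I : ∀ p : N, TangentSpace 𝓘(ℝ, E m) (f p) → ℝ}

theorem SmoothAlongOn.smul {ξ : ∀ q : N, TangentSpace 𝓘(ℝ, E m) (f q)} {U : Set N}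
    (hξ : SmoothAlongOn f ξ U) {c : N → ℝ} (hc : ContMDiffOn 𝓘(ℝ, H m) 𝓘(ℝ, ℝ) ∞ c U) :
    SmoothAlongOn f (fun q ↦ c q • ξ q) U := by
  intro q hq
  have h := hξ q hq
  rw [Bundle.contMDiffWithinAt_totalSpace] at h ⊢
  refine ⟨h.1, ((hc q hq).smul h.2).congr_of_eventuallyEq ?_ ?_⟩
  · have hmem : ∀ᶠ z in 𝓝[U] q,
        f z ∈ (trivializationAt (E m) (TangentSpace 𝓘(ℝ, E m)) (f q)).baseSet :=
      h.1.continuousWithinAt ((Bundle.Trivialization.open_baseSet _).mem_nhds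
        (FiberBundle.mem_baseSet_trivializationAt (E m) (TangentSpace 𝓘(ℝ, E m)) (f q)))
    filter_upwards [hmem] with z hz
    exact ((trivializationAt (E m) (TangentSpace 𝓘(ℝ, E m)) (f q)).linear ℝ hz).map_smul _ _
  · exact ((trivializationAt (E m) (TangentSpace 𝓘(ℝ, E m)) (f q)).linear ℝ
      (FiberBundle.mem_baseSet_trivializationAt (E m) (TangentSpace 𝓘(ℝ, E m)) (f q))).map_smul _ _

theorem IsRelativeInvariant.abs_smul (hI : IsRelativeInvariant g f 1 I) {p : N}
    {v : TangentSpace 𝓘(ℝ, E m) (f p)} (hv : v ∈ radical g f p) (hv0 : v ≠ 0) {c : ℝ}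
    (hc : c ≠ 0) : |I p (c • v)| = |c| * |I p v| := by
  rcases hc.lt_or_gt with h | h
  · have h1 : c • v = -((-c) • v) := by simp
    rw [h1, hI.neg p _ (Submodule.smul_mem _ _ hv) (smul_ne_zero (neg_ne_zero.2 hc) hv0),
      hI.smul p v hv hv0 _ (neg_pos.2 h), zpow_one, abs_mul, abs_neg]
  · rw [hI.smul p v hv hv0 _ h, zpow_one, abs_mul]

/-- A smooth isotropic field on an open subset of `V`, normalized by `|I| = 1`. It is unique up to
sign, and replaces the choice of a vector `e_1` in the isotropic direction. -/
structure IsUnitField (g : LorentzMetric m M) (f : N → M)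
    (I : ∀ p : N, TangentSpace 𝓘(ℝ, E m) (f p) → ℝ) (U : Set N)
    (ν : ∀ q : N, TangentSpace 𝓘(ℝ, E m) (f q)) : Prop where
  isOpen : IsOpen U
  smooth : SmoothAlongOn f ν U
  radical : ∀ q ∈ U, ν q ∈ radical g f q
  ne_zero : ∀ q ∈ U, ν q ≠ 0
  unit : ∀ q ∈ U, |I q (ν q)| = 1

/-- The unit field `e_1 / |I(e_1)|` of a frame field. -/
def unitField (I : ∀ p : N, TangentSpace 𝓘(ℝ, E m) (f p) → ℝ)
    (e : ∀ q : N, Module.Basis (Idx m) ℝ (TangentSpace 𝓘(ℝ, E m) (f q))) (q : N) :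
    TangentSpace 𝓘(ℝ, E m) (f q) :=
  |I q (e q Idx.one)|⁻¹ • e q Idx.one

theorem mvfderiv_log [IsManifold 𝓘(ℝ, H m) ∞ N] {c : N → ℝ} {p : N}
    (hc : ContMDiffAt 𝓘(ℝ, H m) 𝓘(ℝ, ℝ) ∞ c p) (h0 : c p ≠ 0) (X : TangentSpace 𝓘(ℝ, H m) p) :
    mvfderiv 𝓘(ℝ, H m) (fun q ↦ Real.log (c q)) p X = (c p)⁻¹ * mvfderiv 𝓘(ℝ, H m) c p X := by
  have hχ : chartAt (H m) p ∈ IsManifold.maximalAtlas 𝓘(ℝ, H m) ∞ N :=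
    IsManifold.chart_mem_maximalAtlas _
  have hpχ := mem_chart_source (H m) p
  have hl : ContMDiffAt 𝓘(ℝ, H m) 𝓘(ℝ, ℝ) ∞ (fun q ↦ Real.log (c q)) p :=
    ((Real.contDiffAt_log (n := ∞)).2 h0).contMDiffAt.comp p hc
  have hcp : (c ∘ (chartAt (H m) p).symm) (chartAt (H m) p p) = c p :=
    congrArg c ((chartAt (H m) p).left_inv hpχ)
  refine (mfderiv_eq_fderiv_chart hχ hpχ hl X).trans ?_
  refine Eq.trans ?_ (congrArg _ (mfderiv_eq_fderiv_chart hχ hpχ hc X).symm)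
  have hd := (contDiffAt_comp_chart_symm hχ hpχ hc).differentiableAt (by simp)
  have h2 := hd.hasFDerivAt.log (by rw [hcp]; exact h0)
  rw [hcp] at h2
  exact DFunLike.congr_fun h2.fderiv (mfderiv 𝓘(ℝ, H m) 𝓘(ℝ, H m) (chartAt (H m) p) p X)

section FrameField

variable {U : Set N} {e : ∀ q : N, Module.Basis (Idx m) ℝ (TangentSpace 𝓘(ℝ, E m) (f q))}

theorem contMDiffOn_abs_invariant (hf : IsLightlikeHypersurface g f)
    (hI : IsRelativeInvariant g f 1 I) (hI0 : Nonvanishing g f I) (he : IsFrameField g f U e) :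
    ContMDiffOn 𝓘(ℝ, H m) 𝓘(ℝ, ℝ) ∞ (fun q ↦ |I q (e q Idx.one)|) U := by
  have hrad (q : N) (hq : q ∈ U) := (he.isotropic q hq).one_mem_radical (hf.immersion q)
  have h := hI.smooth U (fun q ↦ e q Idx.one) he.isOpen (he.smooth Idx.one)
    fun q hq ↦ ⟨hrad q hq, (e q).ne_zero _⟩
  intro q hq
  exact (contDiffAt_abs (hI0 q _ (hrad q hq) ((e q).ne_zero _))).contMDiffAt.comp_contMDiffWithinAt
    q (h q hq)

theorem isUnitField_unitField (hf : IsLightlikeHypersurface g f)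
    (hI : IsRelativeInvariant g f 1 I) (hI0 : Nonvanishing g f I) (he : IsFrameField g f U e) :
    IsUnitField g f I U (unitField I e) := by
  have hrad (q : N) (hq : q ∈ U) := (he.isotropic q hq).one_mem_radical (hf.immersion q)
  have hne (q : N) (hq : q ∈ U) : |I q (e q Idx.one)| ≠ 0 :=
    abs_ne_zero.2 (hI0 q _ (hrad q hq) ((e q).ne_zero _))
  refine ⟨he.isOpen, (he.smooth Idx.one).smul ?_, fun q hq ↦ Submodule.smul_mem _ _ (hrad q hq),
    fun q hq ↦ smul_ne_zero (inv_ne_zero (hne q hq)) ((e q).ne_zero _), fun q hq ↦ ?_⟩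
  · exact fun q hq ↦ (contDiffAt_inv ℝ (hne q hq)).contMDiffAt.comp_contMDiffWithinAt q
      (contMDiffOn_abs_invariant hf hI hI0 he q hq)
  · rw [unitField, hI.abs_smul (hrad q hq) ((e q).ne_zero _) (inv_ne_zero (hne q hq)), abs_inv,
      abs_abs, inv_mul_cancel₀ (hne q hq)]

variable [IsManifold 𝓘(ℝ, H m) ∞ N]

/-- The Leibniz rule for `e_1 = |I(e_1)| ν`, where `ν` is the unit field. -/
theorem covDeriv_one_eq (hf : IsLightlikeHypersurface g f)
    (hI : IsRelativeInvariant g f 1 I) (hI0 : Nonvanishing g f I) (he : IsFrameField g f U e)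
    {p : N} (hp : p ∈ U) (X : TangentSpace 𝓘(ℝ, H m) p) :
    covDeriv g f (fun q ↦ e q Idx.one) p X
      = mvfderiv 𝓘(ℝ, H m) (fun q ↦ Real.log |I q (e q Idx.one)|) p X • e p Idx.one
        + |I p (e p Idx.one)| • covDeriv g f (unitField I e) p X := by
  have hrad (q : N) (hq : q ∈ U) := (he.isotropic q hq).one_mem_radical (hf.immersion q)
  have hne (q : N) (hq : q ∈ U) : |I q (e q Idx.one)| ≠ 0 :=
    abs_ne_zero.2 (hI0 q _ (hrad q hq) ((e q).ne_zero _))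
  have hc := contMDiffOn_abs_invariant hf hI hI0 he
  have hcp := hc.contMDiffAt (he.isOpen.mem_nhds hp)
  have hν := (isUnitField_unitField hf hI hI0 he).smooth
  have h1 : ∀ᶠ q in 𝓝 p, e q Idx.one = |I q (e q Idx.one)| • unitField I e q := by
    filter_upwards [he.isOpen.mem_nhds hp] with q hq
    rw [unitField, smul_smul, mul_inv_cancel₀ (hne q hq), one_smul]
  rw [covDeriv_congr h1, covDeriv_fun_smul hf.smooth he.isOpen hν (hν.smul hc) hp hcp]
  congr 1
  rw [mvfderiv_log hcp (hne p hp), unitField, smul_smul, mul_comm]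

end FrameField

end Lightlike

/-! ### The screen map -/

namespace Lightlike

variable {m : ℕ} {M : Type*} [TopologicalSpace M] [ChartedSpace (E m) M]
  [IsManifold 𝓘(ℝ, E m) ∞ M]
  {N : Type*} [TopologicalSpace N] [ChartedSpace (H m) N]
  {g : LorentzMetric m M} {f : N → M} {I : ∀ p : N, TangentSpace 𝓘(ℝ, E m) (f p) → ℝ}

/-- The map `X ↦ ∇_X ν - k df(X)`. When `ν` is a unit field and `∇_ν ν = k ν`, its range is the
screen. -/
def screenMap (g : LorentzMetric m M) (f : N → M)
    (ν : ∀ q : N, TangentSpace 𝓘(ℝ, E m) (f q)) (p : N) (k : ℝ) :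
    TangentSpace 𝓘(ℝ, H m) p →ₗ[ℝ] TangentSpace 𝓘(ℝ, E m) (f p) :=
  covDerivₗ g f ν p - k • (mfderiv 𝓘(ℝ, H m) 𝓘(ℝ, E m) f p).toLinearMap

theorem screenMap_apply (ν : ∀ q : N, TangentSpace 𝓘(ℝ, E m) (f q)) (p : N) (k : ℝ)
    (X : TangentSpace 𝓘(ℝ, H m) p) :
    screenMap g f ν p k X = covDeriv g f ν p X - k • mfderiv 𝓘(ℝ, H m) 𝓘(ℝ, E m) f p X := rfl

/-- The number `k` with `∇_ν ν = k ν`: the failure of the parameter of the null geodesic in the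
direction of `ν` to be affine. -/
def IsAcceleration (g : LorentzMetric m M) (f : N → M)
    (ν : ∀ q : N, TangentSpace 𝓘(ℝ, E m) (f q)) (p : N) (k : ℝ) : Prop :=
  ∃ u : TangentSpace 𝓘(ℝ, H m) p,
    mfderiv 𝓘(ℝ, H m) 𝓘(ℝ, E m) f p u = ν p ∧ screenMap g f ν p k u = 0

theorem IsAcceleration.unique (himm : ∀ p, Function.Injective (mfderiv 𝓘(ℝ, H m) 𝓘(ℝ, E m) f p))
    {ν : ∀ q : N, TangentSpace 𝓘(ℝ, E m) (f q)} {p : N} (h0 : ν p ≠ 0) {k k' : ℝ}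
    (h : IsAcceleration g f ν p k) (h' : IsAcceleration g f ν p k') : k = k' := by
  obtain ⟨u, hu, hk⟩ := h
  obtain ⟨u', hu', hk'⟩ := h'
  obtain rfl : u = u' := himm p (hu.trans hu'.symm)
  rw [screenMap_apply, hu, sub_eq_zero] at hk hk'
  exact smul_left_injective ℝ h0 (hk.symm.trans hk')

/-- Two unit fields agree near a point up to a constant sign. -/
theorem IsUnitField.eventually_eq_smul (hf : IsLightlikeHypersurface g f)
    (hI : IsRelativeInvariant g f 1 I)
    (hframe : ∀ q, ∃ b, IsIsotropicFrame g f q b) {U U' : Set N}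
    {ν ν' : ∀ q : N, TangentSpace 𝓘(ℝ, E m) (f q)} (hν : IsUnitField g f I U ν)
    (hν' : IsUnitField g f I U' ν') {p : N} (hp : p ∈ U) (hp' : p ∈ U') :
    ∃ s : ℝ, s ≠ 0 ∧ ∀ᶠ q in 𝓝 p, ν' q = s • ν q := by
  have hpt (q : N) (hq : q ∈ U) (hq' : q ∈ U') : ∃ s : ℝ, |s| = 1 ∧ ν' q = s • ν q := by
    obtain ⟨b, hb⟩ := hframe q
    obtain ⟨c, hc⟩ := (hb.mem_radical_iff (hf.immersion q)).1 (hν.radical q hq)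
    obtain ⟨c', hc'⟩ := (hb.mem_radical_iff (hf.immersion q)).1 (hν'.radical q hq')
    have hc0 : c ≠ 0 := by
      rintro rfl
      exact hν.ne_zero q hq (by simp [hc])
    have h1 : ν' q = (c' / c) • ν q := by
      rw [hc, hc', smul_smul, div_mul_cancel₀ _ hc0]
    have h2 : c' / c ≠ 0 := by
      intro h
      exact hν'.ne_zero q hq' (by rw [h1, h, zero_smul])
    refine ⟨c' / c, ?_, h1⟩
    have h3 := hν'.unit q hq'
    rwa [h1, hI.abs_smul (hν.radical q hq) (hν.ne_zero q hq) h2, hν.unit q hq, mul_one] at h3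
  obtain ⟨s, hs, hsp⟩ := hpt p hp hp'
  have hs0 : s ≠ 0 := fun h ↦ by simp [h] at hs
  refine ⟨s, hs0, ?_⟩
  -- the sign is locally constant, since the product of the components of `ν'` and `s ν` is
  -- continuous
  have hκ : chartAt (E m) (f p) ∈ IsManifold.maximalAtlas 𝓘(ℝ, E m) ∞ M :=
    IsManifold.chart_mem_maximalAtlas _
  have hfp := mem_chart_source (E m) (f p)
  let η (q : N) : E m := mfderiv 𝓘(ℝ, E m) 𝓘(ℝ, E m) (chartAt (E m) (f p)) (f q) (ν q)
  let η' (q : N) : E m := mfderiv 𝓘(ℝ, E m) 𝓘(ℝ, E m) (chartAt (E m) (f p)) (f q) (ν' q)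
  have hη : ContinuousAt η p := (hν.smooth.contMDiffAt_components hν.isOpen hκ hp hfp).continuousAt
  have hη' : ContinuousAt η' p :=
    (hν'.smooth.contMDiffAt_components hν'.isOpen hκ hp' hfp).continuousAt
  have hrel (q : N) (t : ℝ) (h : ν' q = t • ν q) : η' q = t • η q :=
    (congrArg (mfderiv 𝓘(ℝ, E m) 𝓘(ℝ, E m) (chartAt (E m) (f p)) (f q)) h).trans (map_smul _ _ _)
  have hη0 : η p ≠ 0 := fun h ↦ hν.ne_zero p hp
    ((isInvertible_mfderiv_chart hκ hfp).injective (h.trans (map_zero _).symm))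
  have hpos : 0 < inner ℝ (η' p) (s • η p) := by
    rw [hrel p s hsp]
    exact real_inner_self_pos.2 (smul_ne_zero hs0 hη0)
  filter_upwards [hν.isOpen.mem_nhds hp, hν'.isOpen.mem_nhds hp',
    (hη'.inner (hη.const_smul s)).eventually (lt_mem_nhds hpos)] with q hq hq' hlt
  obtain ⟨t, ht, htq⟩ := hpt q hq hq'
  rcases abs_eq_abs.1 (ht.trans hs.symm) with h | h
  · rwa [h] at htq
  · have h1 : η' q = -(s • η q) := by rw [hrel q t htq, h, neg_smul]
    rw [h1, Pi.smul_apply, inner_neg_left] at hlt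
    exact absurd hlt (not_lt.2 (neg_nonpos.2 real_inner_self_nonneg))

section BasisForm

variable {U : Set N} {e : ∀ q : N, Module.Basis (Idx m) ℝ (TangentSpace 𝓘(ℝ, E m) (f q))}
  {p : N}

theorem basisForm_last (hf : IsLightlikeHypersurface g f) (he : IsFrameField g f U e)
    (hp : p ∈ U) (X : TangentSpace 𝓘(ℝ, H m) p) : basisForm f e p Idx.last X = 0 :=
  ((he.isotropic p hp).mem_tangentHyperplane_iff (hf.immersion p)).1 ⟨X, rfl⟩

theorem exists_basisForm_eq (he : IsFrameField g f U e)
    (hp : p ∈ U) (c : ℝ) (w : Fin m → ℝ) : ∃ X : TangentSpace 𝓘(ℝ, H m) p,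
      basisForm f e p Idx.one X = c ∧ (fun a ↦ basisForm f e p (Idx.scr a) X) = w := by
  have h : c • e p Idx.one + ∑ a, w a • e p (Idx.scr a) ∈ tangentHyperplane f p :=
    add_mem (Submodule.smul_mem _ _ (he.isotropic p hp).tangent_one)
      (Submodule.sum_mem _ fun a _ ↦ Submodule.smul_mem _ _ ((he.isotropic p hp).tangent_scr a))
  obtain ⟨X, hX⟩ := h
  refine ⟨X, ?_, funext fun a ↦ ?_⟩
  · rw [basisForm]
    erw [hX]
    simp
  · rw [basisForm]
    erw [hX]
    simp [Finsupp.single_apply]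

end BasisForm

variable [IsManifold 𝓘(ℝ, H m) ∞ N]

theorem IsUnitField.covDeriv_eq_smul (hf : IsLightlikeHypersurface g f) {U : Set N}
    {ν ν' : ∀ q : N, TangentSpace 𝓘(ℝ, E m) (f q)} (hν : IsUnitField g f I U ν) {p : N}
    (hp : p ∈ U) {s : ℝ} (hs : ∀ᶠ q in 𝓝 p, ν' q = s • ν q) (X : TangentSpace 𝓘(ℝ, H m) p) :
    covDeriv g f ν' p X = s • covDeriv g f ν p X := by
  rw [covDeriv_congr hs, covDeriv_fun_smul hf.smooth hν.isOpen hν.smooth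
    (hν.smooth.smul contMDiffOn_const) hp contMDiffAt_const, mvfderiv_const]
  simp

theorem IsUnitField.screenMap_eq_smul (hf : IsLightlikeHypersurface g f) {U : Set N}
    {ν ν' : ∀ q : N, TangentSpace 𝓘(ℝ, E m) (f q)} (hν : IsUnitField g f I U ν) {p : N}
    (hp : p ∈ U) {s : ℝ} (hs : ∀ᶠ q in 𝓝 p, ν' q = s • ν q) (k : ℝ) :
    screenMap g f ν' p (s * k) = s • screenMap g f ν p k := by
  ext X
  rw [LinearMap.smul_apply, screenMap_apply, screenMap_apply, hν.covDeriv_eq_smul hf hp hs,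
    smul_sub, smul_smul]

/-- The screen does not depend on the unit field. -/
theorem IsUnitField.range_screenMap_eq (hf : IsLightlikeHypersurface g f)
    (hI : IsRelativeInvariant g f 1 I)
    (hframe : ∀ q, ∃ b, IsIsotropicFrame g f q b) {U U' : Set N}
    {ν ν' : ∀ q : N, TangentSpace 𝓘(ℝ, E m) (f q)} (hν : IsUnitField g f I U ν)
    (hν' : IsUnitField g f I U' ν') {p : N} (hp : p ∈ U) (hp' : p ∈ U') {k k' : ℝ}
    (hk : IsAcceleration g f ν p k) (hk' : IsAcceleration g f ν' p k') :
    LinearMap.range (screenMap g f ν p k) = LinearMap.range (screenMap g f ν' p k') := by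
  obtain ⟨s, hs0, hs⟩ := hν.eventually_eq_smul hf hI hframe hν' hp hp'
  have h1 : IsAcceleration g f ν' p (s * k) := by
    obtain ⟨u, hu, hku⟩ := hk
    refine ⟨s • u, ?_, ?_⟩
    · rw [map_smul, hu, hs.self_of_nhds]
    · rw [hν.screenMap_eq_smul hf hp hs, LinearMap.smul_apply, map_smul, hku, smul_zero, smul_zero]
  rw [← h1.unique hf.immersion (hν'.ne_zero p hp') hk', hν.screenMap_eq_smul hf hp hs,
    LinearMap.range_smul _ _ hs0]

section Coefficients

variable {U : Set N} {e : ∀ q : N, Module.Basis (Idx m) ℝ (TangentSpace 𝓘(ℝ, E m) (f q))}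
  {p : N}

theorem connForm_one_last (hf : IsLightlikeHypersurface g f) (he : IsFrameField g f U e)
    (hp : p ∈ U) (X : TangentSpace 𝓘(ℝ, H m) p) : connForm g f e p Idx.one Idx.last X = 0 := by
  have h := inner_covDeriv_self (g := g) hf.smooth he.isOpen (he.smooth Idx.one)
    (fun q hq ↦ (he.isotropic q hq).one_mem_radical (hf.immersion q)) hp X
  rw [(he.isotropic p hp).inner_one] at h
  simpa [connForm] using h

/-- The null generators are geodesics, so that the form `ω_1^a` vanishes on `e_1`. -/
theorem connForm_one_scr_eq_zero (hf : IsLightlikeHypersurface g f) (he : IsFrameField g f U e)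
    (hp : p ∈ U) {u : TangentSpace 𝓘(ℝ, H m) p}
    (hu : mfderiv 𝓘(ℝ, H m) 𝓘(ℝ, E m) f p u = e p Idx.one) (a : Fin m) :
    connForm g f e p Idx.one (Idx.scr a) u = 0 := by
  have hrad (q : N) (hq : q ∈ U) := (he.isotropic q hq).one_mem_radical (hf.immersion q)
  have hmem : covDeriv g f (fun q ↦ e q Idx.one) p u ∈ radical g f p := by
    refine ⟨((he.isotropic p hp).mem_tangentHyperplane_iff (hf.immersion p)).2
      (connForm_one_last hf he hp u), ?_⟩
    rintro _ ⟨Y, rfl⟩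
    have h1 := inner_covDeriv_symm (g := g) hf.smooth he.isOpen (he.smooth Idx.one) hrad hp u Y
    rw [hu] at h1
    exact h1.trans
      (inner_covDeriv_self hf.smooth he.isOpen (he.smooth Idx.one) hrad hp Y)
  obtain ⟨c, hc⟩ := ((he.isotropic p hp).mem_radical_iff (hf.immersion p)).1 hmem
  rw [connForm, hc]
  simp

theorem exists_hasCoefficients (hf : IsLightlikeHypersurface g f) (he : IsFrameField g f U e)
    (hp : p ∈ U) : ∃ lam K Ka, HasCoefficients g f I e p lam K Ka := by
  obtain ⟨u, hu⟩ := (he.isotropic p hp).tangent_one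
  choose x hx using (he.isotropic p hp).tangent_scr
  have hdec (X : TangentSpace 𝓘(ℝ, H m) p) : X = basisForm f e p Idx.one X • u
      + ∑ b, basisForm f e p (Idx.scr b) X • x b := by
    apply hf.immersion p
    rw [map_add, map_smul, map_sum]
    simp only [map_smul]
    erw [hu]
    refine (sum_frame_repr (e p) _).trans ?_
    rw [← basisForm, ← basisForm, basisForm_last hf he hp, zero_smul, add_zero]
    refine congrArg₂ _ rfl (Finset.sum_congr rfl fun a _ ↦ ?_)
    exact congrArg _ (hx a).symm
  -- a linear form is determined by its values on the vectors projecting to the frame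
  have hlin (θ : TangentSpace 𝓘(ℝ, H m) p →ₗ[ℝ] ℝ) (X : TangentSpace 𝓘(ℝ, H m) p) :
      θ X = θ u * basisForm f e p Idx.one X + ∑ b, θ (x b) * basisForm f e p (Idx.scr b) X := by
    conv_lhs => rw [hdec X]
    simp only [map_add, map_smul, map_sum, smul_eq_mul, mul_comm]
  let conn (j : Idx m) : TangentSpace 𝓘(ℝ, H m) p →ₗ[ℝ] ℝ :=
    (e p).coord j ∘ₗ covDerivₗ g f (fun q ↦ e q Idx.one) p
  let θ : TangentSpace 𝓘(ℝ, H m) p →ₗ[ℝ] ℝ :=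
    (mvfderiv 𝓘(ℝ, H m) (fun q ↦ Real.log |I q (e q Idx.one)|) p).toLinearMap - conn Idx.one
  refine ⟨Matrix.of fun a b ↦ conn (Idx.scr a) (x b), - θ u, fun b ↦ - θ (x b), ?_, ?_⟩
  · intro a X
    refine (hlin (conn (Idx.scr a)) X).trans ?_
    have h0 : conn (Idx.scr a) u = 0 := connForm_one_scr_eq_zero hf he hp hu a
    rw [h0, zero_mul, zero_add]
    rfl
  · intro X
    refine (hlin θ X).trans ?_
    simp

/-- The screen map in terms of the coefficients in a frame field: its matrix with respect to the
screen vectors is `Λ = λ - K`, and its components along `e_1` are the `K_a`. -/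
theorem HasCoefficients.smul_screenMap (hf : IsLightlikeHypersurface g f)
    (hI : IsRelativeInvariant g f 1 I) (hI0 : Nonvanishing g f I) (he : IsFrameField g f U e)
    (hp : p ∈ U) {lam : Matrix (Fin m) (Fin m) ℝ} {K : ℝ} {Ka : Fin m → ℝ}
    (hc : HasCoefficients g f I e p lam K Ka) (X : TangentSpace 𝓘(ℝ, H m) p) :
    |I p (e p Idx.one)| • screenMap g f (unitField I e) p (K / |I p (e p Idx.one)|) X
      = ∑ c, basisForm f e p (Idx.scr c) X • (Ka c • e p Idx.one
        + ∑ a, (lam - K • (1 : Matrix (Fin m) (Fin m) ℝ)) a c • e p (Idx.scr a)) := by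
  have hh : |I p (e p Idx.one)| ≠ 0 := abs_ne_zero.2 (hI0 p _
    ((he.isotropic p hp).one_mem_radical (hf.immersion p)) ((e p).ne_zero _))
  have h1 := covDeriv_one_eq hf hI hI0 he hp X
  have h2 : |I p (e p Idx.one)| • screenMap g f (unitField I e) p (K / |I p (e p Idx.one)|) X
      = covDeriv g f (fun q ↦ e q Idx.one) p X
        - mvfderiv 𝓘(ℝ, H m) (fun q ↦ Real.log |I q (e q Idx.one)|) p X • e p Idx.one
        - K • mfderiv 𝓘(ℝ, H m) 𝓘(ℝ, E m) f p X := by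
    rw [h1, add_sub_cancel_left, screenMap_apply, smul_sub, smul_smul, mul_div_cancel₀ _ hh]
  obtain ⟨r1, r2, r3⟩ := repr_sum_screen (e p) (k := Ka)
    (Λ := lam - K • (1 : Matrix (Fin m) (Fin m) ℝ)) (fun c ↦ basisForm f e p (Idx.scr c) X)
  rw [h2]
  refine (e p).ext_elem fun i ↦ ?_
  have hL : (e p).repr (covDeriv g f (fun q ↦ e q Idx.one) p X
      - mvfderiv 𝓘(ℝ, H m) (fun q ↦ Real.log |I q (e q Idx.one)|) p X • e p Idx.one
        - K • mfderiv 𝓘(ℝ, H m) 𝓘(ℝ, E m) f p X) i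
      = connForm g f e p Idx.one i X
        - mvfderiv 𝓘(ℝ, H m) (fun q ↦ Real.log |I q (e q Idx.one)|) p X
          * (if Idx.one = i then 1 else 0) - K * basisForm f e p i X := by
    simp [connForm, basisForm, Finsupp.single_apply]
  rw [hL]
  match i with
  | Sum.inl () =>
    refine Eq.trans ?_ r2.symm
    have h := hc.dlog X
    simp only [dotProduct, if_true, mul_one]
    linarith
  | Sum.inr (Sum.inl a) =>
    refine Eq.trans ?_ (r3 a).symm
    have h := hc.shape a X
    simp only [Matrix.sub_mulVec, Matrix.smul_mulVec, Matrix.one_mulVec, Pi.sub_apply,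
      Pi.smul_apply, smul_eq_mul]
    simp only [reduceCtorEq, if_false, mul_zero, sub_zero]
    rw [h]
    rfl
  | Sum.inr (Sum.inr ()) =>
    refine Eq.trans ?_ r1.symm
    rw [connForm_one_last hf he hp, basisForm_last hf he hp]
    simp

theorem HasCoefficients.isAcceleration (hf : IsLightlikeHypersurface g f)
    (hI : IsRelativeInvariant g f 1 I) (hI0 : Nonvanishing g f I) (he : IsFrameField g f U e)
    (hp : p ∈ U) {lam : Matrix (Fin m) (Fin m) ℝ} {K : ℝ} {Ka : Fin m → ℝ}
    (hc : HasCoefficients g f I e p lam K Ka) :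
    IsAcceleration g f (unitField I e) p (K / |I p (e p Idx.one)|) := by
  have hν := isUnitField_unitField hf hI hI0 he
  obtain ⟨u, hu⟩ := (hν.radical p hp).1
  refine ⟨u, hu, ?_⟩
  have hh : |I p (e p Idx.one)| ≠ 0 := abs_ne_zero.2 (hI0 p _
    ((he.isotropic p hp).one_mem_radical (hf.immersion p)) ((e p).ne_zero _))
  have h0 (c : Fin m) : basisForm f e p (Idx.scr c) u = 0 := by
    rw [basisForm]
    erw [hu]
    simp [unitField]
  have h := hc.smul_screenMap hf hI hI0 he hp u
  simp only [h0, zero_smul, Finset.sum_const_zero] at h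
  exact (smul_eq_zero.1 h).resolve_left hh

/-- The screen in terms of the coefficients in a frame field. -/
theorem HasCoefficients.range_screenMap (hf : IsLightlikeHypersurface g f)
    (hI : IsRelativeInvariant g f 1 I) (hI0 : Nonvanishing g f I) (he : IsFrameField g f U e)
    (hp : p ∈ U) {lam : Matrix (Fin m) (Fin m) ℝ} {K : ℝ} {Ka : Fin m → ℝ}
    (hc : HasCoefficients g f I e p lam K Ka) (hK : ¬ lam.charpoly.IsRoot K) :
    LinearMap.range (screenMap g f (unitField I e) p (K / |I p (e p Idx.one)|))
      = screenSpan (e p) (normObj lam K Ka) := by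
  have hh : |I p (e p Idx.one)| ≠ 0 := abs_ne_zero.2 (hI0 p _
    ((he.isotropic p hp).one_mem_radical (hf.immersion p)) ((e p).ne_zero _))
  rw [← LinearMap.range_smul _ _ hh]
  refine range_eq_screenSpan (e p) (θ := fun X c ↦ basisForm f e p (Idx.scr c) X)
    (fun w ↦ ?_) (fun X ↦ ?_) (not_isRoot_charpoly_iff.1 hK)
  · obtain ⟨X, -, hX⟩ := exists_basisForm_eq he hp 0 w
    exact ⟨X, hX⟩
  · exact hc.smul_screenMap hf hI hI0 he hp X

/-- The condition that `K` is not a characteristic root, without reference to frames. -/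
theorem HasCoefficients.not_isRoot_iff (hf : IsLightlikeHypersurface g f)
    (hI : IsRelativeInvariant g f 1 I) (hI0 : Nonvanishing g f I) (he : IsFrameField g f U e)
    (hp : p ∈ U) {lam : Matrix (Fin m) (Fin m) ℝ} {K : ℝ} {Ka : Fin m → ℝ}
    (hc : HasCoefficients g f I e p lam K Ka) :
    ¬ lam.charpoly.IsRoot K ↔ tangentHyperplane f p ≤
      LinearMap.range (screenMap g f (unitField I e) p (K / |I p (e p Idx.one)|))
        ⊔ radical g f p := by
  have hh : |I p (e p Idx.one)| ≠ 0 := abs_ne_zero.2 (hI0 p _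
    ((he.isotropic p hp).one_mem_radical (hf.immersion p)) ((e p).ne_zero _))
  constructor
  · intro hK
    rw [hc.range_screenMap hf hI hI0 he hp hK,
      (he.isotropic p hp).screenSpan_sup_radical (hf.immersion p)]
  · intro hle
    refine not_isRoot_charpoly_iff.2 (isUnit_det_of_scr_mem (e p)
      (Q := |I p (e p Idx.one)| • screenMap g f (unitField I e) p (K / |I p (e p Idx.one)|))
      (θ := fun X c ↦ basisForm f e p (Idx.scr c) X)
      (fun X ↦ hc.smul_screenMap hf hI hI0 he hp X) fun a ↦ ?_)
    have hrange : LinearMap.range (|I p (e p Idx.one)| • screenMap g f (unitField I e) p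
        (K / |I p (e p Idx.one)|)) = LinearMap.range (screenMap g f (unitField I e) p
        (K / |I p (e p Idx.one)|)) := LinearMap.range_smul _ _ hh
    have hrad : radical g f p ≤ Submodule.span ℝ {e p Idx.one} := fun v hv ↦ by
      obtain ⟨c, rfl⟩ := ((he.isotropic p hp).mem_radical_iff (hf.immersion p)).1 hv
      exact Submodule.mem_span_singleton.2 ⟨c, rfl⟩
    exact (sup_le_sup hrange.ge hrad) (hle ((he.isotropic p hp).tangent_scr a))

end Coefficients

end Lightlike

/-! ### Smoothness of the screen -/

namespace Lightlike

section Coordinates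

variable {m : ℕ}

/-- The number `k` with `∇_η η = k η` for a field `η` tangent to the hypersurface, in coordinates;
`l` is a linear map onto the parameter space whose composition with the differential of the
parametrization `φ` is invertible. The auxiliary Euclidean inner product extracts the factor. -/
def coordAcceleration (G : E m → Bil m) (φ η : H m → E m) (l : E m →L[ℝ] H m) (x : H m) : ℝ :=
  inner ℝ (η x) (coordCov G φ η x ((l.comp (fderiv ℝ φ x)).inverse (l (η x))))
    / inner ℝ (η x) (η x)

theorem contDiffAt_coordAcceleration {G : E m → Bil m} {φ η : H m → E m} {l : E m →L[ℝ] H m}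
    {x : H m} (hG : (G (φ x)).IsInvertible) (hd : ContDiffAt ℝ ∞ G (φ x))
    (hφ : ContDiffAt ℝ ∞ φ x) (hη : ContDiffAt ℝ ∞ η x)
    (hl : (l.comp (fderiv ℝ φ x)).IsInvertible) (h0 : η x ≠ 0) :
    ContDiffAt ℝ ∞ (coordAcceleration G φ η l) x := by
  have h1 : ContDiffAt ℝ ∞ (fun z ↦ l.comp (fderiv ℝ φ z)) x :=
    contDiffAt_const.clm_comp (hφ.fderiv_right (m := ∞) (by simp))
  have h2 : ContDiffAt ℝ ∞ (fun z ↦ (l.comp (fderiv ℝ φ z)).inverse) x :=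
    ContDiffAt.comp (g := ContinuousLinearMap.inverse) x hl.contDiffAt_map_inverse h1
  have h3 := h2.clm_apply (l.contDiff.contDiffAt.comp x hη)
  exact (hη.inner ℝ (contDiffAt_coordCov hG hd hφ hη h3)).div (hη.inner ℝ hη)
    (inner_self_ne_zero.2 h0)

theorem coordAcceleration_eq {G : E m → Bil m} {φ η : H m → E m} {l : E m →L[ℝ] H m}
    {x u : H m} {k : ℝ} (hl : (l.comp (fderiv ℝ φ x)).IsInvertible) (h0 : η x ≠ 0)
    (hu : fderiv ℝ φ x u = η x) (hk : coordCov G φ η x u = k • η x) :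
    coordAcceleration G φ η l x = k := by
  have h1 : (l.comp (fderiv ℝ φ x)).inverse (l (η x)) = u := by
    rw [← hu]
    exact hl.inverse_apply_self u
  rw [coordAcceleration, h1, hk, inner_smul_right,
    mul_div_cancel_right₀ _ (inner_self_ne_zero.2 h0)]

end Coordinates

variable {m : ℕ} {M : Type*} [TopologicalSpace M] [ChartedSpace (E m) M]
  [IsManifold 𝓘(ℝ, E m) ∞ M]
  {N : Type*} [TopologicalSpace N] [ChartedSpace (H m) N]
  {g : LorentzMetric m M} {f : N → M} {I : ∀ p : N, TangentSpace 𝓘(ℝ, E m) (f p) → ℝ}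
  {U : Set N} {ν : ∀ q : N, TangentSpace 𝓘(ℝ, E m) (f q)}
  {χ : OpenPartialHomeomorph N (H m)} {κ : OpenPartialHomeomorph M (E m)} {p : N}

theorem injective_fderiv_paramInChart (hf : IsLightlikeHypersurface g f)
    (hχ : χ ∈ IsManifold.maximalAtlas 𝓘(ℝ, H m) ∞ N)
    (hκ : κ ∈ IsManifold.maximalAtlas 𝓘(ℝ, E m) ∞ M) (hpχ : p ∈ χ.source)
    (hfp : f p ∈ κ.source) : Function.Injective (fderiv ℝ (paramInChart f χ κ) (χ p)) := by
  intro Y Z hYZ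
  obtain ⟨Y, rfl⟩ := (isInvertible_mfderiv_chart hχ hpχ).surjective Y
  obtain ⟨Z, rfl⟩ := (isInvertible_mfderiv_chart hχ hpχ).surjective Z
  rw [fderiv_paramInChart hχ hκ hf.smooth hpχ hfp, fderiv_paramInChart hχ hκ hf.smooth hpχ hfp]
    at hYZ
  exact congrArg _ (hf.immersion p ((isInvertible_mfderiv_chart hκ hfp).injective hYZ))

theorem fieldInChart_ne_zero (hν : IsUnitField g f I U ν)
    (hκ : κ ∈ IsManifold.maximalAtlas 𝓘(ℝ, E m) ∞ M) (hp : p ∈ U) (hpχ : p ∈ χ.source)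
    (hfp : f p ∈ κ.source) : fieldInChart f χ κ ν (χ p) ≠ 0 := by
  rw [fieldInChart_apply ν hpχ]
  exact fun h ↦ hν.ne_zero p hp
    ((isInvertible_mfderiv_chart hκ hfp).injective (h.trans (map_zero _).symm))

theorem mfderiv_screenMap (hf : IsLightlikeHypersurface g f) (hν : IsUnitField g f I U ν)
    (hχ : χ ∈ IsManifold.maximalAtlas 𝓘(ℝ, H m) ∞ N)
    (hκ : κ ∈ IsManifold.maximalAtlas 𝓘(ℝ, E m) ∞ M) (hp : p ∈ U) (hpχ : p ∈ χ.source)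
    (hfp : f p ∈ κ.source) (k : ℝ) (X : TangentSpace 𝓘(ℝ, H m) p) :
    mfderiv 𝓘(ℝ, E m) 𝓘(ℝ, E m) κ (f p) (screenMap g f ν p k X)
      = coordCov (metricInChart g κ) (paramInChart f χ κ) (fieldInChart f χ κ ν) (χ p)
          (mfderiv 𝓘(ℝ, H m) 𝓘(ℝ, H m) χ p X)
        - k • fderiv ℝ (paramInChart f χ κ) (χ p) (mfderiv 𝓘(ℝ, H m) 𝓘(ℝ, H m) χ p X) := by
  rw [screenMap_apply, map_sub, map_smul, mfderiv_covDeriv g hχ hκ hf.smooth hν.smooth hν.isOpen hp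
    hpχ hfp, fderiv_paramInChart hχ hκ hf.smooth hpχ hfp]
  rfl

theorem IsAcceleration.exists_coord (hf : IsLightlikeHypersurface g f)
    (hν : IsUnitField g f I U ν)
    (hχ : χ ∈ IsManifold.maximalAtlas 𝓘(ℝ, H m) ∞ N)
    (hκ : κ ∈ IsManifold.maximalAtlas 𝓘(ℝ, E m) ∞ M) (hp : p ∈ U) (hpχ : p ∈ χ.source)
    (hfp : f p ∈ κ.source) {k : ℝ} (hk : IsAcceleration g f ν p k) :
    ∃ u : H m, fderiv ℝ (paramInChart f χ κ) (χ p) u = fieldInChart f χ κ ν (χ p) ∧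
      coordCov (metricInChart g κ) (paramInChart f χ κ) (fieldInChart f χ κ ν) (χ p) u
        = k • fieldInChart f χ κ ν (χ p) := by
  obtain ⟨u, hu, hku⟩ := hk
  have h1 : fderiv ℝ (paramInChart f χ κ) (χ p) (mfderiv 𝓘(ℝ, H m) 𝓘(ℝ, H m) χ p u)
      = fieldInChart f χ κ ν (χ p) := by
    rw [fderiv_paramInChart hχ hκ hf.smooth hpχ hfp, fieldInChart_apply ν hpχ]
    exact congrArg _ hu
  refine ⟨_, h1, ?_⟩
  have h2 := mfderiv_screenMap hf hν hχ hκ hp hpχ hfp k u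
  rw [hku, map_zero, h1] at h2
  exact (sub_eq_zero.1 h2.symm)

variable [IsManifold 𝓘(ℝ, H m) ∞ N]

/-- The ranges of the screen maps of a unit field form a smooth field of subspaces, provided that
they have dimension `m = n - 2`. -/
theorem exists_smooth_spanning (hf : IsLightlikeHypersurface g f)
    (hν : IsUnitField g f I U ν) (hp : p ∈ U)
    {S : ∀ q : N, Submodule ℝ (TangentSpace 𝓘(ℝ, E m) (f q))}
    (hS : ∀ q ∈ U, Module.finrank ℝ (S q) = m ∧
      ∃ k, IsAcceleration g f ν q k ∧ S q = LinearMap.range (screenMap g f ν q k)) :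
    ∃ U : Set N, IsOpen U ∧ p ∈ U ∧
      ∃ s : Fin m → ∀ q : N, TangentSpace 𝓘(ℝ, E m) (f q),
        (∀ a, SmoothAlongOn f (s a) U) ∧
        ∀ q ∈ U, S q = Submodule.span ℝ (Set.range fun a ↦ s a q) := by
  set χ := chartAt (H m) p
  set κ := chartAt (E m) (f p)
  have hκ : κ ∈ IsManifold.maximalAtlas 𝓘(ℝ, E m) ∞ M := IsManifold.chart_mem_maximalAtlas _
  have hχ : χ ∈ IsManifold.maximalAtlas 𝓘(ℝ, H m) ∞ N := IsManifold.chart_mem_maximalAtlas _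
  have hfp : f p ∈ κ.source := mem_chart_source (E m) (f p)
  have hpχ : p ∈ χ.source := mem_chart_source (H m) p
  set G := metricInChart g κ with hG
  set φ := paramInChart f χ κ with hφ
  set η := fieldInChart f χ κ ν with hη
  obtain ⟨l, hl⟩ : ∃ l : E m →L[ℝ] H m, l.comp (fderiv ℝ φ (χ p)) = ContinuousLinearMap.id ℝ _ := by
    obtain ⟨l, hl⟩ := LinearMap.exists_leftInverse_of_injective
      (fderiv ℝ φ (χ p)).toLinearMap
      (LinearMap.ker_eq_bot.2 (injective_fderiv_paramInChart hf hχ hκ hpχ hfp))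
    exact ⟨LinearMap.toContinuousLinearMap l, ContinuousLinearMap.ext fun Y ↦
      DFunLike.congr_fun hl Y⟩
  -- constant directions in which the screen map at `p` takes linearly independent values
  obtain ⟨hdim, k, hk, hSk⟩ := hS p hp
  have hfd : FiniteDimensional ℝ (TangentSpace 𝓘(ℝ, E m) (f p)) :=
    inferInstanceAs (FiniteDimensional ℝ (E m))
  let B := Module.finBasisOfFinrankEq ℝ (S p) hdim
  have hB (a : Fin m) : ∃ X, screenMap g f ν p k X = (B a : TangentSpace 𝓘(ℝ, E m) (f p)) :=
    LinearMap.mem_range.1 (hSk.le (B a).2)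
  choose X hX using hB
  let c (a : Fin m) : H m := mfderiv 𝓘(ℝ, H m) 𝓘(ℝ, H m) χ p (X a)
  let σ (a : Fin m) (x : H m) : E m :=
    coordCov G φ η x (c a) - coordAcceleration G φ η l x • fderiv ℝ φ x (c a)
  have hacc (q : N) (hqU : q ∈ U) (hq : q ∈ χ.source) (hfq : f q ∈ κ.source)
      (hlq : (l.comp (fderiv ℝ φ (χ q))).IsInvertible) (k : ℝ) (hk : IsAcceleration g f ν q k) :
      coordAcceleration G φ η l (χ q) = k := by
    obtain ⟨u, hu, hku⟩ := hk.exists_coord hf hν hχ hκ hqU hq hfq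
    exact coordAcceleration_eq hlq (fieldInChart_ne_zero hν hκ hqU hq hfq) hu hku
  have hσS (q : N) (hqU : q ∈ U) (hq : q ∈ χ.source) (hfq : f q ∈ κ.source)
      (hlq : (l.comp (fderiv ℝ φ (χ q))).IsInvertible) (a : Fin m) :
      (mfderiv 𝓘(ℝ, E m) 𝓘(ℝ, E m) κ (f q)).inverse (σ a (χ q)) ∈ S q := by
    obtain ⟨-, k, hk, hSk⟩ := hS q hqU
    obtain ⟨Y, hY⟩ := (isInvertible_mfderiv_chart hχ hq).surjective (c a)
    rw [hSk]
    refine ⟨Y, ?_⟩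
    have h := mfderiv_screenMap hf hν hχ hκ hqU hq hfq k Y
    erw [hY] at h
    rw [← hacc q hqU hq hfq hlq k hk] at h ⊢
    exact (((isInvertible_mfderiv_chart hκ hfq).inverse_apply_eq).2 h.symm).symm
  have hsm (q : N) (hqU : q ∈ U) (hq : q ∈ χ.source) (hfq : f q ∈ κ.source)
      (hlq : (l.comp (fderiv ℝ φ (χ q))).IsInvertible) (a : Fin m) :
      ContDiffAt ℝ ∞ (σ a) (χ q) := by
    have hφq := contDiffAt_paramInChart hχ hκ hf.smooth hq hfq
    have hηq := contDiffAt_fieldInChart hχ hκ hν.smooth hν.isOpen hqU hq hfq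
    have hGq : (G (φ (χ q))).IsInvertible := by
      rw [hφ, paramInChart_apply hq]; exact isInvertible_metricInChart g hκ hfq
    have hdq : ContDiffAt ℝ ∞ G (φ (χ q)) := by
      rw [hφ, paramInChart_apply hq]; exact contDiffAt_metricInChart g hκ hfq
    exact (contDiffAt_coordCov hGq hdq hφq hηq contDiffAt_const).sub
      ((contDiffAt_coordAcceleration hGq hdq hφq hηq hlq
        (fieldInChart_ne_zero hν hκ hqU hq hfq)).smul
        ((hφq.fderiv_right (m := ∞) (by simp)).clm_apply contDiffAt_const))
  have hlp : (l.comp (fderiv ℝ φ (χ p))).IsInvertible := by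
    rw [hl]; exact ⟨ContinuousLinearEquiv.refl ℝ _, rfl⟩
  have hli : LinearIndependent ℝ fun a ↦ σ a (χ p) := by
    have h1 : LinearIndependent ℝ fun a ↦ (B a : TangentSpace 𝓘(ℝ, E m) (f p)) :=
      B.linearIndependent.map' (S p).subtype (Submodule.ker_subtype _)
    have h2 := h1.map' (mfderiv 𝓘(ℝ, E m) 𝓘(ℝ, E m) κ (f p)).toLinearMap
      (LinearMap.ker_eq_bot.2 (isInvertible_mfderiv_chart hκ hfp).injective)
    have h3 : (fun a ↦ σ a (χ p)) = fun a ↦ (mfderiv 𝓘(ℝ, E m) 𝓘(ℝ, E m) κ (f p)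
        (B a : TangentSpace 𝓘(ℝ, E m) (f p)) : E m) := by
      funext a
      rw [← hX, mfderiv_screenMap hf hν hχ hκ hp hpχ hfp]
      simp only [σ, hacc p hp hpχ hfp hlp k hk]
      rfl
    rw [h3]
    exact h2
  have hcont : ContinuousAt (fun q ↦ fun a ↦ σ a (χ q)) p :=
    continuousAt_pi.2 fun a ↦ ContinuousAt.comp (f := χ) (hsm p hp hpχ hfp hlp a).continuousAt
      (χ.continuousAt hpχ)
  have hinv : ∀ᶠ q in 𝓝 p, (l.comp (fderiv ℝ φ (χ q))).IsInvertible := by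
    have h1 : ContinuousAt (fun x ↦ l.comp (fderiv ℝ φ x)) (χ p) :=
      continuousAt_const.clm_comp ((contDiffAt_paramInChart hχ hκ hf.smooth hpχ hfp).fderiv_right
        (m := ∞) (by simp)).continuousAt
    obtain ⟨e₀, he₀⟩ := hlp
    have h2 := ContinuousLinearEquiv.nhds e₀
    rw [he₀] at h2
    exact (ContinuousAt.comp (f := χ) h1 (χ.continuousAt hpχ)).eventually h2
  have hev : ∀ᶠ q in 𝓝 p, q ∈ U ∧ q ∈ χ.source ∧ f q ∈ κ.source ∧
      (l.comp (fderiv ℝ φ (χ q))).IsInvertible ∧ LinearIndependent ℝ fun a ↦ σ a (χ q) := by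
    filter_upwards [hν.isOpen.mem_nhds hp, χ.open_source.mem_nhds hpχ,
      hf.smooth.continuous.continuousAt.preimage_mem_nhds (κ.open_source.mem_nhds hfp), hinv,
      hcont.eventually hli.eventually] with q h1 h2 h3 h4 h5
    exact ⟨h1, h2, h3, h4, h5⟩
  obtain ⟨W, hW, hWo, hpW⟩ := eventually_nhds_iff.1 hev
  refine ⟨W, hWo, hpW, fun a q ↦ (mfderiv 𝓘(ℝ, E m) 𝓘(ℝ, E m) κ (f q)).inverse (σ a (χ q)),
    fun a ↦ ?_, fun q hq ↦ ?_⟩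
  · refine smoothAlongOn_of_components hf.smooth hκ (fun q hq ↦ (hW q hq).2.2.1) fun q hq ↦ ?_
    obtain ⟨h1, h2, h3, h4, -⟩ := hW q hq
    exact ((hsm q h1 h2 h3 h4 a).contMDiffAt.comp q
      (contMDiffAt_of_mem_maximalAtlas hχ h2)).contMDiffWithinAt
  · obtain ⟨h1, h2, h3, h4, h5⟩ := hW q hq
    have hfdq : FiniteDimensional ℝ (TangentSpace 𝓘(ℝ, E m) (f q)) :=
      inferInstanceAs (FiniteDimensional ℝ (E m))
    refine (Submodule.eq_of_le_of_finrank_eq (Submodule.span_le.2 ?_) ?_).symm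
    · rintro _ ⟨a, rfl⟩
      exact hσS q h1 h2 h3 h4 a
    · rw [(hS q h1).1]
      have h6 := h5.map' (mfderiv 𝓘(ℝ, E m) 𝓘(ℝ, E m) κ (f q)).inverse.toLinearMap
        (LinearMap.ker_eq_bot.2 (isInvertible_mfderiv_chart hκ h3).inverse.injective)
      exact (finrank_span_eq_card h6).trans (Fintype.card_fin m)

end Lightlike

/-! ### The induced normalization -/

namespace Lightlike

variable {m : ℕ} {M : Type*} [TopologicalSpace M] [ChartedSpace (E m) M]

/-- The transformation law of the coordinates `z_a` of a fixed screen under a change of frame. -/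
theorem mul_eq_of_screenSpan_eq {x : M}
    {b b' : Module.Basis (Idx m) ℝ (TangentSpace 𝓘(ℝ, E m) x)} {z z' : Fin m → ℝ}
    (h : screenSpan b z = screenSpan b' z') {t : ℝ} {A : Matrix (Fin m) (Fin m) ℝ} {β : Fin m → ℝ}
    (h1 : b' Idx.one = t • b Idx.one)
    (h2 : ∀ a, b' (Idx.scr a) = (∑ c, A a c • b (Idx.scr c)) + β a • b Idx.one) (a : Fin m) :
    t * z' a = (∑ c, A a c * z c) - β a := by
  have ha : b' (Idx.scr a) + z' a • b' Idx.one ∈ screenSpan b z := by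
    rw [h]
    exact Submodule.subset_span ⟨a, rfl⟩
  have h3 := ((mem_screenSpan_iff b).1 ha).2
  rw [h1, h2] at h3
  simp only [map_add, map_sum, map_smul, Module.Basis.repr_self, Finsupp.add_apply,
    Finsupp.finsetSum_apply, Finsupp.smul_apply, Finsupp.single_apply, smul_eq_mul] at h3
  simp only [reduceCtorEq, Sum.inr.injEq, Sum.inl.injEq, if_false, if_true, mul_zero, mul_one,
    Finset.sum_const_zero, mul_ite, Finset.sum_ite_eq', Finset.mem_univ, zero_add, add_zero] at h3
  simp only [mul_comm (A a _)]
  linarith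

variable [IsManifold 𝓘(ℝ, E m) ∞ M]
  {N : Type*} [TopologicalSpace N] [ChartedSpace (H m) N]
  {g : LorentzMetric m M} {f : N → M} {I : ∀ p : N, TangentSpace 𝓘(ℝ, E m) (f p) → ℝ}

theorem NotCharacteristicRoot.exists_isIsotropicFrame (hNR : NotCharacteristicRoot g f I) (q : N) :
    ∃ b, IsIsotropicFrame g f q b := by
  obtain ⟨U, e, hq, he, -⟩ := hNR q
  exact ⟨e q, he.isotropic q hq⟩

/-- Smooth isotropic fields normalized by `|I| = 1` exist locally, are geodesic, and the ranges of
their screen maps give the screen. -/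
theorem IsInducedNormalization.exists_isUnitField [IsManifold 𝓘(ℝ, H m) ∞ N]
    (hf : IsLightlikeHypersurface g f)
    (hI : IsRelativeInvariant g f 1 I) (hI0 : Nonvanishing g f I)
    (hNR : NotCharacteristicRoot g f I)
    {z : ∀ p : N, Module.Basis (Idx m) ℝ (TangentSpace 𝓘(ℝ, E m) (f p)) → Fin m → ℝ}
    {S : ∀ p : N, Submodule ℝ (TangentSpace 𝓘(ℝ, E m) (f p))}
    (hS : IsInducedNormalization g f I z S) (p : N) :
    ∃ (U : Set N) (ν : ∀ q : N, TangentSpace 𝓘(ℝ, E m) (f q)) (k : ℝ), p ∈ U ∧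
      IsUnitField g f I U ν ∧ IsAcceleration g f ν p k ∧
      S p = LinearMap.range (screenMap g f ν p k) := by
  obtain ⟨U, e, hp, he, lam, K, Ka, hc, hK⟩ := hNR p
  exact ⟨U, unitField I e, _, hp, isUnitField_unitField hf hI hI0 he,
    hc.isAcceleration hf hI hI0 he hp, by
      rw [hS.screen_eq p (e p) (he.isotropic p hp), hS.obj_eq U e he p hp lam K Ka hc,
        hc.range_screenMap hf hI hI0 he hp hK]⟩

theorem NotCharacteristicRoot.eq_of_isInducedNormalization
    (hNR : NotCharacteristicRoot g f I)
    {z z' : ∀ p : N, Module.Basis (Idx m) ℝ (TangentSpace 𝓘(ℝ, E m) (f p)) → Fin m → ℝ}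
    {S S' : ∀ p : N, Submodule ℝ (TangentSpace 𝓘(ℝ, E m) (f p))}
    (hS : IsInducedNormalization g f I z S) (hS' : IsInducedNormalization g f I z' S') :
    S' = S := by
  funext p
  obtain ⟨U, e, hp, he, lam, K, Ka, hc, -⟩ := hNR p
  rw [hS.screen_eq p (e p) (he.isotropic p hp), hS.obj_eq U e he p hp lam K Ka hc,
    hS'.screen_eq p (e p) (he.isotropic p hp), hS'.obj_eq U e he p hp lam K Ka hc]

theorem IsInducedNormalization.isNormalizingObject
    {z : ∀ p : N, Module.Basis (Idx m) ℝ (TangentSpace 𝓘(ℝ, E m) (f p)) → Fin m → ℝ}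
    {S : ∀ p : N, Submodule ℝ (TangentSpace 𝓘(ℝ, E m) (f p))}
    (hS : IsInducedNormalization g f I z S) : IsNormalizingObject g f z := by
  intro p b b' hb hb' t A β h1 h2 a
  exact mul_eq_of_screenSpan_eq ((hS.screen_eq p b hb).symm.trans (hS.screen_eq p b' hb')) h1 h2 a

section

variable [IsManifold 𝓘(ℝ, H m) ∞ N] {U : Set N}
  {e : ∀ q : N, Module.Basis (Idx m) ℝ (TangentSpace 𝓘(ℝ, E m) (f q))} {p : N}
  {lam : Matrix (Fin m) (Fin m) ℝ} {K : ℝ} {Ka : Fin m → ℝ}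

/-- If `K` is not a characteristic root in one frame field near each point, then it is not a
characteristic root in any frame field. -/
theorem HasCoefficients.not_isRoot (hf : IsLightlikeHypersurface g f)
    (hI : IsRelativeInvariant g f 1 I) (hI0 : Nonvanishing g f I)
    (hNR : NotCharacteristicRoot g f I) (he : IsFrameField g f U e)
    (hp : p ∈ U) (hc : HasCoefficients g f I e p lam K Ka) : ¬ lam.charpoly.IsRoot K := by
  obtain ⟨U', e', hp', he', lam', K', Ka', hc', hK'⟩ := hNR p
  rw [hc.not_isRoot_iff hf hI hI0 he hp,
    (isUnitField_unitField hf hI hI0 he).range_screenMap_eq hf hI hNR.exists_isIsotropicFrame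
      (isUnitField_unitField hf hI hI0 he') hp hp' (hc.isAcceleration hf hI hI0 he hp)
      (hc'.isAcceleration hf hI hI0 he' hp')]
  exact (hc'.not_isRoot_iff hf hI hI0 he' hp').1 hK'

theorem HasCoefficients.screenSpan_eq (hf : IsLightlikeHypersurface g f)
    (hI : IsRelativeInvariant g f 1 I) (hI0 : Nonvanishing g f I)
    (hNR : NotCharacteristicRoot g f I) (he : IsFrameField g f U e)
    (hp : p ∈ U) (hc : HasCoefficients g f I e p lam K Ka)
    {U' : Set N} {e' : ∀ q : N, Module.Basis (Idx m) ℝ (TangentSpace 𝓘(ℝ, E m) (f q))}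
    {lam' : Matrix (Fin m) (Fin m) ℝ} {K' : ℝ} {Ka' : Fin m → ℝ} (he' : IsFrameField g f U' e')
    (hp' : p ∈ U') (hc' : HasCoefficients g f I e' p lam' K' Ka') :
    screenSpan (e p) (normObj lam K Ka) = screenSpan (e' p) (normObj lam' K' Ka') := by
  rw [← hc.range_screenMap hf hI hI0 he hp (hc.not_isRoot hf hI hI0 hNR he hp),
    ← hc'.range_screenMap hf hI hI0 he' hp' (hc'.not_isRoot hf hI hI0 hNR he' hp')]
  exact (isUnitField_unitField hf hI hI0 he).range_screenMap_eq hf hI hNR.exists_isIsotropicFrame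
    (isUnitField_unitField hf hI hI0 he') hp hp' (hc.isAcceleration hf hI hI0 he hp)
    (hc'.isAcceleration hf hI hI0 he' hp')

end

variable [IsManifold 𝓘(ℝ, H m) ∞ N]

theorem exists_isInducedNormalization (hf : IsLightlikeHypersurface g f)
    (hI : IsRelativeInvariant g f 1 I) (hI0 : Nonvanishing g f I)
    (hNR : NotCharacteristicRoot g f I) : ∃ z S, IsInducedNormalization g f I z S := by
  classical
  choose U e hp he lam K Ka hc _ using id hNR
  let S (p : N) : Submodule ℝ (TangentSpace 𝓘(ℝ, E m) (f p)) :=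
    screenSpan (e p p) (normObj (lam p) (K p) (Ka p))
  have hex (p : N) (b : Module.Basis (Idx m) ℝ (TangentSpace 𝓘(ℝ, E m) (f p)))
      (hb : IsIsotropicFrame g f p b) : ∃ z, S p = screenSpan b z :=
    ((he p).isotropic p (hp p)).exists_screenSpan_eq (hf.immersion p) _ hb
  let z (p : N) (b : Module.Basis (Idx m) ℝ (TangentSpace 𝓘(ℝ, E m) (f p))) : Fin m → ℝ :=
    if h : ∃ z, S p = screenSpan b z then h.choose else 0
  have hz (p : N) (b : Module.Basis (Idx m) ℝ (TangentSpace 𝓘(ℝ, E m) (f p)))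
      (hb : IsIsotropicFrame g f p b) : S p = screenSpan b (z p b) := by
    have h := hex p b hb
    simp only [z, dif_pos h]
    exact h.choose_spec
  refine ⟨z, S, fun U' e' he' p hp' lam' K' Ka' hc' ↦ ?_, hz⟩
  refine screenSpan_injective (e' p) ?_
  rw [← hz p (e' p) (he'.isotropic p hp')]
  exact (hc p).screenSpan_eq hf hI hI0 hNR (he p) (hp p) he' hp' hc'

theorem IsInducedNormalization.isScreenDistribution (hf : IsLightlikeHypersurface g f)
    (hI : IsRelativeInvariant g f 1 I) (hI0 : Nonvanishing g f I)
    (hNR : NotCharacteristicRoot g f I)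
    {z : ∀ p : N, Module.Basis (Idx m) ℝ (TangentSpace 𝓘(ℝ, E m) (f p)) → Fin m → ℝ}
    {S : ∀ p : N, Submodule ℝ (TangentSpace 𝓘(ℝ, E m) (f p))}
    (hS : IsInducedNormalization g f I z S) : IsScreenDistribution g f S where
  inf_eq p := by
    obtain ⟨b, hb⟩ := hNR.exists_isIsotropicFrame p
    rw [hS.screen_eq p b hb, hb.screenSpan_inf_radical (hf.immersion p)]
  sup_eq p := by
    obtain ⟨b, hb⟩ := hNR.exists_isIsotropicFrame p
    rw [hS.screen_eq p b hb, hb.screenSpan_sup_radical (hf.immersion p)]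
  smooth p := by
    obtain ⟨U, e, hp, he, -⟩ := hNR p
    refine exists_smooth_spanning hf (isUnitField_unitField hf hI hI0 he) hp fun q hq ↦ ?_
    obtain ⟨lam, K, Ka, hc⟩ := exists_hasCoefficients (I := I) hf he hq
    refine ⟨?_, _, hc.isAcceleration hf hI hI0 he hq, ?_⟩
    · rw [hS.screen_eq q _ (he.isotropic q hq), finrank_screenSpan]
    · rw [hS.screen_eq q _ (he.isotropic q hq), hS.obj_eq U e he q hq lam K Ka hc,
        hc.range_screenMap hf hI hI0 he hq (hc.not_isRoot hf hI hI0 hNR he hq)]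

end Lightlike

/-! ### The algebraic equations on third-order data -/

namespace Lightlike

section Homogeneous

variable {A B : Type*} [NormedAddCommGroup A] [NormedSpace ℝ A] [NormedAddCommGroup B]
  [NormedSpace ℝ B]

/-- Euler's relation for a function which is homogeneous of degree one in its second argument. -/
theorem fderivWithin_of_homogeneous {F : A × B → ℝ} {D : Set (A × B)} {a : A} {v : B}
    (hF : DifferentiableWithinAt ℝ F D (a, v))
    (hhom : ∀ t : ℝ, 0 < t → (a, t • v) ∈ D ∧ F (a, t • v) = t * F (a, v)) :
    fderivWithin ℝ F D (a, v) (0, v) = F (a, v) := by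
  have d1 : HasDerivAt (fun t : ℝ ↦ (a, t • v)) (0, v) 1 := by
    have h1 := (hasDerivAt_id (1 : ℝ)).smul_const v
    rw [one_smul] at h1
    exact (hasDerivAt_const (1 : ℝ) a).prodMk h1
  have hpos : ∀ᶠ t : ℝ in 𝓝 1, 0 < t := lt_mem_nhds one_pos
  have dF : HasFDerivWithinAt F (fderivWithin ℝ F D (a, v)) D (a, (1 : ℝ) • v) := by
    rw [one_smul]
    exact hF.hasFDerivWithinAt
  have d2 := dF.comp_hasDerivAt (1 : ℝ) d1 (hpos.mono fun t ht ↦ (hhom t ht).1)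
  have d3 : HasDerivAt (fun t : ℝ ↦ t * F (a, v)) (1 * F (a, v)) 1 :=
    (hasDerivAt_id (1 : ℝ)).mul_const _
  have d4 := d3.congr_of_eventuallyEq
    (f₁ := F ∘ fun t : ℝ ↦ (a, t • v)) (hpos.mono fun t ht ↦ (hhom t ht).2)
  rw [d2.unique d4, one_mul]

theorem mul_apply_eq_zero_of_sub_eq_smul {L : A × B →L[ℝ] ℝ} {a : A} {b b' v : B} {c : ℝ}
    (h : L (a, b) = 0) (h' : L (a, b') = 0) (hc : b - b' = c • v) : c * L (0, v) = 0 := by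
  have h1 : c • ((0, v) : A × B) = (a, b) - (a, b') := by
    rw [Prod.mk_sub_mk, sub_self, hc, Prod.smul_mk, smul_zero]
  rw [← smul_eq_mul, ← map_smul, h1, map_sub, h, h', sub_zero]

end Homogeneous

section Coordinates

variable {m : ℕ}

/-- The second-order part of third-order data. -/
def Jet3.toJet2 (J : Jet3 m) : Jet2 m := ((J.1.1, J.1.2.1), (J.2.1, J.2.2.1))

/-- The Christoffel operation as a function of the 1-jet of the metric. -/
def Jet3.christoffel (J : Jet3 m) (u v : E m) : E m :=
  (1 / 2 : ℝ) • J.1.1.inverse (J.1.2.1 u v + J.1.2.1 v u - (J.1.2.1.flip u).flip v)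

/-- The third-order data of a parametrization `φ` and a metric `G` in coordinates. -/
def coordJet3 (G : E m → Bil m) (φ : H m → E m) (x : H m) : Jet3 m :=
  ((G (φ x), fderiv ℝ G (φ x), fderiv ℝ (fderiv ℝ G) (φ x)),
    (fderiv ℝ φ x, fderiv ℝ (fderiv ℝ φ) x, fderiv ℝ (fderiv ℝ (fderiv ℝ φ)) x))

/-- `(v, T)` satisfies the algebraic equations that hold for the value `v` and the derivative `T` of
an isotropic field normalized by `|F| = 1`, at a point where the third-order data are `J`: the
orthogonality to the hypersurface, the normalization, and the equations obtained from these two by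
differentiation. The tangency of `v` is not included. -/
structure IsUnitJet (F : Jet2 m × E m → ℝ) (D : Set (Jet2 m × E m)) (J : Jet3 m) (v : E m)
    (T : H m →L[ℝ] E m) : Prop where
  ne_zero : v ≠ 0
  mem : (J.toJet2, v) ∈ D
  unit : |F (J.toJet2, v)| = 1
  orthogonal : ∀ Y, J.1.1 v (J.2.1 Y) = 0
  deriv_unit : ∀ X, fderivWithin ℝ F D (J.toJet2, v)
    (((J.1.2.1 (J.2.1 X), J.1.2.2 (J.2.1 X)), (J.2.2.1 X, J.2.2.2 X)), T X) = 0
  deriv_orthogonal : ∀ X Y,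
    J.1.2.1 (J.2.1 X) v (J.2.1 Y) + J.1.1 (T X) (J.2.1 Y) + J.1.1 v (J.2.2.1 X Y) = 0

/-- The subspace `W` is the screen computed from the third-order data `J`: the range of
`X ↦ ∇_X ν - k df(X)`, where `ν` has value `v` and derivative `T`, and `∇_ν ν = k ν`. -/
def IsScreenOfJet (F : Jet2 m × E m → ℝ) (D : Set (Jet2 m × E m)) (J : Jet3 m)
    (W : Submodule ℝ (E m)) : Prop :=
  ∃ (v : E m) (T : H m →L[ℝ] E m) (u : H m) (k : ℝ), IsUnitJet F D J v T ∧ J.2.1 u = v ∧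
    T u + J.christoffel (J.2.1 u) v = k • v ∧
    ∀ w, w ∈ W ↔ ∃ Y, T Y + J.christoffel (J.2.1 Y) v - k • J.2.1 Y = w

variable {F : Jet2 m × E m → ℝ} {D : Set (Jet2 m × E m)}

/-- An isotropic field normalized by `|F| = 1` satisfies the algebraic equations. -/
theorem isUnitJet_coordJet3 (hF : ContDiffOn ℝ ∞ F D) {G : E m → Bil m} {φ η : H m → E m} {x : H m}
    (hd : ContDiffAt ℝ ∞ G (φ x)) (hφ : ContDiffAt ℝ ∞ φ x) (hη : ContDiffAt ℝ ∞ η x)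
    (h0 : η x ≠ 0) (horth : ∀ᶠ z in 𝓝 x, ∀ Y, G (φ z) (η z) (fderiv ℝ φ z Y) = 0)
    (hmem : ∀ᶠ z in 𝓝 x, ((coordJet3 G φ z).toJet2, η z) ∈ D)
    (hunit : ∀ᶠ z in 𝓝 x, |F ((coordJet3 G φ z).toJet2, η z)| = 1) :
    IsUnitJet F D (coordJet3 G φ x) (η x) (fderiv ℝ η x) := by
  have dφ : HasFDerivAt φ (fderiv ℝ φ x) x := (hφ.differentiableAt (by simp)).hasFDerivAt
  have dη : HasFDerivAt η (fderiv ℝ η x) x := (hη.differentiableAt (by simp)).hasFDerivAt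
  have hφ1 : ContDiffAt ℝ ∞ (fderiv ℝ φ) x := hφ.fderiv_right (m := ∞) (by simp)
  have hφ2 : ContDiffAt ℝ ∞ (fderiv ℝ (fderiv ℝ φ)) x := hφ1.fderiv_right (m := ∞) (by simp)
  have hG1 : ContDiffAt ℝ ∞ (fderiv ℝ G) (φ x) := hd.fderiv_right (m := ∞) (by simp)
  have dφ1 := (hφ1.differentiableAt (by simp)).hasFDerivAt
  have dφ2 := (hφ2.differentiableAt (by simp)).hasFDerivAt
  have dG := (hd.differentiableAt (by simp)).hasFDerivAt.comp x dφ
  have dG1 := (hG1.differentiableAt (by simp)).hasFDerivAt.comp x dφ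
  refine ⟨h0, hmem.self_of_nhds, hunit.self_of_nhds, horth.self_of_nhds, fun X ↦ ?_, fun X Y ↦ ?_⟩
  · have dγ := ((dG.prodMk dG1).prodMk (dφ1.prodMk dφ2)).prodMk dη
    have dF := ((hF.differentiableOn (by simp)) _ hmem.self_of_nhds).hasFDerivWithinAt
    have dFγ := dF.comp_hasFDerivAt x dγ hmem
    -- `F` takes the values `1` and `-1` along the field and is continuous, hence locally constant
    have hconst : (F ∘ fun z ↦ ((coordJet3 G φ z).toJet2, η z)) =ᶠ[𝓝 x]
        fun _ ↦ F ((coordJet3 G φ x).toJet2, η x) := by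
      have hpos : 0 < F ((coordJet3 G φ x).toJet2, η x) * F ((coordJet3 G φ x).toJet2, η x) :=
        mul_self_pos.2 fun h ↦ by simpa [h] using hunit.self_of_nhds
      have hc : ContinuousAt (fun z ↦ F ((coordJet3 G φ z).toJet2, η z)
          * F ((coordJet3 G φ x).toJet2, η x)) x :=
        ContinuousAt.mul dFγ.continuousAt continuousAt_const
      filter_upwards [hc.eventually (lt_mem_nhds hpos), hunit] with z h1 h2
      rcases abs_eq_abs.1 (h2.trans hunit.self_of_nhds.symm) with h | h
      · exact h
      · rw [h] at h1
        linarith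
    exact DFunLike.congr_fun (dFγ.unique ((hasFDerivAt_const _ x).congr_of_eventuallyEq hconst)) X
  · have d := (dG.clm_apply dη).clm_apply (dφ1.clm_apply (hasFDerivAt_const Y x))
    have hz : (fun z ↦ G (φ z) (η z) (fderiv ℝ φ z Y)) =ᶠ[𝓝 x] fun _ ↦ 0 :=
      horth.mono fun z hz ↦ hz Y
    have h := DFunLike.congr_fun (d.unique ((hasFDerivAt_const (0 : ℝ) x).congr_of_eventuallyEq hz))
      X
    simp only [add_apply, ContinuousLinearMap.comp_apply, ContinuousLinearMap.flip_apply,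
      zero_apply, map_zero, zero_add, Function.comp_apply] at h
    change fderiv ℝ G (φ x) (fderiv ℝ φ x X) (η x) (fderiv ℝ φ x Y)
      + G (φ x) (fderiv ℝ η x X) (fderiv ℝ φ x Y)
      + G (φ x) (η x) (fderiv ℝ (fderiv ℝ φ) x X Y) = 0
    linarith

/-- The algebraic equations determine the derivative of the normalized isotropic field from its
value: the orthogonality determines it up to multiples of the value, and these are excluded by the
normalization, since `F` is homogeneous of degree one. -/
theorem IsUnitJet.eq_of_eq (hF : ContDiffOn ℝ ∞ F D) {J : Jet3 m} {v : E m} {T T' : H m →L[ℝ] E m}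
    (h : IsUnitJet F D J v T) (h' : IsUnitJet F D J v T')
    (horth : ∀ d, (∀ Y, J.1.1 d (J.2.1 Y) = 0) → ∃ c : ℝ, d = c • v)
    (hhom : ∀ t : ℝ, 0 < t → (J.toJet2, t • v) ∈ D ∧
      F (J.toJet2, t • v) = t * F (J.toJet2, v)) : T = T' := by
  have hv := fderivWithin_of_homogeneous (hF.differentiableOn (by simp) _ h.mem) hhom
  ext1 X
  obtain ⟨c, hc⟩ := horth (T X - T' X) fun Y ↦ by
    have h1 := h.deriv_orthogonal X Y
    have h2 := h'.deriv_orthogonal X Y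
    rw [map_sub, sub_apply]
    linarith
  have h4 := mul_apply_eq_zero_of_sub_eq_smul (h.deriv_unit X) (h'.deriv_unit X) hc
  rw [hv, mul_eq_zero] at h4
  have h6 : F (J.toJet2, v) ≠ 0 := fun h0 ↦ by simpa [h0] using h.unit
  rw [h4.resolve_right h6, zero_smul] at hc
  exact sub_eq_zero.1 hc

end Coordinates

end Lightlike

/-! ### Third-order dependence of the screen -/

namespace Lightlike

variable {m : ℕ} {M : Type*} [TopologicalSpace M] [ChartedSpace (E m) M]
  [IsManifold 𝓘(ℝ, E m) ∞ M]
  {N : Type*} [TopologicalSpace N] {g : LorentzMetric m M} {f : N → M}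
  {I : ∀ p : N, TangentSpace 𝓘(ℝ, E m) (f p) → ℝ}
  {χ : OpenPartialHomeomorph N (H m)} {κ : OpenPartialHomeomorph M (E m)} {p : N}
  {F : Jet2 m × E m → ℝ} {D : Set (Jet2 m × E m)}
  {U : Set N} {ν : ∀ q : N, TangentSpace 𝓘(ℝ, E m) (f q)}

theorem jet3_eq_coordJet3 (hp : p ∈ χ.source) :
    jet3 g f χ κ p = coordJet3 (metricInChart g κ) (paramInChart f χ κ) (χ p) := by
  rw [coordJet3, paramInChart_apply hp]
  rfl

theorem toJet2_jet3 : (jet3 g f χ κ p).toJet2 = jet2 g f χ κ p := rfl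

theorem christoffel_jet3 (hpχ : p ∈ χ.source) (Y : H m) (v : E m) :
    (jet3 g f χ κ p).christoffel ((jet3 g f χ κ p).2.1 Y) v
      = christoffel (metricInChart g κ) (paramInChart f χ κ (χ p))
          (fderiv ℝ (paramInChart f χ κ) (χ p) Y) v := by
  rw [paramInChart_apply hpχ]
  rfl

variable [ChartedSpace (H m) N]

theorem IsUnitField.smul (hI : IsRelativeInvariant g f 1 I) (hν : IsUnitField g f I U ν) {s : ℝ}
    (hs : |s| = 1) : IsUnitField g f I U fun q ↦ s • ν q := by
  have hs0 : s ≠ 0 := fun h ↦ by simp [h] at hs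
  refine ⟨hν.isOpen, hν.smooth.smul contMDiffOn_const,
    fun q hq ↦ Submodule.smul_mem _ _ (hν.radical q hq),
    fun q hq ↦ smul_ne_zero hs0 (hν.ne_zero q hq),
    fun q hq ↦ ?_⟩
  rw [hI.abs_smul (hν.radical q hq) (hν.ne_zero q hq) hs0, hs, hν.unit q hq, mul_one]

theorem IsIsotropicFrame.mem_radical_of_orthogonal
    {b : Module.Basis (Idx m) ℝ (TangentSpace 𝓘(ℝ, E m) (f p))} (hb : IsIsotropicFrame g f p b)
    (himm : Function.Injective (mfderiv 𝓘(ℝ, H m) 𝓘(ℝ, E m) f p))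
    {w : TangentSpace 𝓘(ℝ, E m) (f p)} (hw : ∀ v ∈ tangentHyperplane f p, g.val (f p) w v = 0) :
    w ∈ radical g f p := by
  refine ⟨(hb.mem_tangentHyperplane_iff himm).2 ?_, hw⟩
  have h := hb.inner_one w
  rw [hw _ hb.tangent_one] at h
  linarith

/-- A vector which is orthogonal to the hypersurface in coordinates is a multiple of the unit
field. -/
theorem IsUnitField.exists_eq_smul (hf : IsLightlikeHypersurface g f)
    (hframe : ∀ q, ∃ b, IsIsotropicFrame g f q b) (hν : IsUnitField g f I U ν)
    (hχ : χ ∈ IsManifold.maximalAtlas 𝓘(ℝ, H m) ∞ N)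
    (hκ : κ ∈ IsManifold.maximalAtlas 𝓘(ℝ, E m) ∞ M) (hp : p ∈ U) (hpχ : p ∈ χ.source)
    (hfp : f p ∈ κ.source) {d : E m}
    (hd : ∀ Y, metricInChart g κ (κ (f p)) d (fderiv ℝ (paramInChart f χ κ) (χ p) Y) = 0) :
    ∃ c : ℝ, d = c • fieldInChart f χ κ ν (χ p) := by
  obtain ⟨b, hb⟩ := hframe p
  obtain ⟨d, rfl⟩ := (isInvertible_mfderiv_chart hκ hfp).surjective d
  have hrad : d ∈ Lightlike.radical g f p := by
    refine hb.mem_radical_of_orthogonal (hf.immersion p) ?_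
    rintro _ ⟨Y, rfl⟩
    have h := hd (mfderiv 𝓘(ℝ, H m) 𝓘(ℝ, H m) χ p Y)
    rw [fderiv_paramInChart hχ hκ hf.smooth hpχ hfp, metricInChart_mfderiv g hκ hfp] at h
    exact h
  obtain ⟨c, rfl⟩ := (hb.mem_radical_iff (hf.immersion p)).1 hrad
  obtain ⟨c', hc'⟩ := (hb.mem_radical_iff (hf.immersion p)).1 (hν.radical p hp)
  have hc0 : c' ≠ 0 := by
    rintro rfl
    exact hν.ne_zero p hp (by simp [hc'])
  refine ⟨c / c', ?_⟩
  have h1 : c • b Idx.one = (c / c') • ν p := by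
    rw [hc', smul_smul, div_mul_cancel₀ _ hc0]
  rw [h1, fieldInChart_apply ν hpχ, map_smul]
  rfl

/-- The components of a unit field satisfy the algebraic equations in all coordinates. -/
theorem IsUnitField.isUnitJet (hF : ContDiffOn ℝ ∞ F D) (hf : IsLightlikeHypersurface g f)
    (hID : GivenBySecondOrder F D g f I) (hν : IsUnitField g f I U ν)
    (hχ : χ ∈ IsManifold.maximalAtlas 𝓘(ℝ, H m) ∞ N)
    (hκ : κ ∈ IsManifold.maximalAtlas 𝓘(ℝ, E m) ∞ M) (hp : p ∈ U) (hpχ : p ∈ χ.source)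
    (hfp : f p ∈ κ.source) :
    IsUnitJet F D (jet3 g f χ κ p) (fieldInChart f χ κ ν (χ p))
      (fderiv ℝ (fieldInChart f χ κ ν) (χ p)) := by
  rw [jet3_eq_coordJet3 hpχ]
  have hd : ContDiffAt ℝ ∞ (metricInChart g κ) (paramInChart f χ κ (χ p)) := by
    rw [paramInChart_apply hpχ]
    exact contDiffAt_metricInChart g hκ hfp
  have hmem : ∀ᶠ z in 𝓝 (χ p),
      ((coordJet3 (metricInChart g κ) (paramInChart f χ κ) z).toJet2, fieldInChart f χ κ ν z) ∈ D ∧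
      |F ((coordJet3 (metricInChart g κ) (paramInChart f χ κ) z).toJet2, fieldInChart f χ κ ν z)|
        = 1 := by
    have hU : U ∩ f ⁻¹' κ.source ∈ 𝓝 p := Filter.inter_mem (hν.isOpen.mem_nhds hp)
      (hf.smooth.continuous.continuousAt.preimage_mem_nhds (κ.open_source.mem_nhds hfp))
    filter_upwards [eventually_mem_chart_source hpχ hU] with z ⟨hz, hzs, hzU, hfz⟩
    have h := hID (χ.symm z) χ hχ κ hκ hzs hfz _ (hν.radical _ hzU) (hν.ne_zero _ hzU)
    rw [← toJet2_jet3, jet3_eq_coordJet3 hzs, χ.right_inv hz] at h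
    refine ⟨h.1, ?_⟩
    have h1 := hν.unit _ hzU
    rwa [h.2] at h1
  exact isUnitJet_coordJet3 hF hd (contDiffAt_paramInChart hχ hκ hf.smooth hpχ hfp)
    (contDiffAt_fieldInChart hχ hκ hν.smooth hν.isOpen hp hpχ hfp)
    (fieldInChart_ne_zero hν hκ hp hpχ hfp)
    (eventually_inner_fieldInChart hχ hκ hf.smooth hν.isOpen hν.radical hp hpχ hfp)
    (hmem.mono fun z hz ↦ hz.1) (hmem.mono fun z hz ↦ hz.2)

/-- Every solution of the algebraic equations comes from one of the unit fields `ν` and `-ν`. -/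
theorem IsUnitJet.exists_isUnitField (hF : ContDiffOn ℝ ∞ F D) (hf : IsLightlikeHypersurface g f)
    (hI : IsRelativeInvariant g f 1 I)
    (hframe : ∀ q, ∃ b, IsIsotropicFrame g f q b)
    (hID : GivenBySecondOrder F D g f I) (hν : IsUnitField g f I U ν)
    (hχ : χ ∈ IsManifold.maximalAtlas 𝓘(ℝ, H m) ∞ N)
    (hκ : κ ∈ IsManifold.maximalAtlas 𝓘(ℝ, E m) ∞ M) (hp : p ∈ U) (hpχ : p ∈ χ.source)
    (hfp : f p ∈ κ.source) {v : E m} {T : H m →L[ℝ] E m}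
    (h : IsUnitJet F D (jet3 g f χ κ p) v T) :
    ∃ s : ℝ, |s| = 1 ∧ v = fieldInChart f χ κ (fun q ↦ s • ν q) (χ p) ∧
      T = fderiv ℝ (fieldInChart f χ κ fun q ↦ s • ν q) (χ p) := by
  obtain ⟨s, hs⟩ := hν.exists_eq_smul hf hframe hχ hκ hp hpχ hfp h.orthogonal
  have hs0 : s ≠ 0 := by
    rintro rfl
    exact h.ne_zero (by simp [hs])
  have hvs : v = mfderiv 𝓘(ℝ, E m) 𝓘(ℝ, E m) κ (f p) (s • ν p) := by
    rw [hs, fieldInChart_apply ν hpχ, map_smul]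
    rfl
  have hrad : s • ν p ∈ radical g f p := Submodule.smul_mem _ _ (hν.radical p hp)
  have hne : s • ν p ≠ 0 := smul_ne_zero hs0 (hν.ne_zero p hp)
  have hs1 : |s| = 1 := by
    have h1 := h.unit
    have h2 := hID p χ hχ κ hκ hpχ hfp _ hrad hne
    rw [toJet2_jet3, hvs] at h1
    rwa [← h2.2, hI.abs_smul (hν.radical p hp) (hν.ne_zero p hp) hs0, hν.unit p hp, mul_one] at h1
  have hν' := hν.smul hI hs1
  have hv' : v = fieldInChart f χ κ (fun q ↦ s • ν q) (χ p) := by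
    rw [hvs, fieldInChart_apply _ hpχ]
  refine ⟨s, hs1, hv', ?_⟩
  have h' := hν'.isUnitJet hF hf hID hχ hκ hp hpχ hfp
  rw [← hv'] at h'
  refine h.eq_of_eq hF h' (fun d hd ↦ ?_) fun t ht ↦ ?_
  · rw [hv']
    exact hν'.exists_eq_smul hf hframe hχ hκ hp hpχ hfp hd
  · have h1 := hID p χ hχ κ hκ hpχ hfp _ hrad hne
    have h2 := hID p χ hχ κ hκ hpχ hfp _ (Submodule.smul_mem _ t hrad) (smul_ne_zero ht.ne' hne)
    rw [map_smul, ← hvs, hI.smul p _ hrad hne t ht, zpow_one] at h2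
    rw [← hvs] at h1
    rw [h1.2] at h2
    exact ⟨h2.1, h2.2.symm⟩

/-- The range of the screen map in terms of the third-order data in coordinates. -/
theorem mem_map_range_screenMap_iff (hf : IsLightlikeHypersurface g f)
    (hν : IsUnitField g f I U ν) (hχ : χ ∈ IsManifold.maximalAtlas 𝓘(ℝ, H m) ∞ N)
    (hκ : κ ∈ IsManifold.maximalAtlas 𝓘(ℝ, E m) ∞ M) (hp : p ∈ U) (hpχ : p ∈ χ.source)
    (hfp : f p ∈ κ.source) {k : ℝ} {w : E m} :
    w ∈ (LinearMap.range (screenMap g f ν p k)).map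
        (mfderiv 𝓘(ℝ, E m) 𝓘(ℝ, E m) κ (f p)).toLinearMap ↔
      ∃ Y, fderiv ℝ (fieldInChart f χ κ ν) (χ p) Y
        + (jet3 g f χ κ p).christoffel ((jet3 g f χ κ p).2.1 Y) (fieldInChart f χ κ ν (χ p))
        - k • (jet3 g f χ κ p).2.1 Y = w := by
  simp only [christoffel_jet3 hpχ]
  constructor
  · rintro ⟨_, ⟨X, rfl⟩, rfl⟩
    exact ⟨mfderiv 𝓘(ℝ, H m) 𝓘(ℝ, H m) χ p X,
      (mfderiv_screenMap hf hν hχ hκ hp hpχ hfp k X).symm⟩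
  · rintro ⟨Y, rfl⟩
    obtain ⟨X, rfl⟩ := (isInvertible_mfderiv_chart hχ hpχ).surjective Y
    exact ⟨_, ⟨X, rfl⟩, mfderiv_screenMap hf hν hχ hκ hp hpχ hfp k X⟩

/-- The screen of a unit field satisfies the algebraic description in all coordinates. -/
theorem IsUnitField.isScreenOfJet (hF : ContDiffOn ℝ ∞ F D) (hf : IsLightlikeHypersurface g f)
    (hID : GivenBySecondOrder F D g f I) (hν : IsUnitField g f I U ν)
    (hχ : χ ∈ IsManifold.maximalAtlas 𝓘(ℝ, H m) ∞ N)
    (hκ : κ ∈ IsManifold.maximalAtlas 𝓘(ℝ, E m) ∞ M) (hp : p ∈ U) (hpχ : p ∈ χ.source)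
    (hfp : f p ∈ κ.source) {k : ℝ} (hk : IsAcceleration g f ν p k) :
    IsScreenOfJet F D (jet3 g f χ κ p) ((LinearMap.range (screenMap g f ν p k)).map
      (mfderiv 𝓘(ℝ, E m) 𝓘(ℝ, E m) κ (f p)).toLinearMap) := by
  obtain ⟨u, hu, hku⟩ := hk.exists_coord hf hν hχ hκ hp hpχ hfp
  refine ⟨_, _, u, k, hν.isUnitJet hF hf hID hχ hκ hp hpχ hfp, hu, ?_,
    fun w ↦ mem_map_range_screenMap_iff hf hν hχ hκ hp hpχ hfp⟩
  rw [christoffel_jet3 hpχ]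
  exact hku

variable [IsManifold 𝓘(ℝ, H m) ∞ N]

/-- The algebraic description determines the screen. -/
theorem IsScreenOfJet.eq_map_range (hF : ContDiffOn ℝ ∞ F D) (hf : IsLightlikeHypersurface g f)
    (hI : IsRelativeInvariant g f 1 I)
    (hframe : ∀ q, ∃ b, IsIsotropicFrame g f q b)
    (hID : GivenBySecondOrder F D g f I) (hν : IsUnitField g f I U ν)
    (hχ : χ ∈ IsManifold.maximalAtlas 𝓘(ℝ, H m) ∞ N)
    (hκ : κ ∈ IsManifold.maximalAtlas 𝓘(ℝ, E m) ∞ M) (hp : p ∈ U) (hpχ : p ∈ χ.source)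
    (hfp : f p ∈ κ.source) {k : ℝ} (hk : IsAcceleration g f ν p k)
    {W : Submodule ℝ (E m)} (hW : IsScreenOfJet F D (jet3 g f χ κ p) W) :
    W = (LinearMap.range (screenMap g f ν p k)).map
      (mfderiv 𝓘(ℝ, E m) 𝓘(ℝ, E m) κ (f p)).toLinearMap := by
  obtain ⟨v, T, u, k', h, hu, hku, hW⟩ := hW
  obtain ⟨s, hs, rfl, rfl⟩ := h.exists_isUnitField hF hf hI hframe hID hν hχ hκ hp hpχ hfp
  have hν' := hν.smul hI hs
  rw [christoffel_jet3 hpχ] at hku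
  obtain ⟨X, rfl⟩ := (isInvertible_mfderiv_chart hχ hpχ).surjective u
  have hX : mfderiv 𝓘(ℝ, H m) 𝓘(ℝ, E m) f p X = s • ν p := by
    refine (isInvertible_mfderiv_chart hκ hfp).injective ?_
    rw [← fderiv_paramInChart hχ hκ hf.smooth hpχ hfp, ← fieldInChart_apply (fun q ↦ s • ν q) hpχ]
    exact hu
  have hk' : IsAcceleration g f (fun q ↦ s • ν q) p k' := by
    refine ⟨X, hX, (isInvertible_mfderiv_chart hκ hfp).injective ?_⟩
    rw [map_zero, mfderiv_screenMap hf hν' hχ hκ hp hpχ hfp]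
    refine sub_eq_zero.2 (hku.trans ?_)
    rw [← hu]
    rfl
  rw [hν.range_screenMap_eq hf hI hframe hν' hp hp hk hk']
  exact Submodule.ext fun w ↦
    (hW w).trans (mem_map_range_screenMap_iff hf hν' hχ hκ hp hpχ hfp).symm

open Classical in
/-- The screen as a function of the third-order data. The data of a hypersurface determine exactly
one subspace; if there is none, the value is `⊥`. -/
def screenOfJet (F : Jet2 m × E m → ℝ) (D : Set (Jet2 m × E m)) (J : Jet3 m) :
    Submodule ℝ (E m) :=
  if h : ∃ W, IsScreenOfJet F D J W then h.choose else ⊥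

theorem IsInducedNormalization.givenByThirdOrder (hF : ContDiffOn ℝ ∞ F D)
    (hf : IsLightlikeHypersurface g f) (hI : IsRelativeInvariant g f 1 I)
    (hI0 : Nonvanishing g f I) (hID : GivenBySecondOrder F D g f I)
    (hNR : NotCharacteristicRoot g f I)
    {z : ∀ p : N, Module.Basis (Idx m) ℝ (TangentSpace 𝓘(ℝ, E m) (f p)) → Fin m → ℝ}
    {S : ∀ p : N, Submodule ℝ (TangentSpace 𝓘(ℝ, E m) (f p))}
    (hS : IsInducedNormalization g f I z S) : GivenByThirdOrder (screenOfJet F D) g f S := by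
  intro p χ hχ κ hκ hpχ hfp
  obtain ⟨U, ν, k, hp, hν, hk, hSp⟩ := hS.exists_isUnitField hf hI hI0 hNR p
  have hex : ∃ W, IsScreenOfJet F D (jet3 g f χ κ p) W :=
    ⟨_, hν.isScreenOfJet hF hf hID hχ hκ hp hpχ hfp hk⟩
  rw [screenOfJet, dif_pos hex, hSp]
  exact (hex.choose_spec.eq_map_range hF hf hI hNR.exists_isIsotropicFrame hID hν hχ hκ hp hpχ hfp
    hk).symm

end Lightlike

end

theorem theorem6 (m : ℕ) :
    (∀ (M : Type u) [TopologicalSpace M] [ChartedSpace (Lightlike.E m) M]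
        [IsManifold 𝓘(ℝ, Lightlike.E m) ∞ M]
        (N : Type v) [TopologicalSpace N] [ChartedSpace (Lightlike.H m) N]
        [IsManifold 𝓘(ℝ, Lightlike.H m) ∞ N]
        (g : Lightlike.LorentzMetric m M) (f : N → M)
        (I : ∀ p : N, TangentSpace 𝓘(ℝ, Lightlike.E m) (f p) → ℝ),
        Lightlike.IsLightlikeHypersurface g f →
        Lightlike.IsRelativeInvariant g f 1 I →
        Lightlike.Nonvanishing g f I →
        Lightlike.NotCharacteristicRoot g f I →
        (∀ (U : Set N)
            (e : ∀ q : N, Module.Basis (Lightlike.Idx m) ℝ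
              (TangentSpace 𝓘(ℝ, Lightlike.E m) (f q))),
            Lightlike.IsFrameField g f U e → ∀ p ∈ U,
            (∃ (lam : Matrix (Fin m) (Fin m) ℝ) (K : ℝ) (Ka : Fin m → ℝ),
              Lightlike.HasCoefficients g f I e p lam K Ka) ∧
            ∀ (lam : Matrix (Fin m) (Fin m) ℝ) (K : ℝ) (Ka : Fin m → ℝ),
              Lightlike.HasCoefficients g f I e p lam K Ka → ¬ lam.charpoly.IsRoot K) ∧
        ∃ (z : ∀ p : N, Module.Basis (Lightlike.Idx m) ℝ
              (TangentSpace 𝓘(ℝ, Lightlike.E m) (f p)) → Fin m → ℝ)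
          (S : ∀ p : N, Submodule ℝ (TangentSpace 𝓘(ℝ, Lightlike.E m) (f p))),
          Lightlike.IsInducedNormalization g f I z S ∧
          Lightlike.IsNormalizingObject g f z ∧
          Lightlike.IsScreenDistribution g f S ∧
          ∀ z' S', Lightlike.IsInducedNormalization g f I z' S' → S' = S) ∧
    (∀ (D : Set (Lightlike.Jet2 m × Lightlike.E m)) (F : Lightlike.Jet2 m × Lightlike.E m → ℝ),
      ContDiffOn ℝ ∞ F D →
      ∃ Φ : Lightlike.Jet3 m → Submodule ℝ (Lightlike.E m),
        ∀ (M : Type u) [TopologicalSpace M] [ChartedSpace (Lightlike.E m) M]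
          [IsManifold 𝓘(ℝ, Lightlike.E m) ∞ M]
          (N : Type v) [TopologicalSpace N] [ChartedSpace (Lightlike.H m) N]
          [IsManifold 𝓘(ℝ, Lightlike.H m) ∞ N]
          (g : Lightlike.LorentzMetric m M) (f : N → M)
          (I : ∀ p : N, TangentSpace 𝓘(ℝ, Lightlike.E m) (f p) → ℝ),
          Lightlike.IsLightlikeHypersurface g f →
          Lightlike.IsRelativeInvariant g f 1 I →
          Lightlike.Nonvanishing g f I →
          Lightlike.GivenBySecondOrder F D g f I →
          Lightlike.NotCharacteristicRoot g f I →
          ∀ z S, Lightlike.IsInducedNormalization g f I z S →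
            Lightlike.GivenByThirdOrder Φ g f S) := by

  refine ⟨fun M _ _ _ N _ _ _ g f I hf hI hI0 hNR ↦ ⟨fun U e he p hp ↦ ?_, ?_⟩, fun D F hF ↦ ?_⟩
  · exact ⟨Lightlike.exists_hasCoefficients hf he hp,
      fun lam K Ka hc ↦ hc.not_isRoot hf hI hI0 hNR he hp⟩
  · obtain ⟨z, S, hS⟩ := Lightlike.exists_isInducedNormalization hf hI hI0 hNR
    exact ⟨z, S, hS, hS.isNormalizingObject, hS.isScreenDistribution hf hI hI0 hNR,
      fun z' S' hS' ↦ hNR.eq_of_isInducedNormalization hS hS'⟩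
  · exact ⟨Lightlike.screenOfJet F D, fun M _ _ _ N _ _ _ g f I hf hI hI0 hID hNR z S hS ↦
      hS.givenByThirdOrder hF hf hI hI0 hID hNR⟩
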